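/- Let $N\ge 1$, $s\in(0,1)$, and let $\Omega\subset\mathbb{R}^N$ be an open set. Write $[v]^2=\int_{\mathbb{R}^N}\int_{\mathbb{R}^N}\frac{|v(x)-v(y)|^2}{|x-y|^{N+2s}}\,dx\,dy$, let $H^s(\mathbb{R}^N)=\{v\in L^2(\mathbb{R}^N): [v]<\infty\}$, and let $H^s_0(\Omega)$ be the closure of $C_c^\infty(\Omega)$ in $H^s(\mathbb{R}^N)$ (with respect to the norm $\|v\|_{L^2}+[v]$). Let $c\in L^\infty(\Omega)$ and let $u\in H^s_0(\Omega)\cap C(\mathbb{R}^N)$ satisfy $u=0$ in $\mathbb{R}^N\setminus\Omega$ and be a weak supersolution of $(-\Delta)^su\ge c(x)u$ in $\Omega$, that is, $$\int_{\mathbb{R}^N}\int_{\mathbb{R}^N}\frac{(u(x)-u(y))(\varphi(x)-\varphi(y))}{|x-y|^{N+2s}}\,dx\,dy\ \ge\ \int_\Omega c\,u\,\varphi\,dx\qquad\text{for every }\varphi\in H^s_0(\Omega)\text{ with }\varphi\ge0\text{ in }\Omega .$$ Let $x_0\in\partial\Omega$. Suppose that $\Omega$ satisfies an interior ball condition at $x_0$,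 i.e. there are $y_0$ and $R>0$ with $B_R(y_0)\subset\Omega$ and $x_0\in\partial B_R(y_0)$, and that $u\ge0$ in $B_\delta(x_0)$ for some $\delta>0$. Let $U$ be the Caffarelli–Silvestre extension of $u$: the function on $\mathbb{R}^N\times[0,\infty)$, smooth in $\mathbb{R}^N\times(0,\infty)$, which solves $$\operatorname{div}(t^{1-2s}\nabla U)=0\ \text{ in }\mathbb{R}^N\times(0,\infty),\qquad U(\cdot,0)=u,$$ with $U(\cdot,t)\to u$ in $L^2_{loc}(\mathbb{R}^N)$ as $t\to0^+$, $\int_{B_\rho(0)}\int_0^\rho t^{1-2s}U^2\,dt\,dx<\infty$ for every $\rho>0$, and $\int_{\mathbb{R}^N}\int_0^\infty t^{1-2s}|\nabla U|^2\,dt\,dx<\infty$. If $$\liminf_{t\to0^+}\frac{U(x_0,t)-U(x_0,0)}{t^{2s}}>0,$$ then $u$ satisfies Hopf's Lemma at $x_0$: for every ball $B_R(y_0)\subset\Omega$ with $x_0\in\partial B_R(y_0)$ and every $\beta\in(0,\frac\pi2)$, $$\liminf_{\substack{x\to x_0\\ x\in C_\beta(x_0)}}\frac{u(x)}{|x-x_0|^s}>0,\qquad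 C_\beta(x_0)=\Big\{x\in\Omega:\ \arccos\Big(\frac{x-x_0}{|x-x_0|}\cdot\frac{y_0-x_0}{|y_0-x_0|}\Big)<\beta\Big\}.$$ Both lower limits may be $+\infty$. -/

import Mathlib

open MeasureTheory Filter Topology Set
open scoped ENNReal ContDiff

namespace FractionalHopf

/-- Euclidean space `ℝ^N`. -/
abbrev Eucl (N : ℕ) : Type := EuclideanSpace ℝ (Fin N)

/-- The square of the Gagliardo seminorm of order `s`, as an extended nonnegative number. -/
noncomputable def gagliardoSq {N : ℕ} (s : ℝ) (u : Eucl N → ℝ) : ℝ≥0∞ :=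
  ∫⁻ x, ∫⁻ y, ENNReal.ofReal ((u x - u y) ^ 2 / ‖x - y‖ ^ ((N : ℝ) + 2 * s))

/-- `u ∈ H^s(ℝ^N)`. -/
def MemHs {N : ℕ} (s : ℝ) (u : Eucl N → ℝ) : Prop :=
  MemLp u 2 volume ∧ gagliardoSq s u < ⊤

/-- `u ∈ H^s_0(Ω)`: `u` is a limit in `H^s(ℝ^N)` of functions in `C_c^∞(Ω)`. -/
def MemHsZero {N : ℕ} (s : ℝ) (Ω : Set (Eucl N)) (u : Eucl N → ℝ) : Prop :=
  MemHs s u ∧ ∃ φ : ℕ → Eucl N → ℝ,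
    (∀ n, ContDiff ℝ ∞ (φ n) ∧ HasCompactSupport (φ n) ∧ tsupport (φ n) ⊆ Ω) ∧
    Tendsto (fun n => eLpNorm (fun x => u x - φ n x) 2 volume) atTop (𝓝 0) ∧
    Tendsto (fun n => gagliardoSq s (fun x => u x - φ n x)) atTop (𝓝 0)

/-- The bilinear form of the fractional Laplacian on `H^s(ℝ^N)`. -/
noncomputable def gagliardoForm {N : ℕ} (s : ℝ) (u φ : Eucl N → ℝ) : ℝ :=
  ∫ z : Eucl N × Eucl N,
    (u z.1 - u z.2) * (φ z.1 - φ z.2) / ‖z.1 - z.2‖ ^ ((N : ℝ) + 2 * s)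

/-- `u` is a weak supersolution of `(-Δ)^s u = f` in `Ω`, `u = g` in `ℝ^N \ Ω`. -/
structure IsWeakSupersolution {N : ℕ} (s : ℝ) (Ω : Set (Eucl N)) (f g u : Eucl N → ℝ) :
    Prop where
  memHs : MemHs s u
  sub_mem : MemHsZero s Ω (fun x => u x - g x)
  le_form : ∀ φ : Eucl N → ℝ, MemHsZero s Ω φ → (∀ᵐ x ∂(volume.restrict Ω), 0 ≤ φ x) →
    ∫ x in Ω, f x * φ x ≤ gagliardoForm s u φ

/-- `U` (only its values for `t ≥ 0` matter) is the Caffarelli–Silvestre extension of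
`u ∈ H^s(ℝ^N)`: the finite-energy solution of `div (t^(1-2s) ∇U) = 0` in the open upper
half-space with boundary datum `u`, which is attained in `L²_loc`. -/
structure IsCaffarelliSilvestreExtension {N : ℕ} (s : ℝ) (u : Eucl N → ℝ)
    (U : Eucl N → ℝ → ℝ) : Prop where
  smooth : ContDiffOn ℝ ∞ (fun p : Eucl N × ℝ => U p.1 p.2) {p | 0 < p.2}
  equation : ∀ x : Eucl N, ∀ t : ℝ, 0 < t →
    t ^ (1 - 2 * s) * Laplacian.laplacian (fun z => U z t) x
      + deriv (fun τ : ℝ => τ ^ (1 - 2 * s) * deriv (fun σ : ℝ => U x σ) τ) t = 0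
  boundary : ∀ x, U x 0 = u x
  trace : ∀ K : Set (Eucl N), IsCompact K →
    Tendsto (fun t : ℝ => ∫⁻ x in K, ENNReal.ofReal ((U x t - u x) ^ 2)) (𝓝[>] 0) (𝓝 0)
  locally_sq_integrable : ∀ R : ℝ, 0 < R →
    ∫⁻ x in Metric.ball (0 : Eucl N) R, ∫⁻ t in Ioo (0 : ℝ) R,
      ENNReal.ofReal (t ^ (1 - 2 * s) * U x t ^ 2) < ⊤
  finite_energy :
    ∫⁻ x : Eucl N, ∫⁻ t in Ioi (0 : ℝ),
      ENNReal.ofReal (t ^ (1 - 2 * s) *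
        (‖gradient (fun z => U z t) x‖ ^ 2 + deriv (fun σ : ℝ => U x σ) t ^ 2)) < ⊤

/-- `B_R(y₀)` is an interior ball of `Ω` at `x₀`. -/
def IsInteriorBall {N : ℕ} (Ω : Set (Eucl N)) (x₀ y₀ : Eucl N) (R : ℝ) : Prop :=
  0 < R ∧ Metric.ball y₀ R ⊆ Ω ∧ x₀ ∈ Metric.sphere y₀ R

/-- The part in `Ω` of the open cone with vertex `x₀`, axis direction `y₀ - x₀` and
half-opening `β`. -/
def cone {N : ℕ} (Ω : Set (Eucl N)) (x₀ y₀ : Eucl N) (β : ℝ) : Set (Eucl N) :=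
  {x | x ∈ Ω ∧ Real.arccos
    (inner ℝ ((‖x - x₀‖)⁻¹ • (x - x₀)) ((‖y₀ - x₀‖)⁻¹ • (y₀ - x₀))) < β}

/-- `u` satisfies Hopf's Lemma at `x₀`, for every choice of the interior ball whose centre
gives the axis of the cones. The lower limits are taken in the extended reals. -/
def SatisfiesHopfLemma {N : ℕ} (s : ℝ) (Ω : Set (Eucl N)) (u : Eucl N → ℝ)
    (x₀ : Eucl N) : Prop :=
  ∀ (y₀ : Eucl N) (R : ℝ), IsInteriorBall Ω x₀ y₀ R →
    ∀ β ∈ Ioo (0 : ℝ) (Real.pi / 2),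
      0 < liminf (fun x => ((u x / ‖x - x₀‖ ^ s : ℝ) : EReal)) (𝓝[cone Ω x₀ y₀ β] x₀)

end FractionalHopf

open FractionalHopf

/-!
Hopf's lemma holds at `x₀` because `u` has positive *far mass* there (`HasFarMass`): the values of
`u` away from `x₀`, weighted with `|x - y|^(-N-2s)`, add up to a positive amount for all poles `x`
near `x₀`. This is where the nonlocality enters, and it is the only information that the hypothesis
on the extension `U` has to supply.

**From the extension to far mass.** The extension is the Poisson integral of its boundary values,
`U(x, t) = C t^(2s) ∫ u(y) (|x-y|² + t²)^(-(N+2s)/2) dy`; only the inequality `≤` is needed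
(`IsCaffarelliSilvestreExtension.le_poisson`). Averaged in the horizontal variables, a function of
finite energy attains its boundary values uniformly with rate `t^s`, so the difference of the
averaged extension and the Poisson integral of the averaged datum grows at most like `t^s`. The
maximum principle `nonpos_of_hasWeightedLaplacianAt` applies to it: the solution `t^(2s)` is a
barrier at large heights and `|x|² - μ t²` one at large `|x|`. Since `u(x₀) = 0`, a positive lower
limit of `U(x₀, t) / t^(2s)` says that the Poisson integrals without the factor `t^(2s)` stay
bounded below. Their near part is small for one fixed small height and their far part is continuous
down to `t = 0`, while removing `t` only increases the kernel where `u ≥ 0`; this gives far mass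
(`hasFarMass_of_poisson`).

**From far mass to the lower bound.** In a small ball `B_r(z) ⊆ Ω` that touches `x₀`, compare `u`
with `κ b`, where `b(x) = (r² - |x-z|²)_+^s` (`exists_barrier_le`). If `u < κ b` somewhere, then the
mollification `v` of `u`, minus `κ b`, has a negative minimum at an interior point `x`. Testing the
supersolution inequality with the mollifying kernel centred at `x` bounds the fractional Laplacian
of `v` at `x`, an integral of second differences, from below by `-‖c‖_∞ v(x) ≥ -‖c‖_∞ κ r^(2s)`.
Comparison with the second differences of `κ b` bounds it from above by a multiple of `κ` minus the
far mass (`integral_secondDiff_add_le`), which is impossible for small `κ`. Within a cone about the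
inner normal `b` is comparable to `|x - x₀|^s`.

**The barrier.** The fractional Laplacian of `b` has to be bounded above uniformly in the ball. In
polar coordinates about `x` it is an average over directions of one-dimensional integrals, and on
each line `b` is the model profile `((p + t)(q - t))_+^s` of a chord. These integrals are bounded
uniformly in `p` and `q` (`exists_integral_chordDiff_le`): after rescaling they differ by a
controlled error from the integral for `x_+^s`, which is nonpositive by the substitution
`σ = τ / (1 + τ)` (`integral_halfLineDiff_nonpos`).
-/

namespace FractionalHopf

/-! ### The one-dimensional profile `x_+ ^ s` -/

lemma one_sub_le_rpow {s a : ℝ} (hs0 : 0 ≤ s) (hs1 : s ≤ 1) (h0 : 0 ≤ a) (h1 : a ≤ 1) :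
    1 - a ≤ (1 - a) ^ s := by
  have := Real.rpow_le_rpow_of_exponent_ge' (x := 1 - a) (by linarith) (by linarith) hs0 hs1
  simpa using this

lemma one_sub_min_le_rpow {s a : ℝ} (hs0 : 0 ≤ s) (hs1 : s ≤ 1) (h0 : 0 ≤ a) :
    1 - min 1 a ≤ (max (1 - a) 0) ^ s := by
  rcases le_total a 1 with h | h
  · rw [min_eq_right h, max_eq_left (by linarith)]
    exact one_sub_le_rpow hs0 hs1 h0 h
  · rw [min_eq_left h, sub_self]
    exact Real.rpow_nonneg (le_max_right _ _) _

lemma rpow_one_add_le {s a : ℝ} (hs1 : s ≤ 1) (h0 : 0 ≤ a) :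
    (1 + a) ^ s ≤ 1 + a := by
  have := Real.rpow_le_rpow_of_exponent_le (x := 1 + a) (by linarith) hs1
  simpa using this

lemma secondDiff_rpow_nonneg {s a : ℝ} (hs0 : 0 ≤ s) (hs1 : s ≤ 1) (h0 : 0 ≤ a) (h1 : a ≤ 1) :
    0 ≤ 2 - (1 - a) ^ s - (1 + a) ^ s := by
  have e1 := rpow_one_add_le_one_add_mul_self (s := a) (by linarith) hs0 hs1
  have e2 := rpow_one_add_le_one_add_mul_self (s := -a) (by linarith) hs0 hs1
  rw [← sub_eq_add_neg] at e2
  linarith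

lemma secondDiff_rpow_le {s a : ℝ} (hs0 : 0 ≤ s) (hs1 : s ≤ 1) (h0 : 0 ≤ a) (h1 : a ≤ 1) :
    2 - (1 - a) ^ s - (1 + a) ^ s ≤ 2 * a ^ 2 := by
  have hX : 0 ≤ (1 - a) ^ s := Real.rpow_nonneg (by linarith) _
  have hY : 0 ≤ (1 + a) ^ s := Real.rpow_nonneg (by linarith) _
  have hXY : 1 - a ^ 2 ≤ (1 - a) ^ s * (1 + a) ^ s := by
    rw [← Real.mul_rpow (by linarith) (by linarith), show (1 - a) * (1 + a) = 1 - a ^ 2 by ring]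
    exact one_sub_le_rpow hs0 hs1 (by positivity) (by nlinarith)
  have ha2 : 0 ≤ 1 - a ^ 2 := by nlinarith
  have : 2 * (1 - a ^ 2) ≤ (1 - a) ^ s + (1 + a) ^ s := by
    refine (sq_le_sq₀ (by linarith) (by linarith)).1 ?_
    nlinarith [sq_nonneg ((1 - a) ^ s - (1 + a) ^ s)]
  linarith

/-- Second difference at `1` of the one-dimensional profile `x ↦ x_+ ^ s`. -/
noncomputable def halfLineDiff (s τ : ℝ) : ℝ := 2 - (max (1 - τ) 0) ^ s - (1 + τ) ^ s

lemma measurable_halfLineDiff (s : ℝ) : Measurable (halfLineDiff s) := by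
  unfold halfLineDiff; fun_prop

lemma abs_halfLineDiff_le_of_le_one {s τ : ℝ} (hs0 : 0 ≤ s) (hs1 : s ≤ 1) (h0 : 0 ≤ τ)
    (h1 : τ ≤ 1) : |halfLineDiff s τ| ≤ 2 * τ ^ 2 := by
  unfold halfLineDiff
  rw [max_eq_left (by linarith), abs_of_nonneg (secondDiff_rpow_nonneg hs0 hs1 h0 h1)]
  exact secondDiff_rpow_le hs0 hs1 h0 h1

lemma rpow_one_add_le_two_mul {s τ : ℝ} (hs0 : 0 ≤ s) (hs1 : s ≤ 1) (h1 : 1 ≤ τ) :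
    (1 + τ) ^ s ≤ 2 * τ ^ s := by
  calc (1 + τ) ^ s ≤ (2 * τ) ^ s := Real.rpow_le_rpow (by linarith) (by linarith) hs0
    _ = 2 ^ s * τ ^ s := Real.mul_rpow (by norm_num) (by linarith)
    _ ≤ 2 * τ ^ s := by
        gcongr
        simpa using Real.rpow_le_rpow_of_exponent_le (x := 2) (by norm_num) hs1

lemma abs_halfLineDiff_le_of_one_le {s τ : ℝ} (hs0 : 0 < s) (hs1 : s ≤ 1) (h1 : 1 ≤ τ) :
    |halfLineDiff s τ| ≤ 2 * τ ^ s := by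
  unfold halfLineDiff
  rw [max_eq_right (by linarith), Real.zero_rpow hs0.ne', abs_le]
  have e1 := rpow_one_add_le_two_mul hs0.le hs1 h1
  have e2 : 1 ≤ τ ^ s := Real.one_le_rpow h1 hs0.le
  have e3 : 1 ≤ (1 + τ) ^ s := Real.one_le_rpow (by linarith) hs0.le
  constructor <;> linarith

lemma integrableOn_Ioc_rpow {r a : ℝ} (hr : -1 < r) (ha : 0 ≤ a) :
    IntegrableOn (fun τ : ℝ => τ ^ r) (Ioc 0 a) :=
  (intervalIntegrable_iff_integrableOn_Ioc_of_le ha).1 (intervalIntegral.intervalIntegrable_rpow' hr)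

lemma setIntegral_Ioc_rpow {r a : ℝ} (hr : -1 < r) (ha : 0 ≤ a) :
    ∫ τ in Ioc 0 a, τ ^ r = a ^ (r + 1) / (r + 1) := by
  rw [← intervalIntegral.integral_of_le ha, integral_rpow (Or.inl hr),
    Real.zero_rpow (by linarith), sub_zero]

lemma integrableOn_halfLineDiff {s : ℝ} (hs0 : 0 < s) (hs1 : s < 1) :
    IntegrableOn (fun τ => halfLineDiff s τ * τ ^ (-1 - 2 * s)) (Ioi 0) := by
  rw [← Ioc_union_Ioi_eq_Ioi (zero_le_one' ℝ)]
  have hm : Measurable (fun τ => halfLineDiff s τ * τ ^ (-1 - 2 * s)) :=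
    (measurable_halfLineDiff s).mul (by fun_prop)
  refine IntegrableOn.union ?_ ?_
  · refine Integrable.mono' ((integrableOn_Ioc_rpow (r := 1 - 2 * s) (by linarith)
      zero_le_one).const_mul 2) hm.aestronglyMeasurable ?_
    filter_upwards [ae_restrict_mem measurableSet_Ioc] with τ hτ
    rw [norm_mul, Real.norm_eq_abs, Real.norm_eq_abs,
      abs_of_nonneg (Real.rpow_nonneg hτ.1.le _)]
    calc _ ≤ 2 * τ ^ 2 * τ ^ (-1 - 2 * s) := by
          have := hτ.1
          gcongr
          exact abs_halfLineDiff_le_of_le_one hs0.le hs1.le hτ.1.le hτ.2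
      _ = 2 * τ ^ (1 - 2 * s) := by
          rw [mul_assoc, ← Real.rpow_natCast, ← Real.rpow_add hτ.1]; norm_num; ring_nf
  · refine Integrable.mono' ((integrableOn_Ioi_rpow_of_lt (a := -1 - s) (by linarith)
      zero_lt_one).const_mul 2) hm.aestronglyMeasurable ?_
    filter_upwards [ae_restrict_mem measurableSet_Ioi] with τ hτ
    have h0 : 0 < τ := lt_trans zero_lt_one hτ
    rw [norm_mul, Real.norm_eq_abs, Real.norm_eq_abs,
      abs_of_nonneg (Real.rpow_nonneg h0.le _)]
    calc _ ≤ 2 * τ ^ s * τ ^ (-1 - 2 * s) := by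
          gcongr
          exact abs_halfLineDiff_le_of_one_le hs0 hs1.le (le_of_lt hτ)
      _ = 2 * τ ^ (-1 - s) := by
          rw [mul_assoc, ← Real.rpow_add h0]; ring_nf

/-- The density into which `((1 + τ) ^ s - 1) τ ^ (-1 - 2s) dτ` is turned by `σ = τ / (1 + τ)`. -/
noncomputable def mobiusDensity (s σ : ℝ) : ℝ :=
  ((1 - σ) ^ (s - 1) - (1 - σ) ^ (2 * s - 1)) * σ ^ (-1 - 2 * s)

lemma mobiusDensity_nonneg {s σ : ℝ} (hs0 : 0 < s) (h0 : 0 < σ) (h1 : σ < 1) :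
    0 ≤ mobiusDensity s σ := by
  unfold mobiusDensity
  refine mul_nonneg (sub_nonneg.2 ?_) (Real.rpow_nonneg h0.le _)
  exact Real.rpow_le_rpow_of_exponent_ge (by linarith) (by linarith) (by linarith)

lemma image_mobius {a : ℝ} (ha : 0 < a) :
    (fun σ : ℝ => σ / (1 - σ)) '' Ioo (a / (1 + a)) 1 = Ioi a := by
  ext τ
  simp only [mem_image, mem_Ioo, mem_Ioi]
  constructor
  · rintro ⟨σ, ⟨h1, h2⟩, rfl⟩
    rw [div_lt_iff₀ (by linarith)] at h1
    rw [lt_div_iff₀ (by linarith)]; linarith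
  · intro h
    refine ⟨τ / (1 + τ), ⟨?_, ?_⟩, ?_⟩
    · rw [div_lt_div_iff₀ (by linarith) (by linarith)]; linarith
    · rw [div_lt_one (by linarith)]; linarith
    · have : 1 + τ ≠ 0 := by linarith
      field_simp
      ring

lemma integrableOn_one_add_rpow_sub_one {s a : ℝ} (hs0 : 0 < s) (hs1 : s < 1) (ha : 0 < a) :
    IntegrableOn (fun τ => ((1 + τ) ^ s - 1) * τ ^ (-1 - 2 * s)) (Ioi a) := by
  have h1 := (integrableOn_halfLineDiff hs0 hs1).mono_set (Ioi_subset_Ioi ha.le)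
  have h2 : IntegrableOn (fun τ => (1 - (max (1 - τ) 0) ^ s) * τ ^ (-1 - 2 * s)) (Ioi a) := by
    refine Integrable.mono' (integrableOn_Ioi_rpow_of_lt (a := -1 - 2 * s) (by linarith) ha)
      (by fun_prop) ?_
    filter_upwards [ae_restrict_mem measurableSet_Ioi] with τ hτ
    have h0 : 0 < τ := lt_trans ha hτ
    rw [norm_mul, Real.norm_eq_abs, Real.norm_eq_abs,
      abs_of_nonneg (Real.rpow_nonneg h0.le _)]
    refine mul_le_of_le_one_left (Real.rpow_nonneg h0.le _) ?_
    have e1 : 0 ≤ (max (1 - τ) 0) ^ s := Real.rpow_nonneg (le_max_right _ _) _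
    have e2 : (max (1 - τ) 0) ^ s ≤ 1 :=
      Real.rpow_le_one (le_max_right _ _) (max_le (by linarith) zero_le_one) hs0.le
    rw [abs_le]; constructor <;> linarith
  refine (h2.sub h1).congr ?_
  refine Eventually.of_forall fun τ => ?_
  simp only [halfLineDiff, Pi.sub_apply]
  ring

lemma mobius_subst {s a : ℝ} (hs0 : 0 < s) (hs1 : s < 1) (ha : 0 < a) :
    IntegrableOn (mobiusDensity s) (Ioo (a / (1 + a)) 1) ∧
    ∫ τ in Ioi a, ((1 + τ) ^ s - 1) * τ ^ (-1 - 2 * s)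
      = ∫ σ in Ioo (a / (1 + a)) 1, mobiusDensity s σ := by
  have hpos : 0 < a / (1 + a) := by positivity
  have hd : ∀ σ ∈ Ioo (a / (1 + a)) 1, HasDerivWithinAt (fun σ : ℝ => σ / (1 - σ))
      (1 / (1 - σ) ^ 2) (Ioo (a / (1 + a)) 1) σ := by
    intro σ hσ
    have h1 : 1 - σ ≠ 0 := by linarith [hσ.2]
    have := ((hasDerivAt_id σ).div ((hasDerivAt_const σ (1 : ℝ)).sub (hasDerivAt_id σ)) h1)
    refine this.hasDerivWithinAt.congr_deriv ?_
    simp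
  have hinj : InjOn (fun σ : ℝ => σ / (1 - σ)) (Ioo (a / (1 + a)) 1) := by
    intro x hx y hy h
    have h1 : 1 - x ≠ 0 := by linarith [hx.2]
    have h2 : 1 - y ≠ 0 := by linarith [hy.2]
    simp only at h
    field_simp at h
    linarith
  have heq : EqOn (fun σ => |1 / (1 - σ) ^ 2| •
      (((1 + σ / (1 - σ)) ^ s - 1) * (σ / (1 - σ)) ^ (-1 - 2 * s))) (mobiusDensity s)
      (Ioo (a / (1 + a)) 1) := by
    intro σ hσ
    have h0 : 0 < σ := hpos.trans hσ.1
    have h1 : 0 < 1 - σ := by linarith [hσ.2]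
    have e1 : 1 + σ / (1 - σ) = (1 - σ)⁻¹ := by field_simp; ring
    simp only [e1, mobiusDensity, smul_eq_mul]
    rw [abs_of_nonneg (by positivity), Real.div_rpow h0.le h1.le, Real.inv_rpow h1.le,
      ← Real.rpow_neg h1.le, div_eq_mul_inv (σ ^ _), ← Real.rpow_neg h1.le, one_div,
      ← Real.rpow_natCast (1 - σ) 2, ← Real.rpow_neg h1.le]
    have e2 : (1 - σ) ^ (s - 1) = (1 - σ) ^ (-((2 : ℕ) : ℝ)) * (1 - σ) ^ (-s) *
        (1 - σ) ^ (-(-1 - 2 * s)) := by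
      rw [← Real.rpow_add h1, ← Real.rpow_add h1]; norm_num; ring_nf
    have e3 : (1 - σ) ^ (2 * s - 1) = (1 - σ) ^ (-((2 : ℕ) : ℝ)) *
        (1 - σ) ^ (-(-1 - 2 * s)) := by
      rw [← Real.rpow_add h1]; norm_num; ring_nf
    rw [e2, e3]; ring
  constructor
  · have := (integrableOn_image_iff_integrableOn_abs_deriv_smul measurableSet_Ioo hd hinj
      (fun τ : ℝ => ((1 + τ) ^ s - 1) * τ ^ (-1 - 2 * s))).1
      (by rw [image_mobius ha]; exact integrableOn_one_add_rpow_sub_one hs0 hs1 ha)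
    exact this.congr_fun heq measurableSet_Ioo
  · have := integral_image_eq_integral_abs_deriv_smul measurableSet_Ioo hd hinj
      (fun τ : ℝ => ((1 + τ) ^ s - 1) * τ ^ (-1 - 2 * s))
    rw [image_mobius ha] at this
    rw [this]
    exact setIntegral_congr_fun measurableSet_Ioo heq

/-- The difference of the two integrands has an elementary primitive, which makes the cancellation
in `integral_halfLineDiff_nonpos` explicit. -/
lemma hasDerivAt_mobius_primitive {s σ : ℝ} (hs0 : 0 < s) (h0 : 0 < σ) (h1 : σ < 1) :
    HasDerivAt (fun σ : ℝ => -(1 / (2 * s)) * (σ ^ (-(2 * s)) * (1 - (1 - σ) ^ s) ^ 2))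
      ((1 - (1 - σ) ^ s) * σ ^ (-1 - 2 * s) - mobiusDensity s σ) σ := by
  have hσ : 0 < 1 - σ := by linarith
  have d1 : HasDerivAt (fun σ : ℝ => (1 - σ) ^ s) (-1 * s * (1 - σ) ^ (s - 1)) σ :=
    HasDerivAt.rpow_const ((hasDerivAt_id σ).const_sub 1) (Or.inl hσ.ne')
  have d2 : HasDerivAt (fun σ : ℝ => σ ^ (-(2 * s))) (-(2 * s) * σ ^ (-(2 * s) - 1)) σ :=
    Real.hasDerivAt_rpow_const (Or.inl h0.ne')
  have d3 := (d2.mul ((d1.const_sub 1).pow 2)).const_mul (-(1 / (2 * s)))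
  refine d3.congr_deriv ?_
  unfold mobiusDensity
  have e1 : (1 - σ) ^ s = (1 - σ) * (1 - σ) ^ (s - 1) := by
    rw [← Real.rpow_one_add' hσ.le (by simpa using hs0.ne')]; ring_nf
  have e2 : (1 - σ) ^ (2 * s - 1) = (1 - σ) * (1 - σ) ^ (s - 1) * (1 - σ) ^ (s - 1) := by
    rw [← e1, ← Real.rpow_add hσ]; ring_nf
  have e3 : σ ^ (-(2 * s)) = σ * σ ^ (-1 - 2 * s) := by
    rw [← Real.rpow_one_add' h0.le (by linarith)]; ring_nf
  rw [e3, show -(2 * s) - 1 = -1 - 2 * s by ring, e2]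
  simp only [Pi.pow_apply]
  rw [e1]
  field_simp
  ring

/-- The fractional Laplacian of `x_+ ^ s` is nonpositive at `1` (in fact it vanishes). Cut off at
`a`, the integral of `(1 + τ) ^ s - 1` becomes under `σ = τ / (1 + τ)` one over `(a / (1 + a), 1)`;
restricting it to `(a, 1)` does not increase it, and the remaining difference is integrated in
closed form, up to terms of order `a ^ (2 - 2s)`. -/
lemma integral_halfLineDiff_nonpos {s : ℝ} (hs0 : 0 < s) (hs1 : s < 1) :
    ∫ τ in Ioi 0, halfLineDiff s τ * τ ^ (-1 - 2 * s) ≤ 0 := by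
  have key : ∀ a ∈ Ioo (0 : ℝ) 1, ∫ τ in Ioi 0, halfLineDiff s τ * τ ^ (-1 - 2 * s)
      ≤ (1 / (1 - s) + 1 / (2 * s)) * a ^ (2 - 2 * s) := by
    rintro a ⟨ha0, ha1⟩
    have hint := integrableOn_halfLineDiff hs0 hs1
    rw [← Ioc_union_Ioi_eq_Ioi ha0.le, setIntegral_union Ioc_disjoint_Ioi_same
      measurableSet_Ioi (hint.mono_set Ioc_subset_Ioi_self)
      (hint.mono_set (Ioi_subset_Ioi ha0.le))]
    have near : ∫ τ in Ioc 0 a, halfLineDiff s τ * τ ^ (-1 - 2 * s)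
        ≤ 1 / (1 - s) * a ^ (2 - 2 * s) := by
      have : ∫ τ in Ioc 0 a, halfLineDiff s τ * τ ^ (-1 - 2 * s)
          ≤ ∫ τ in Ioc 0 a, 2 * τ ^ (1 - 2 * s) := by
        refine setIntegral_mono_on (hint.mono_set Ioc_subset_Ioi_self)
          ((integrableOn_Ioc_rpow (by linarith) ha0.le).const_mul 2) measurableSet_Ioc ?_
        intro τ hτ
        calc _ ≤ 2 * τ ^ 2 * τ ^ (-1 - 2 * s) := by
              have := hτ.1
              gcongr
              exact (le_abs_self _).trans
                (abs_halfLineDiff_le_of_le_one hs0.le hs1.le hτ.1.le (hτ.2.trans ha1.le))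
          _ = 2 * τ ^ (1 - 2 * s) := by
              rw [mul_assoc, ← Real.rpow_natCast, ← Real.rpow_add hτ.1]; norm_num; ring_nf
      refine this.trans (le_of_eq ?_)
      rw [integral_const_mul, setIntegral_Ioc_rpow (by linarith) ha0.le,
        show 1 - 2 * s + 1 = 2 - 2 * s by ring]
      have : 1 - s ≠ 0 := by linarith
      have : 2 - 2 * s ≠ 0 := by linarith
      field_simp
    -- the part beyond `a`, split into the two one-sided differences
    have h2 := integrableOn_one_add_rpow_sub_one hs0 hs1 ha0
    have h1 : IntegrableOn (fun τ => (1 - (max (1 - τ) 0) ^ s) * τ ^ (-1 - 2 * s)) (Ioi a) := by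
      refine ((hint.mono_set (Ioi_subset_Ioi ha0.le)).add h2).congr
        (Eventually.of_forall fun τ => ?_)
      simp only [halfLineDiff, Pi.add_apply]; ring
    have hsplit : ∫ τ in Ioi a, halfLineDiff s τ * τ ^ (-1 - 2 * s)
        = (∫ τ in Ioi a, (1 - (max (1 - τ) 0) ^ s) * τ ^ (-1 - 2 * s))
          - ∫ τ in Ioi a, ((1 + τ) ^ s - 1) * τ ^ (-1 - 2 * s) := by
      rw [← integral_sub h1 h2]
      refine integral_congr_ae (Eventually.of_forall fun τ => ?_)
      simp only [halfLineDiff]; ring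
    obtain ⟨hk, hsub⟩ := mobius_subst hs0 hs1 ha0
    have haa : a / (1 + a) < a := by
      rw [div_lt_iff₀ (by linarith)]; nlinarith
    have hk1 : ∫ σ in Ioo a 1, mobiusDensity s σ
        ≤ ∫ σ in Ioo (a / (1 + a)) 1, mobiusDensity s σ := by
      refine setIntegral_mono_set hk ?_ (Ioo_subset_Ioo_left haa.le).eventuallyLE
      filter_upwards [ae_restrict_mem measurableSet_Ioo] with σ hσ
      exact mobiusDensity_nonneg hs0 (lt_trans (by positivity) hσ.1) hσ.2
    have htail : ∫ τ in Ioi a, (1 - (max (1 - τ) 0) ^ s) * τ ^ (-1 - 2 * s)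
        = (∫ τ in Ioo a 1, (1 - (1 - τ) ^ s) * τ ^ (-1 - 2 * s)) + 1 / (2 * s) := by
      rw [← Ioc_union_Ioi_eq_Ioi ha1.le] at h1 ⊢
      rw [setIntegral_union Ioc_disjoint_Ioi_same measurableSet_Ioi
        (h1.mono_set subset_union_left) (h1.mono_set subset_union_right)]
      congr 1
      · rw [integral_Ioc_eq_integral_Ioo]
        refine setIntegral_congr_fun measurableSet_Ioo fun τ hτ => ?_
        rw [max_eq_left (by linarith [hτ.2])]
      · have : ∫ τ in Ioi (1 : ℝ), (1 - (max (1 - τ) 0) ^ s) * τ ^ (-1 - 2 * s)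
            = ∫ τ in Ioi (1 : ℝ), τ ^ (-1 - 2 * s) := by
          refine setIntegral_congr_fun measurableSet_Ioi fun τ hτ => ?_
          have : (1 : ℝ) < τ := hτ
          rw [max_eq_right (by linarith), Real.zero_rpow hs0.ne']; ring
        rw [this, integral_Ioi_rpow_of_lt (by linarith) zero_lt_one, Real.one_rpow]
        have : -1 - 2 * s + 1 = -(2 * s) := by ring
        rw [this, neg_div_neg_eq]
    have hki : IntegrableOn (mobiusDensity s) (Ioo a 1) :=
      hk.mono_set (Ioo_subset_Ioo_left haa.le)
    have h1i : IntegrableOn (fun τ => (1 - (1 - τ) ^ s) * τ ^ (-1 - 2 * s)) (Ioo a 1) := by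
      refine (h1.mono_set Ioo_subset_Ioi_self).congr_fun (fun τ hτ => ?_) measurableSet_Ioo
      simp only
      rw [max_eq_left (by linarith [hτ.2])]
    have hftc : ∫ σ in Ioo a 1, ((1 - (1 - σ) ^ s) * σ ^ (-1 - 2 * s) - mobiusDensity s σ)
        = -(1 / (2 * s)) + 1 / (2 * s) * (a ^ (-(2 * s)) * (1 - (1 - a) ^ s) ^ 2) := by
      rw [← integral_Ioc_eq_integral_Ioo, ← intervalIntegral.integral_of_le ha1.le,
        intervalIntegral.integral_eq_sub_of_hasDerivAt_of_le ha1.le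
          (f := fun σ : ℝ => -(1 / (2 * s)) * (σ ^ (-(2 * s)) * (1 - (1 - σ) ^ s) ^ 2))]
      · simp [Real.zero_rpow hs0.ne']
      · refine ContinuousOn.mul continuousOn_const (ContinuousOn.mul ?_ ?_)
        · exact fun x hx => (Real.continuousAt_rpow_const _ _
            (Or.inl (by linarith [hx.1]))).continuousWithinAt
        · refine (ContinuousOn.pow (continuousOn_const.sub ?_) 2)
          exact (continuousOn_const.sub continuousOn_id).rpow_const fun x hx => Or.inr hs0.le
      · exact fun σ hσ => hasDerivAt_mobius_primitive hs0 (ha0.trans hσ.1) hσ.2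
      · rw [intervalIntegrable_iff_integrableOn_Ioo_of_le ha1.le]
        exact h1i.sub hki
    rw [integral_sub h1i hki] at hftc
    have hbd : a ^ (-(2 * s)) * (1 - (1 - a) ^ s) ^ 2 ≤ a ^ (2 - 2 * s) := by
      have e1 := one_sub_le_rpow hs0.le hs1.le ha0.le ha1.le
      have e2 : (1 - a) ^ s ≤ 1 := Real.rpow_le_one (by linarith) (by linarith) hs0.le
      have e3 : (1 - (1 - a) ^ s) ^ 2 ≤ a ^ 2 := by
        apply pow_le_pow_left₀ <;> linarith
      calc _ ≤ a ^ (-(2 * s)) * a ^ 2 := by gcongr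
        _ = a ^ (2 - 2 * s) := by
          rw [← Real.rpow_natCast, ← Real.rpow_add ha0]; norm_num; ring_nf
    have hbd' := mul_le_mul_of_nonneg_left hbd (show 0 ≤ 1 / (2 * s) by positivity)
    rw [hsplit, hsub, htail]
    linarith
  have hlim : Tendsto (fun a : ℝ => (1 / (1 - s) + 1 / (2 * s)) * a ^ (2 - 2 * s)) (𝓝[>] 0)
      (𝓝 0) := by
    have : Tendsto (fun a : ℝ => a ^ (2 - 2 * s)) (𝓝 0) (𝓝 (0 ^ (2 - 2 * s))) :=
      (Real.continuousAt_rpow_const 0 _ (Or.inr (by linarith))).tendsto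
    rw [Real.zero_rpow (by linarith)] at this
    simpa using (this.mono_left nhdsWithin_le_nhds).const_mul (1 / (1 - s) + 1 / (2 * s))
  refine ge_of_tendsto hlim ?_
  filter_upwards [Ioo_mem_nhdsGT (zero_lt_one' ℝ)] with a ha using key a ha

/-! ### The profile of the barrier on a chord -/

/-- Second difference at the origin of the one-dimensional profile
`x ↦ ((1 + x)(1 - ε x))_+ ^ s`, which vanishes at `-1` and at `1 / ε`. -/
noncomputable def intervalDiff (s ε τ : ℝ) : ℝ :=
  2 - (max (1 - τ) 0) ^ s * (1 + ε * τ) ^ s - (1 + τ) ^ s * (max (1 - ε * τ) 0) ^ s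

lemma intervalDiff_le_of_le_one {s ε τ : ℝ} (hs0 : 0 < s) (hs1 : s < 1) (hε0 : 0 < ε)
    (hε1 : ε ≤ 1) (h0 : 0 ≤ τ) (h1 : τ ≤ 1) :
    |intervalDiff s ε τ - halfLineDiff s τ| ≤ 4 * ε * τ ^ 2 := by
  have hετ : ε * τ ≤ 1 := by nlinarith
  have hετ0 : 0 ≤ ε * τ := by positivity
  unfold intervalDiff halfLineDiff
  rw [max_eq_left (by linarith), max_eq_left (by linarith)]
  have a1 := rpow_one_add_le hs1.le h0
  have a2 := one_sub_le_rpow hs0.le hs1.le h0 h1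
  have a3 := one_sub_le_rpow hs0.le hs1.le hετ0 hετ
  have a4 := secondDiff_rpow_le hs0.le hs1.le hετ0 hετ
  have a4' := secondDiff_rpow_nonneg hs0.le hs1.le hετ0 hετ
  have a5 : (1 - τ) ^ s ≤ 1 := Real.rpow_le_one (by linarith) (by linarith) hs0.le
  have a6 : (1 - ε * τ) ^ s ≤ 1 := Real.rpow_le_one (by linarith) (by linarith) hs0.le
  have a7 : 0 ≤ (1 - τ) ^ s := Real.rpow_nonneg (by linarith) _
  have a8 : 1 ≤ (1 + τ) ^ s := Real.one_le_rpow (by linarith) hs0.le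
  have e : 2 - (1 - τ) ^ s * (1 + ε * τ) ^ s - (1 + τ) ^ s * (1 - ε * τ) ^ s
      - (2 - (1 - τ) ^ s - (1 + τ) ^ s)
      = ((1 + τ) ^ s - (1 - τ) ^ s) * (1 - (1 - ε * τ) ^ s)
        + (1 - τ) ^ s * (2 - (1 - ε * τ) ^ s - (1 + ε * τ) ^ s) := by ring
  rw [e, abs_of_nonneg (add_nonneg (mul_nonneg (by linarith) (by linarith))
    (mul_nonneg a7 a4'))]
  have b1 : ((1 + τ) ^ s - (1 - τ) ^ s) * (1 - (1 - ε * τ) ^ s) ≤ (2 * τ) * (ε * τ) :=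
    mul_le_mul (by linarith) (by linarith) (by linarith) (by linarith)
  have b2 : (1 - τ) ^ s * (2 - (1 - ε * τ) ^ s - (1 + ε * τ) ^ s) ≤ 1 * (2 * (ε * τ) ^ 2) :=
    mul_le_mul a5 a4 a4' zero_le_one
  have b3 : (ε * τ) ^ 2 ≤ ε * τ ^ 2 := by
    rw [mul_pow]; exact mul_le_mul_of_nonneg_right (by nlinarith) (sq_nonneg _)
  nlinarith

lemma intervalDiff_le_of_one_le {s ε τ : ℝ} (hs0 : 0 < s) (hs1 : s < 1) (hε0 : 0 < ε)
    (h1 : 1 ≤ τ) :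
    |intervalDiff s ε τ - halfLineDiff s τ| ≤ 2 * τ ^ s * min 1 (ε * τ) := by
  have hετ0 : 0 ≤ ε * τ := by positivity
  unfold intervalDiff halfLineDiff
  rw [max_eq_right (by linarith), Real.zero_rpow hs0.ne']
  have e : 2 - 0 * (1 + ε * τ) ^ s - (1 + τ) ^ s * (max (1 - ε * τ) 0) ^ s
      - (2 - 0 - (1 + τ) ^ s) = (1 + τ) ^ s * (1 - (max (1 - ε * τ) 0) ^ s) := by ring
  have a1 := one_sub_min_le_rpow hs0.le hs1.le hετ0
  have a2 : (max (1 - ε * τ) 0) ^ s ≤ 1 :=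
    Real.rpow_le_one (le_max_right _ _) (max_le (by linarith) zero_le_one) hs0.le
  have a3 := rpow_one_add_le_two_mul hs0.le hs1.le h1
  have a4 : 0 ≤ (1 + τ) ^ s := Real.rpow_nonneg (by linarith) _
  rw [e, abs_of_nonneg (mul_nonneg a4 (by linarith))]
  exact mul_le_mul a3 (by linarith) (by linarith) (by positivity)

/-- The weight `x ^ (-1 - s) min 1 x`, whose rescalings dominate the difference between the second
differences on an interval and on the half-line at distances `τ ≥ 1`. -/
noncomputable def tailWeight (s x : ℝ) : ℝ := x ^ (-1 - s) * min 1 x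

lemma integrableOn_tailWeight {s : ℝ} (hs0 : 0 < s) (hs1 : s < 1) :
    IntegrableOn (tailWeight s) (Ioi 0) := by
  rw [← Ioc_union_Ioi_eq_Ioi (zero_le_one' ℝ)]
  refine IntegrableOn.union ?_ ?_
  · refine (integrableOn_Ioc_rpow (r := -s) (by linarith) zero_le_one).congr_fun
      (fun x hx => ?_) measurableSet_Ioc
    unfold tailWeight
    rw [min_eq_right hx.2, ← Real.rpow_add_one hx.1.ne']
    ring_nf
  · refine (integrableOn_Ioi_rpow_of_lt (a := -1 - s) (by linarith) zero_lt_one).congr_fun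
      (fun x hx => ?_) measurableSet_Ioi
    unfold tailWeight
    rw [min_eq_left (le_of_lt hx), mul_one]

/-- Uniformly in `ε`, the integral of the second difference is `O(ε ^ s)`: it exceeds the
nonpositive integral for the half-line by a curvature error of that order. -/
lemma exists_integral_intervalDiff_le {s : ℝ} (hs0 : 0 < s) (hs1 : s < 1) :
    ∃ L : ℝ, 0 < L ∧ ∀ ε : ℝ, 0 < ε → ε ≤ 1 →
      IntegrableOn (fun τ => intervalDiff s ε τ * τ ^ (-1 - 2 * s)) (Ioi 0) ∧
      ∫ τ in Ioi 0, intervalDiff s ε τ * τ ^ (-1 - 2 * s) ≤ L * ε ^ s := by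
  set T := ∫ x in Ioi 0, tailWeight s x
  have hT : 0 ≤ T := setIntegral_nonneg measurableSet_Ioi fun x hx => by
    have : (0 : ℝ) < x := hx
    unfold tailWeight; positivity
  refine ⟨2 / (1 - s) + 2 * T, ?_, fun ε hε0 hε1 => ?_⟩
  · have : 0 < 1 - s := by linarith
    positivity
  have hF := integrableOn_halfLineDiff hs0 hs1
  set M : ℝ → ℝ := fun τ => (Ioc 0 1).indicator (fun τ => 4 * ε * τ ^ (1 - 2 * s)) τ
    + 2 * ε ^ (1 + s) * tailWeight s (ε * τ) with hM
  have hM1 : IntegrableOn ((Ioc 0 1).indicator (fun τ : ℝ => 4 * ε * τ ^ (1 - 2 * s))) (Ioi 0) :=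
    ((integrable_indicator_iff measurableSet_Ioc).2
      ((integrableOn_Ioc_rpow (by linarith) zero_le_one).const_mul _)).integrableOn
  have hM2 : IntegrableOn (fun τ => 2 * ε ^ (1 + s) * tailWeight s (ε * τ)) (Ioi 0) := by
    refine Integrable.const_mul ?_ _
    have := (integrableOn_Ioi_comp_mul_left_iff (tailWeight s) 0 hε0).2
      (by simpa using integrableOn_tailWeight hs0 hs1)
    exact this
  have hMi : IntegrableOn M (Ioi 0) := hM1.add hM2
  have hbound : ∀ τ ∈ Ioi (0 : ℝ),
      |intervalDiff s ε τ * τ ^ (-1 - 2 * s) - halfLineDiff s τ * τ ^ (-1 - 2 * s)| ≤ M τ := by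
    intro τ hτ
    have hτ0 : (0 : ℝ) < τ := hτ
    have hw : 0 ≤ τ ^ (-1 - 2 * s) := Real.rpow_nonneg hτ0.le _
    rw [← sub_mul, abs_mul, abs_of_nonneg hw]
    rcases le_or_gt τ 1 with h | h
    · have : (0 : ℝ) ≤ 2 * ε ^ (1 + s) * tailWeight s (ε * τ) := by
        unfold tailWeight; positivity
      simp only [hM]
      rw [indicator_of_mem (show τ ∈ Ioc (0 : ℝ) 1 from ⟨hτ0, h⟩)]
      have e := mul_le_mul_of_nonneg_right
        (intervalDiff_le_of_le_one hs0 hs1 hε0 hε1 hτ0.le h) hw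
      have e2 : 4 * ε * τ ^ 2 * τ ^ (-1 - 2 * s) = 4 * ε * τ ^ (1 - 2 * s) := by
        rw [mul_assoc, ← Real.rpow_natCast, ← Real.rpow_add hτ0]
        congr 2; push_cast; ring
      linarith
    · simp only [hM]
      rw [indicator_of_notMem (fun hh => absurd hh.2 (not_le.2 h)), zero_add]
      refine (mul_le_mul_of_nonneg_right
        (intervalDiff_le_of_one_le hs0 hs1 hε0 h.le) hw).trans (le_of_eq ?_)
      unfold tailWeight
      have e1 : τ ^ s * τ ^ (-1 - 2 * s) = τ ^ (-1 - s) := by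
        rw [← Real.rpow_add hτ0]; ring_nf
      have e2 : ε ^ (1 + s) * ε ^ (-1 - s) = 1 := by
        rw [← Real.rpow_add hε0]; ring_nf; simp
      rw [Real.mul_rpow hε0.le hτ0.le]
      calc _ = 2 * (τ ^ s * τ ^ (-1 - 2 * s)) * min 1 (ε * τ) := by ring
        _ = 2 * (ε ^ (1 + s) * ε ^ (-1 - s)) * τ ^ (-1 - s) * min 1 (ε * τ) := by
          rw [e1, e2]; ring
        _ = _ := by ring
  have hDi : IntegrableOn (fun τ => intervalDiff s ε τ * τ ^ (-1 - 2 * s)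
      - halfLineDiff s τ * τ ^ (-1 - 2 * s)) (Ioi 0) := by
    refine Integrable.mono' hMi ?_ ?_
    · unfold intervalDiff halfLineDiff; fun_prop
    · filter_upwards [ae_restrict_mem measurableSet_Ioi] with τ hτ using hbound τ hτ
  have hI : IntegrableOn (fun τ => intervalDiff s ε τ * τ ^ (-1 - 2 * s)) (Ioi 0) := by
    refine (hDi.add hF).congr (Eventually.of_forall fun τ => ?_)
    simp
  refine ⟨hI, ?_⟩
  have h1 : ∫ τ in Ioi 0, intervalDiff s ε τ * τ ^ (-1 - 2 * s)
      ≤ ∫ τ in Ioi 0, (halfLineDiff s τ * τ ^ (-1 - 2 * s) + M τ) := by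
    refine setIntegral_mono_on hI (hF.add hMi) measurableSet_Ioi fun τ hτ => ?_
    linarith [(abs_le.1 (hbound τ hτ)).2]
  rw [integral_add hF hMi] at h1
  have h2 : ∫ τ in Ioi 0, M τ = 2 * ε / (1 - s) + 2 * ε ^ s * T := by
    rw [hM, integral_add hM1 hM2, setIntegral_indicator measurableSet_Ioc,
      inter_eq_self_of_subset_right Ioc_subset_Ioi_self, integral_const_mul,
      setIntegral_Ioc_rpow (by linarith) zero_le_one, integral_const_mul,
      integral_comp_mul_left_Ioi (tailWeight s) 0 hε0, Real.one_rpow, mul_zero,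
      Real.rpow_add hε0, Real.rpow_one, smul_eq_mul]
    have : 1 - s ≠ 0 := by linarith
    have : 1 - 2 * s + 1 ≠ 0 := by linarith
    field_simp
    ring
  have h3 := integral_halfLineDiff_nonpos hs0 hs1
  have h4 : ε ≤ ε ^ s := by
    simpa using Real.rpow_le_rpow_of_exponent_ge hε0 hε1 hs1.le
  have h5 : 2 * ε / (1 - s) ≤ 2 / (1 - s) * ε ^ s := by
    have : 0 < 1 - s := by linarith
    rw [mul_comm 2 ε, mul_div_assoc, mul_comm]
    gcongr
  rw [h2] at h1
  nlinarith

/-- Second difference at the origin of `x ↦ ((p + x)(q - x))_+ ^ s`. -/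
noncomputable def chordDiff (s p q t : ℝ) : ℝ :=
  2 * (p * q) ^ s - (max ((p - t) * (q + t)) 0) ^ s - (max ((p + t) * (q - t)) 0) ^ s

lemma chordDiff_comm (s p q t : ℝ) : chordDiff s p q t = chordDiff s q p t := by
  unfold chordDiff
  rw [mul_comm p q, mul_comm (p - t), mul_comm (p + t)]
  ring

/-- The fractional Laplacian of order `2s` of `((p + x)(q - x))_+ ^ s` is bounded above by a
constant that does not depend on the interval. -/
lemma exists_integral_chordDiff_le {s : ℝ} (hs0 : 0 < s) (hs1 : s < 1) :
    ∃ L : ℝ, 0 < L ∧ ∀ p q : ℝ, 0 < p → 0 < q →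
      IntegrableOn (fun t => chordDiff s p q t * t ^ (-1 - 2 * s)) (Ioi 0) ∧
      ∫ t in Ioi 0, chordDiff s p q t * t ^ (-1 - 2 * s) ≤ L := by
  obtain ⟨L, hL, H⟩ := exists_integral_intervalDiff_le hs0 hs1
  refine ⟨L, hL, ?_⟩
  have main : ∀ p q : ℝ, 0 < p → p ≤ q →
      IntegrableOn (fun t => chordDiff s p q t * t ^ (-1 - 2 * s)) (Ioi 0) ∧
      ∫ t in Ioi 0, chordDiff s p q t * t ^ (-1 - 2 * s) ≤ L := by
    intro p q hp hpq
    have hq : 0 < q := hp.trans_le hpq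
    obtain ⟨h1, h2⟩ := H (p / q) (by positivity) ((div_le_one hq).2 hpq)
    have hpi : 0 < p⁻¹ := by positivity
    have heq : EqOn (fun t => chordDiff s p q t * t ^ (-1 - 2 * s))
        (fun t => (p * q) ^ s * p ^ (-1 - 2 * s) *
          (intervalDiff s (p / q) (p⁻¹ * t) * (p⁻¹ * t) ^ (-1 - 2 * s))) (Ioi 0) := by
      intro t ht
      have ht0 : (0 : ℝ) < t := ht
      simp only
      have hpn : p ≠ 0 := hp.ne'
      have hqn : q ≠ 0 := hq.ne'
      have e1 : (max ((p - t) * (q + t)) 0) ^ s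
          = (p * q) ^ s * ((max (1 - p⁻¹ * t) 0) ^ s * (1 + p / q * (p⁻¹ * t)) ^ s) := by
        rw [← Real.mul_rpow (le_max_right _ _) (by positivity),
          ← Real.mul_rpow (by positivity) (mul_nonneg (le_max_right _ _) (by positivity))]
        congr 1
        rw [max_mul_of_nonneg _ _ (by positivity), mul_max_of_nonneg _ _ (by positivity)]
        congr 1
        · field_simp
        · ring
      have e2 : (max ((p + t) * (q - t)) 0) ^ s
          = (p * q) ^ s * ((1 + p⁻¹ * t) ^ s * (max (1 - p / q * (p⁻¹ * t)) 0) ^ s) := by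
        rw [← Real.mul_rpow (by positivity) (le_max_right _ _),
          ← Real.mul_rpow (by positivity) (mul_nonneg (by positivity) (le_max_right _ _))]
        congr 1
        rw [mul_max_of_nonneg _ _ (by positivity), mul_max_of_nonneg _ _ (by positivity)]
        congr 1
        · field_simp
        · ring
      have e3 : p ^ (-1 - 2 * s) * (p⁻¹ * t) ^ (-1 - 2 * s) = t ^ (-1 - 2 * s) := by
        rw [← Real.mul_rpow hp.le (by positivity)]
        congr 1
        field_simp
      unfold chordDiff intervalDiff
      rw [e1, e2, ← e3]
      ring
    constructor
    · refine IntegrableOn.congr_fun (Integrable.const_mul ?_ _) heq.symm measurableSet_Ioi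
      exact (integrableOn_Ioi_comp_mul_left_iff
        (fun τ => intervalDiff s (p / q) τ * τ ^ (-1 - 2 * s)) 0 hpi).2 (by simpa using h1)
    · rw [setIntegral_congr_fun measurableSet_Ioi heq, integral_const_mul,
        integral_comp_mul_left_Ioi (fun τ => intervalDiff s (p / q) τ * τ ^ (-1 - 2 * s)) 0 hpi,
        mul_zero, inv_inv, smul_eq_mul]
      have e : (p * q) ^ s * p ^ (-1 - 2 * s) * p * (p / q) ^ s = 1 := by
        have e0 : p ^ (-1 - 2 * s) * p = p ^ (-(2 * s)) := by
          rw [← Real.rpow_add_one hp.ne']; ring_nf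
        have e4 : (p * q) ^ s * (p / q) ^ s = p ^ (2 * s) := by
          rw [← Real.mul_rpow (by positivity) (by positivity), Real.rpow_mul hp.le]
          congr 1
          rw [Real.rpow_two]; field_simp
        calc _ = ((p * q) ^ s * (p / q) ^ s) * (p ^ (-1 - 2 * s) * p) := by ring
          _ = 1 := by rw [e0, e4, ← Real.rpow_add hp]; simp
      calc _ = (p * q) ^ s * p ^ (-1 - 2 * s) * p *
            ∫ τ in Ioi 0, intervalDiff s (p / q) τ * τ ^ (-1 - 2 * s) := by ring
        _ ≤ (p * q) ^ s * p ^ (-1 - 2 * s) * p * (L * (p / q) ^ s) := by gcongr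
        _ = L * ((p * q) ^ s * p ^ (-1 - 2 * s) * p * (p / q) ^ s) := by ring
        _ = L := by rw [e, mul_one]
  -- by reflection one may measure from the nearer endpoint
  intro p q hp hq
  rcases le_total p q with h | h
  · exact main p q hp h
  · simp_rw [chordDiff_comm s p q]
    exact main q p hq h

/-! ### Polar coordinates and the barrier of a ball -/

lemma nontrivial_eucl {N : ℕ} (hN : 1 ≤ N) : Nontrivial (Eucl N) := by
  have : Nonempty (Fin N) := ⟨⟨0, hN⟩⟩
  infer_instance

lemma integral_volumeIoiPow (n : ℕ) (f : ℝ → ℝ) :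
    ∫ t : Ioi (0 : ℝ), f t ∂(Measure.volumeIoiPow n) = ∫ t in Ioi (0 : ℝ), f t * t ^ n := by
  simp only [Measure.volumeIoiPow, ENNReal.ofReal]
  rw [integral_withDensity_eq_integral_smul,
    integral_subtype_comap measurableSet_Ioi fun a ↦ Real.toNNReal (a ^ n) • f a,
    setIntegral_congr_fun measurableSet_Ioi fun x hx ↦ ?_]
  · rw [NNReal.smul_def, Real.coe_toNNReal _ (pow_nonneg (le_of_lt hx) _), smul_eq_mul, mul_comm]
  · exact (measurable_subtype_coe.pow_const _).real_toNNReal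

lemma integrable_volumeIoiPow (n : ℕ) (f : ℝ → ℝ)
    (hf : Integrable (fun t : Ioi (0 : ℝ) => f t) (Measure.volumeIoiPow n)) :
    IntegrableOn (fun t => f t * t ^ n) (Ioi 0) := by
  unfold Measure.volumeIoiPow at hf
  rw [integrable_withDensity_iff_integrable_smul' (by fun_prop) (by simp)] at hf
  rw [integrableOn_iff_comap_subtypeVal measurableSet_Ioi]
  refine hf.congr (Eventually.of_forall ?_)
  rintro ⟨x, hx⟩
  have hx : 0 < x := hx
  simp [ENNReal.toReal_ofReal, pow_nonneg hx.le, mul_comm]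

/-- In polar coordinates, an integral is bounded by the area of the sphere times a bound for
the radial integrals. -/
lemma integral_le_of_polar {N : ℕ} (hN : 1 ≤ N) {Θ : Eucl N → ℝ} (hΘ : Integrable Θ)
    {m : Eucl N → ℝ → ℝ} {L : ℝ}
    (hm : ∀ e : Eucl N, ‖e‖ = 1 → IntegrableOn (m e) (Ioi 0))
    (hmL : ∀ e : Eucl N, ‖e‖ = 1 → ∫ t in Ioi 0, m e t ≤ L)
    (hle : ∀ e : Eucl N, ‖e‖ = 1 → ∀ t : ℝ, 0 < t → Θ (t • e) * t ^ (N - 1) ≤ m e t) :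
    ∫ x, Θ x ≤ L * (volume : Measure (Eucl N)).toSphere.real univ := by
  have := nontrivial_eucl hN
  set μ : Measure (Eucl N) := volume
  have hmp := μ.measurePreserving_homeomorphUnitSphereProd
  have hdim : Module.finrank ℝ (Eucl N) - 1 = N - 1 := by simp
  rw [hdim] at hmp
  set g : Metric.sphere (0 : Eucl N) 1 × Ioi (0 : ℝ) → ℝ := fun z => Θ ((z.2 : ℝ) • (z.1 : Eucl N))
    with hg
  have hcomp : ∀ x : ({(0)}ᶜ : Set (Eucl N)), g (homeomorphUnitSphereProd (Eucl N) x) = Θ x := by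
    intro x
    simp only [hg]
    congr 1
    have : (homeomorphUnitSphereProd (Eucl N)).symm (homeomorphUnitSphereProd (Eucl N) x) = x :=
      Homeomorph.symm_apply_apply _ _
    conv_rhs => rw [← this]
    rfl
  have hemb := (homeomorphUnitSphereProd (Eucl N)).measurableEmbedding
  have hint : Integrable g (μ.toSphere.prod (.volumeIoiPow (N - 1))) := by
    rw [← hmp.integrable_comp_emb hemb]
    have : g ∘ (homeomorphUnitSphereProd (Eucl N)) = Θ ∘ Subtype.val := funext hcomp
    rw [this, ← integrableOn_iff_comap_subtypeVal (measurableSet_singleton _).compl]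
    exact hΘ.integrableOn
  have hval : ∫ x, Θ x ∂μ = ∫ z, g z ∂(μ.toSphere.prod (.volumeIoiPow (N - 1))) := by
    rw [← hmp.integral_comp hemb g, integral_congr_ae (Eventually.of_forall hcomp),
      integral_subtype_comap (measurableSet_singleton _).compl Θ, restrict_compl_singleton]
  rw [hval, integral_prod _ hint]
  calc _ ≤ ∫ _ : Metric.sphere (0 : Eucl N) 1, L ∂μ.toSphere := by
        refine integral_mono_ae hint.integral_prod_left (integrable_const _) ?_
        filter_upwards [hint.prod_right_ae] with e he
        have hen : ‖(e : Eucl N)‖ = 1 := by simp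
        have h1 := integrable_volumeIoiPow (N - 1) (fun t => Θ (t • (e : Eucl N))) he
        have h2 := integral_volumeIoiPow (N - 1) (fun t => Θ (t • (e : Eucl N)))
        simp only [hg]
        rw [h2]
        exact (setIntegral_mono_on h1 (hm e hen) measurableSet_Ioi
          fun t ht => hle e hen t ht).trans (hmL e hen)
    _ = _ := by simp [mul_comm]

/-- The barrier `(r² - |x - z|²)_+ ^ s`: up to a constant, the solution of
`(-Δ)^s w = 1` in the ball of radius `r` about `z` with zero exterior data. -/
noncomputable def ballBarrier {N : ℕ} (s : ℝ) (z : Eucl N) (r : ℝ) (x : Eucl N) : ℝ :=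
  (max (r ^ 2 - ‖x - z‖ ^ 2) 0) ^ s

lemma ballBarrier_eq_zero {N : ℕ} {s : ℝ} (hs : 0 < s) {z : Eucl N} {r : ℝ} (hr : 0 ≤ r)
    {x : Eucl N} (hx : x ∉ Metric.ball z r) : ballBarrier s z r x = 0 := by
  unfold ballBarrier
  rw [Metric.mem_ball, dist_eq_norm, not_lt] at hx
  rw [max_eq_right (by nlinarith), Real.zero_rpow hs.ne']

lemma continuous_ballBarrier {N : ℕ} {s : ℝ} (hs : 0 < s) (z : Eucl N) (r : ℝ) :
    Continuous (ballBarrier s z r) := by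
  unfold ballBarrier
  exact Continuous.rpow_const (by fun_prop) fun _ => Or.inr hs.le

lemma ballBarrier_le {N : ℕ} {s : ℝ} (hs : 0 ≤ s) (z : Eucl N) (r : ℝ) (x : Eucl N) :
    ballBarrier s z r x ≤ (r ^ 2) ^ s := by
  unfold ballBarrier
  exact Real.rpow_le_rpow (le_max_right _ _)
    (max_le (by nlinarith [sq_nonneg ‖x - z‖]) (sq_nonneg _)) hs

/-- Along each line through a point of the ball the barrier is the model profile on a chord. -/
lemma exists_chord {N : ℕ} (s : ℝ) {z x e : Eucl N} {r : ℝ} (hx : x ∈ Metric.ball z r)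
    (he : ‖e‖ = 1) : ∃ p q : ℝ, 0 < p ∧ 0 < q ∧ ∀ t : ℝ,
      2 * ballBarrier s z r x - ballBarrier s z r (x + t • e) - ballBarrier s z r (x - t • e)
        = chordDiff s p q t := by
  rw [Metric.mem_ball, dist_eq_norm] at hx
  set B : ℝ := inner ℝ (x - z) e
  set A : ℝ := r ^ 2 - ‖x - z‖ ^ 2 with hA
  have hA0 : 0 < A := by nlinarith [norm_nonneg (x - z)]
  have hBA : |B| < Real.sqrt (B ^ 2 + A) := by
    rw [← Real.sqrt_sq_eq_abs]; exact Real.sqrt_lt_sqrt (sq_nonneg _) (by linarith)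
  have hsq : Real.sqrt (B ^ 2 + A) ^ 2 = B ^ 2 + A := Real.sq_sqrt (by positivity)
  rw [abs_lt] at hBA
  refine ⟨-B + Real.sqrt (B ^ 2 + A), B + Real.sqrt (B ^ 2 + A), by linarith, by linarith,
    fun t => ?_⟩
  have hplus : ‖x + t • e - z‖ ^ 2 = ‖x - z‖ ^ 2 + 2 * t * B + t ^ 2 := by
    rw [show x + t • e - z = (x - z) + t • e by abel, norm_add_sq_real, inner_smul_right,
      norm_smul, he, Real.norm_eq_abs, mul_one, sq_abs]
    ring
  have hminus : ‖x - t • e - z‖ ^ 2 = ‖x - z‖ ^ 2 - 2 * t * B + t ^ 2 := by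
    rw [show x - t • e - z = (x - z) - t • e by abel, norm_sub_sq_real, inner_smul_right,
      norm_smul, he, Real.norm_eq_abs, mul_one, sq_abs]
    ring
  have e0 : (-B + Real.sqrt (B ^ 2 + A)) * (B + Real.sqrt (B ^ 2 + A)) = A := by nlinarith
  have e1 : (-B + Real.sqrt (B ^ 2 + A) - t) * (B + Real.sqrt (B ^ 2 + A) + t)
      = r ^ 2 - (‖x - z‖ ^ 2 + 2 * t * B + t ^ 2) := by
    rw [hA] at e0 ⊢; nlinarith
  have e2 : (-B + Real.sqrt (B ^ 2 + A) + t) * (B + Real.sqrt (B ^ 2 + A) - t)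
      = r ^ 2 - (‖x - z‖ ^ 2 - 2 * t * B + t ^ 2) := by
    rw [hA] at e0 ⊢; nlinarith
  unfold ballBarrier chordDiff
  rw [hplus, hminus, ← hA, max_eq_left hA0.le, e0, e1, e2]

/-! ### Mollification and the bilinear form -/

/-- A smooth probability density supported in the closed ball of radius `η` about the origin. -/
structure IsMollifier {N : ℕ} (φ : Eucl N → ℝ) (η : ℝ) : Prop where
  smooth : ContDiff ℝ ∞ φ
  support : tsupport φ ⊆ Metric.closedBall 0 η
  nonneg : ∀ z, 0 ≤ φ z
  integral_eq : ∫ z, φ z = 1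

lemma exists_isMollifier (N : ℕ) {η : ℝ} (hη : 0 < η) : ∃ φ : Eucl N → ℝ, IsMollifier φ η := by
  let f : ContDiffBump (0 : Eucl N) := ⟨η / 2, η, by positivity, by linarith⟩
  refine ⟨f.normed volume, ?_, ?_, fun z => f.nonneg_normed z, f.integral_normed⟩
  · exact f.contDiff_normed
  · rw [f.tsupport_normed_eq]

lemma IsMollifier.continuous {N : ℕ} {φ : Eucl N → ℝ} {η : ℝ} (h : IsMollifier φ η) :
    Continuous φ := h.smooth.continuous

lemma IsMollifier.hasCompactSupport {N : ℕ} {φ : Eucl N → ℝ} {η : ℝ} (h : IsMollifier φ η) :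
    HasCompactSupport φ :=
  (isCompact_closedBall (0 : Eucl N) η).of_isClosed_subset (isClosed_tsupport φ) h.support

lemma IsMollifier.eq_zero {N : ℕ} {φ : Eucl N → ℝ} {η : ℝ} (h : IsMollifier φ η) {z : Eucl N}
    (hz : η < ‖z‖) : φ z = 0 := by
  by_contra hne
  have := h.support (subset_tsupport φ hne)
  rw [mem_closedBall_zero_iff] at this
  linarith

/-- The average of `u` about `x` with weight `φ`. -/
noncomputable def mollify {N : ℕ} (φ u : Eucl N → ℝ) (x : Eucl N) : ℝ := ∫ z, φ z * u (x + z)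

lemma mollify_eq {N : ℕ} (φ u : Eucl N → ℝ) (x : Eucl N) :
    mollify φ u x = ∫ a, φ (a - x) * u a := by
  unfold mollify
  rw [← integral_sub_right_eq_self (fun z => φ z * u (x + z)) x]
  simp

lemma integrable_mul_of_compact {N : ℕ} {φ u : Eucl N → ℝ} (hφ : Continuous φ)
    (hc : HasCompactSupport φ) (hu : Continuous u) : Integrable (fun z => φ z * u z) :=
  (hφ.mul hu).integrable_of_hasCompactSupport hc.mul_right

lemma integrable_mollify {N : ℕ} {φ u : Eucl N → ℝ} (hφ : Continuous φ)
    (hc : HasCompactSupport φ) (hu : Continuous u) (x : Eucl N) :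
    Integrable (fun z => φ z * u (x + z)) :=
  integrable_mul_of_compact hφ hc (by fun_prop)

lemma hasCompactSupport_comp_sub {N : ℕ} {φ : Eucl N → ℝ} (hc : HasCompactSupport φ)
    (x : Eucl N) : HasCompactSupport (fun a => φ (a - x)) :=
  hc.comp_homeomorph (Homeomorph.subRight x)

/-- The truncated power `min 1 |h|² · |h|^(-N-2s)` is integrable on `ℝ^N`. -/
lemma integrable_min_one_sq_div {N : ℕ} (hN : 1 ≤ N) {s : ℝ} (hs0 : 0 < s) (hs1 : s < 1) :
    Integrable (fun h : Eucl N => min 1 (‖h‖ ^ 2) / ‖h‖ ^ ((N : ℝ) + 2 * s)) := by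
  have := nontrivial_eucl hN
  rw [integrable_fun_norm_addHaar (volume : Measure (Eucl N))
    (f := fun y : ℝ => min 1 (y ^ 2) / y ^ ((N : ℝ) + 2 * s))]
  have hdim : Module.finrank ℝ (Eucl N) - 1 = N - 1 := by simp
  rw [hdim]
  have hcongr : EqOn (fun y : ℝ => y ^ (-1 - 2 * s) * min 1 (y ^ 2))
      (fun y : ℝ => y ^ (N - 1) • (min 1 (y ^ 2) / y ^ ((N : ℝ) + 2 * s))) (Ioi 0) := by
    intro y hy
    have hy0 : (0 : ℝ) < y := hy
    have e : y ^ (-1 - 2 * s) = y ^ (N - 1) / y ^ ((N : ℝ) + 2 * s) := by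
      rw [← Real.rpow_natCast, ← Real.rpow_sub hy0, Nat.cast_sub hN]
      congr 1; push_cast; ring
    simp only [smul_eq_mul, e]
    ring
  refine IntegrableOn.congr_fun ?_ hcongr measurableSet_Ioi
  rw [← Ioc_union_Ioi_eq_Ioi (zero_le_one' ℝ)]
  refine IntegrableOn.union ?_ ?_
  · refine (integrableOn_Ioc_rpow (r := 1 - 2 * s) (by linarith) zero_le_one).congr_fun
      (fun y hy => ?_) measurableSet_Ioc
    have hy2 : y ^ 2 ≤ 1 := by nlinarith [hy.1, hy.2]
    simp only
    rw [min_eq_right hy2, ← Real.rpow_natCast y 2, ← Real.rpow_add hy.1]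
    congr 1; push_cast; ring
  · refine (integrableOn_Ioi_rpow_of_lt (a := -1 - 2 * s) (by linarith) zero_lt_one).congr_fun
      (fun y hy => ?_) measurableSet_Ioi
    have hy1 : (1 : ℝ) < y := hy
    simp only
    rw [min_eq_left (by nlinarith), mul_one]

lemma measurePreserving_shear (N : ℕ) :
    MeasurePreserving (MeasurableEquiv.shearAddRight (Eucl N))
      (volume : Measure (Eucl N × Eucl N)) volume :=
  measurePreserving_prod_add volume volume

/-- Smooth functions with compact support have finite Gagliardo seminorm. -/
lemma gagliardoSq_lt_top {N : ℕ} (hN : 1 ≤ N) {s : ℝ} (hs0 : 0 < s) (hs1 : s < 1)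
    {φ : Eucl N → ℝ} (hφ : ContDiff ℝ ∞ φ) (hc : HasCompactSupport φ) :
    gagliardoSq s φ < ⊤ := by
  obtain ⟨K, hK⟩ := ContDiff.lipschitzWith_of_hasCompactSupport hc hφ (by simp)
  obtain ⟨M, hM⟩ := hφ.continuous.bounded_above_of_compact_support hc
  set S := tsupport φ
  have hS : MeasurableSet S := (isClosed_tsupport φ).measurableSet
  set C : ℝ := max ((K : ℝ) ^ 2) ((2 * M) ^ 2)
  have hC0 : 0 ≤ C := le_max_of_le_left (sq_nonneg _)
  have hpt : ∀ x h : Eucl N, (φ x - φ (x + h)) ^ 2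
      ≤ C * min 1 (‖h‖ ^ 2) * (S.indicator 1 x + S.indicator 1 (x + h)) := by
    intro x h
    have hm0 : (0 : ℝ) ≤ min 1 (‖h‖ ^ 2) := by positivity
    by_cases h0 : x ∈ S ∨ x + h ∈ S
    · have h1 : (1 : ℝ) ≤ S.indicator 1 x + S.indicator 1 (x + h) := by
        have p1 : (0 : ℝ) ≤ S.indicator 1 x := indicator_nonneg (fun _ _ => zero_le_one) _
        have p2 : (0 : ℝ) ≤ S.indicator 1 (x + h) := indicator_nonneg (fun _ _ => zero_le_one) _
        rcases h0 with h0 | h0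
        · have : S.indicator (1 : Eucl N → ℝ) x = 1 := by simp [h0]
          linarith
        · have : S.indicator (1 : Eucl N → ℝ) (x + h) = 1 := by simp [h0]
          linarith
      have h2 : (φ x - φ (x + h)) ^ 2 ≤ C * min 1 (‖h‖ ^ 2) := by
        rw [mul_min_of_nonneg _ _ hC0, mul_one]
        apply le_min
        · refine le_trans ?_ (le_max_right _ _)
          rw [← sq_abs]
          apply pow_le_pow_left₀ (abs_nonneg _)
          have := hM x
          have := hM (x + h)
          simp only [Real.norm_eq_abs, abs_le] at *
          constructor <;> linarith
        · have hd := hK.dist_le_mul x (x + h)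
          rw [Real.dist_eq, dist_self_add_right] at hd
          calc (φ x - φ (x + h)) ^ 2 = |φ x - φ (x + h)| ^ 2 := (sq_abs _).symm
            _ ≤ (K * ‖h‖) ^ 2 := pow_le_pow_left₀ (abs_nonneg _) hd 2
            _ = K ^ 2 * ‖h‖ ^ 2 := by ring
            _ ≤ C * ‖h‖ ^ 2 := by gcongr; exact le_max_left _ _
      nlinarith [mul_nonneg hC0 hm0]
    · push Not at h0
      rw [image_eq_zero_of_notMem_tsupport h0.1, image_eq_zero_of_notMem_tsupport h0.2]
      simp [h0.1, h0.2]
  have hSfin : volume S < ⊤ := IsCompact.measure_lt_top hc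
  have hstep : gagliardoSq s φ = ∫⁻ h : Eucl N, ∫⁻ x : Eucl N,
      ENNReal.ofReal ((φ x - φ (x + h)) ^ 2 / ‖h‖ ^ ((N : ℝ) + 2 * s)) := by
    unfold gagliardoSq
    have hmeas : Measurable fun z : Eucl N × Eucl N =>
        ENNReal.ofReal ((φ z.1 - φ (z.1 + z.2)) ^ 2 / ‖z.2‖ ^ ((N : ℝ) + 2 * s)) := by
      have := hφ.continuous.measurable
      fun_prop
    rw [lintegral_lintegral_swap (f := fun h x : Eucl N =>
      ENNReal.ofReal ((φ x - φ (x + h)) ^ 2 / ‖h‖ ^ ((N : ℝ) + 2 * s)))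
      (hmeas.comp measurable_swap).aemeasurable]
    refine lintegral_congr fun x => ?_
    rw [← lintegral_add_left_eq_self _ x]
    simp [norm_neg]
  have hbound : ∀ h : Eucl N, ∫⁻ x : Eucl N,
      ENNReal.ofReal ((φ x - φ (x + h)) ^ 2 / ‖h‖ ^ ((N : ℝ) + 2 * s))
      ≤ ENNReal.ofReal (min 1 (‖h‖ ^ 2) / ‖h‖ ^ ((N : ℝ) + 2 * s)) *
        (ENNReal.ofReal C * (2 * volume S)) := by
    intro h
    have hm0 : (0 : ℝ) ≤ min 1 (‖h‖ ^ 2) / ‖h‖ ^ ((N : ℝ) + 2 * s) := by positivity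
    calc _ ≤ ∫⁻ x : Eucl N, ENNReal.ofReal (min 1 (‖h‖ ^ 2) / ‖h‖ ^ ((N : ℝ) + 2 * s)) *
          (ENNReal.ofReal C * (S.indicator 1 x + S.indicator 1 (x + h))) := by
          refine lintegral_mono fun x => ?_
          have e : (S.indicator 1 x + S.indicator 1 (x + h) : ℝ≥0∞)
              = ENNReal.ofReal (S.indicator 1 x + S.indicator 1 (x + h)) := by
            by_cases h1 : x ∈ S <;> by_cases h2 : x + h ∈ S <;> simp [h1, h2, one_add_one_eq_two]
          rw [e, ← ENNReal.ofReal_mul hC0, ← ENNReal.ofReal_mul hm0]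
          refine ENNReal.ofReal_le_ofReal ?_
          rw [div_mul_eq_mul_div]
          refine div_le_div_of_nonneg_right ?_ (by positivity)
          nlinarith [hpt x h]
      _ = _ := by
          have hi : Measurable fun x : Eucl N => S.indicator (1 : Eucl N → ℝ≥0∞) x :=
            measurable_one.indicator hS
          rw [lintegral_const_mul _ (by fun_prop), lintegral_const_mul _ (by fun_prop),
            lintegral_add_left hi,
            lintegral_add_right_eq_self (fun x => S.indicator (1 : Eucl N → ℝ≥0∞) x) h,
            lintegral_indicator_one hS, ← two_mul]
  rw [hstep]
  refine (lintegral_mono hbound).trans_lt ?_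
  rw [lintegral_mul_const' _ _ (ENNReal.mul_ne_top ENNReal.ofReal_ne_top
    (ENNReal.mul_ne_top (by simp) hSfin.ne))]
  refine ENNReal.mul_lt_top ?_ (ENNReal.mul_lt_top ENNReal.ofReal_lt_top
    (ENNReal.mul_lt_top (by simp) hSfin))
  exact (integrable_min_one_sq_div hN hs0 hs1).lintegral_lt_top

lemma memHsZero_of_smooth {N : ℕ} (hN : 1 ≤ N) {s : ℝ} (hs0 : 0 < s) (hs1 : s < 1)
    {Ω : Set (Eucl N)} {φ : Eucl N → ℝ} (hφ : ContDiff ℝ ∞ φ) (hc : HasCompactSupport φ)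
    (hΩ : tsupport φ ⊆ Ω) : MemHsZero s Ω φ := by
  refine ⟨⟨hφ.continuous.memLp_of_hasCompactSupport hc, gagliardoSq_lt_top hN hs0 hs1 hφ hc⟩,
    fun _ => φ, fun _ => ⟨hφ, hc, hΩ⟩, ?_, ?_⟩
  · simp
  · simp [gagliardoSq]

/-- The square of this difference quotient is the Gagliardo integrand. -/
lemma memLp_diffQuot {N : ℕ} {s : ℝ} {u : Eucl N → ℝ} (hu : Continuous u)
    (h : gagliardoSq s u < ⊤) :
    MemLp (fun z : Eucl N × Eucl N =>
      (u z.1 - u z.2) / ‖z.1 - z.2‖ ^ (((N : ℝ) + 2 * s) / 2)) 2 volume := by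
  have hm := hu.measurable
  refine ⟨(by fun_prop : Measurable _).aestronglyMeasurable, ?_⟩
  rw [eLpNorm_lt_top_iff_lintegral_rpow_enorm_lt_top (by simp) (by simp)]
  have hmeas : Measurable fun z : Eucl N × Eucl N =>
      ENNReal.ofReal ((u z.1 - u z.2) ^ 2 / ‖z.1 - z.2‖ ^ ((N : ℝ) + 2 * s)) := by fun_prop
  unfold gagliardoSq at h
  rw [← lintegral_prod _ hmeas.aemeasurable] at h
  refine lt_of_eq_of_lt ?_ h
  refine lintegral_congr fun z => ?_
  rw [← ofReal_norm, ENNReal.toReal_ofNat, ENNReal.rpow_two,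
    ← ENNReal.ofReal_pow (norm_nonneg _), Real.norm_eq_abs, sq_abs, div_pow,
    ← Real.rpow_mul_natCast (norm_nonneg _)]
  congr 3
  push_cast; ring

lemma integrable_gagliardoForm {N : ℕ} {s : ℝ} {u φ : Eucl N → ℝ} (hu : Continuous u)
    (hφ : Continuous φ) (h : gagliardoSq s u < ⊤) (h' : gagliardoSq s φ < ⊤) :
    Integrable (fun z : Eucl N × Eucl N =>
      (u z.1 - u z.2) * (φ z.1 - φ z.2) / ‖z.1 - z.2‖ ^ ((N : ℝ) + 2 * s)) := by
  refine ((memLp_diffQuot hu h).integrable_mul (memLp_diffQuot hφ h')).congr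
    (Eventually.of_forall fun z => ?_)
  simp only [Pi.mul_apply]
  rw [div_mul_div_comm, ← sq, ← Real.rpow_mul_natCast (norm_nonneg _)]
  congr 2
  push_cast; ring

/-- Tested with a translate of the mollifying kernel, the bilinear form is the fractional
Laplacian of the mollified function, written as an absolutely convergent integral of second
differences. -/
lemma gagliardoForm_comp_sub {N : ℕ} {s : ℝ} {u φ : Eucl N → ℝ} (hu : Continuous u)
    (hφ : Continuous φ) (hc : HasCompactSupport φ) (h : gagliardoSq s u < ⊤) (x : Eucl N)
    (h' : gagliardoSq s (fun a => φ (a - x)) < ⊤) :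
    Integrable (fun h : Eucl N =>
      (2 * mollify φ u x - mollify φ u (x + h) - mollify φ u (x - h))
        / ‖h‖ ^ ((N : ℝ) + 2 * s)) ∧
    gagliardoForm s u (fun a => φ (a - x)) = ∫ h : Eucl N,
      (2 * mollify φ u x - mollify φ u (x + h) - mollify φ u (x - h))
        / ‖h‖ ^ ((N : ℝ) + 2 * s) := by
  have hφx : Continuous fun a => φ (a - x) := by fun_prop
  have hG := integrable_gagliardoForm hu hφx h h'
  have hmp := measurePreserving_shear N
  have hemb := (MeasurableEquiv.shearAddRight (Eucl N)).measurableEmbedding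
  have hG2 := (hmp.integrable_comp_emb hemb).2 hG
  have hval := hmp.integral_comp hemb (fun z : Eucl N × Eucl N =>
      (u z.1 - u z.2) * (φ (z.1 - x) - φ (z.2 - x)) / ‖z.1 - z.2‖ ^ ((N : ℝ) + 2 * s))
  have hfun : ((fun z : Eucl N × Eucl N =>
      (u z.1 - u z.2) * (φ (z.1 - x) - φ (z.2 - x)) / ‖z.1 - z.2‖ ^ ((N : ℝ) + 2 * s)) ∘
      MeasurableEquiv.shearAddRight (Eucl N)) = fun z : Eucl N × Eucl N =>
      (u z.1 - u (z.1 + z.2)) * (φ (z.1 - x) - φ (z.1 + z.2 - x))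
        / ‖z.2‖ ^ ((N : ℝ) + 2 * s) := by
    funext z
    have e1 : (MeasurableEquiv.shearAddRight (Eucl N) z) = (z.1, z.1 + z.2) := rfl
    simp only [Function.comp, e1, sub_add_cancel_left, norm_neg]
  rw [hfun] at hG2
  have hinner : ∀ h : Eucl N, ∫ a : Eucl N,
      (u a - u (a + h)) * (φ (a - x) - φ (a + h - x)) / ‖h‖ ^ ((N : ℝ) + 2 * s)
      = (2 * mollify φ u x - mollify φ u (x + h) - mollify φ u (x - h))
        / ‖h‖ ^ ((N : ℝ) + 2 * s) := by
    intro h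
    rw [integral_div]
    congr 1
    have hcx : HasCompactSupport fun a => φ (a - x) := hasCompactSupport_comp_sub hc x
    have hch : HasCompactSupport fun a => φ (a + h - x) := by
      have := hasCompactSupport_comp_sub hc (x - h)
      have e : (fun a => φ (a + h - x)) = fun a => φ (a - (x - h)) := by
        funext a; congr 1; abel
      rwa [e]
    have i1 := integrable_mul_of_compact (φ := fun a => φ (a - x)) (by fun_prop) hcx hu
    have i2 := integrable_mul_of_compact (φ := fun a => φ (a - x)) (u := fun a => u (a + h))
      (by fun_prop) hcx (by fun_prop)
    have i3 := integrable_mul_of_compact (φ := fun a => φ (a + h - x)) (by fun_prop) hch hu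
    have i4 := integrable_mul_of_compact (φ := fun a => φ (a + h - x)) (u := fun a => u (a + h))
      (by fun_prop) hch (by fun_prop)
    have e : ∀ a, (u a - u (a + h)) * (φ (a - x) - φ (a + h - x))
        = (φ (a - x) * u a - φ (a - x) * u (a + h))
          - (φ (a + h - x) * u a - φ (a + h - x) * u (a + h)) := fun a => by ring
    simp_rw [e]
    refine (integral_sub (i1.sub i2) (i3.sub i4)).trans ?_
    simp only [Pi.sub_apply]
    rw [integral_sub i1 i2, integral_sub i3 i4]
    have t1 : ∫ a, φ (a - x) * u a = mollify φ u x := (mollify_eq φ u x).symm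
    have t2 : ∫ a, φ (a - x) * u (a + h) = mollify φ u (x + h) := by
      rw [mollify_eq, ← integral_add_right_eq_self (fun a => φ (a - (x + h)) * u a) h]
      congr 1; funext a; congr 2; abel
    have t3 : ∫ a, φ (a + h - x) * u a = mollify φ u (x - h) := by
      rw [mollify_eq]
      congr 1; funext a; congr 2; abel
    have t4 : ∫ a, φ (a + h - x) * u (a + h) = mollify φ u x := by
      rw [mollify_eq, ← integral_add_right_eq_self (fun a => φ (a - x) * u a) h]
    rw [t1, t2, t3, t4]; ring
  constructor
  · refine hG2.integral_prod_right.congr (Eventually.of_forall fun h => ?_)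
    exact hinner h
  · unfold gagliardoForm
    rw [← hval]
    have : ∀ z : Eucl N × Eucl N, (fun z : Eucl N × Eucl N =>
      (u z.1 - u z.2) * (φ (z.1 - x) - φ (z.2 - x)) / ‖z.1 - z.2‖ ^ ((N : ℝ) + 2 * s))
      ((MeasurableEquiv.shearAddRight (Eucl N)) z) = (u z.1 - u (z.1 + z.2)) *
        (φ (z.1 - x) - φ (z.1 + z.2 - x)) / ‖z.2‖ ^ ((N : ℝ) + 2 * s) := fun z => congrFun hfun z
    rw [integral_congr_ae (Eventually.of_forall this)]
    refine (integral_prod_symm _ hG2).trans ?_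
    exact integral_congr_ae (Eventually.of_forall hinner)

lemma continuous_mollify {N : ℕ} {φ u : Eucl N → ℝ} {η : ℝ} (hφ : IsMollifier φ η)
    (hu : Continuous u) : Continuous (mollify φ u) := by
  have : mollify φ u = fun x => ∫ z in Metric.closedBall (0 : Eucl N) η, φ z * u (x + z) := by
    funext x
    refine (setIntegral_eq_integral_of_forall_compl_eq_zero fun z hz => ?_).symm
    rw [hφ.eq_zero, zero_mul]
    simpa using hz
  rw [this]
  have hc := hφ.continuous
  exact continuous_parametric_integral_of_continuous (by fun_prop) (isCompact_closedBall _ _)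

/-- A mollified function lies between the bounds of `u` over the ball carrying the kernel. -/
lemma mollify_le {N : ℕ} {φ u : Eucl N → ℝ} {η : ℝ} (hφ : IsMollifier φ η)
    (hu : Continuous u) {x : Eucl N} {C : ℝ} (h : ∀ z, ‖z‖ ≤ η → u (x + z) ≤ C) :
    mollify φ u x ≤ C := by
  calc mollify φ u x ≤ ∫ z, φ z * C := by
        refine integral_mono (integrable_mollify hφ.continuous hφ.hasCompactSupport hu x)
          ((hφ.continuous.integrable_of_hasCompactSupport hφ.hasCompactSupport).mul_const C)
          fun z => ?_
        rcases le_or_gt ‖z‖ η with hz | hz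
        · exact mul_le_mul_of_nonneg_left (h z hz) (hφ.nonneg z)
        · simp [hφ.eq_zero hz]
    _ = C := by rw [integral_mul_const, hφ.integral_eq, one_mul]

lemma le_mollify {N : ℕ} {φ u : Eucl N → ℝ} {η : ℝ} (hφ : IsMollifier φ η)
    (hu : Continuous u) {x : Eucl N} {C : ℝ} (h : ∀ z, ‖z‖ ≤ η → C ≤ u (x + z)) :
    C ≤ mollify φ u x := by
  have := mollify_le hφ hu.neg (x := x) (C := -C) fun z hz => neg_le_neg (h z hz)
  have e : mollify φ (-u) x = -mollify φ u x := by
    unfold mollify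
    simp [integral_neg]
  rw [e] at this
  linarith

lemma integrable_indicator_one_div_norm_rpow {N : ℕ} {d a : ℝ} (hd : 0 < d) (ha : (N : ℝ) < a) :
    Integrable ((Metric.ball (0 : Eucl N) d)ᶜ.indicator fun h => 1 / ‖h‖ ^ a) := by
  have h1 : Integrable fun x : Eucl N => (1 + ‖x‖) ^ (-a) :=
    integrable_one_add_norm (by simpa using ha)
  have ha0 : 0 ≤ a := (Nat.cast_nonneg N).trans ha.le
  refine Integrable.mono' (h1.const_mul ((d / (1 + d)) ^ (-a))) ?_ (Eventually.of_forall fun x => ?_)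
  · exact ((by fun_prop : Measurable fun h : Eucl N => 1 / ‖h‖ ^ a).indicator
      Metric.isOpen_ball.measurableSet.compl).aestronglyMeasurable
  · by_cases hx : x ∈ (Metric.ball (0 : Eucl N) d)ᶜ
    · rw [indicator_of_mem hx]
      have hx' : d ≤ ‖x‖ := by simpa using hx
      have h3 : d / (1 + d) * (1 + ‖x‖) ≤ ‖x‖ := by
        rw [div_mul_eq_mul_div, div_le_iff₀ (by linarith)]; nlinarith
      rw [← Real.mul_rpow (by positivity) (by positivity), Real.norm_of_nonneg (by positivity),
        Real.rpow_neg (by positivity), one_div]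
      gcongr
    · rw [indicator_of_notMem hx, norm_zero]
      positivity

/-- Away from the pole the kernel `|x - ·|^(-N-2s)` is square integrable. -/
lemma memLp_kernel_indicator {N : ℕ} {s d : ℝ} (hs : 0 < s) (hd : 0 < d) (x : Eucl N)
    {A : Set (Eucl N)} (hA : MeasurableSet A) (hAx : ∀ y ∈ A, d ≤ ‖x - y‖) :
    MemLp (A.indicator fun y => 1 / ‖x - y‖ ^ ((N : ℝ) + 2 * s)) 2 volume := by
  have hm : Measurable (A.indicator fun y : Eucl N => 1 / ‖x - y‖ ^ ((N : ℝ) + 2 * s)) :=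
    (by fun_prop : Measurable fun y : Eucl N => 1 / ‖x - y‖ ^ ((N : ℝ) + 2 * s)).indicator hA
  rw [memLp_two_iff_integrable_sq hm.aestronglyMeasurable]
  have h1 := (integrable_indicator_one_div_norm_rpow (N := N) hd
    (a := 2 * ((N : ℝ) + 2 * s)) (by nlinarith [(Nat.cast_nonneg N : (0 : ℝ) ≤ N)]))
  have h2 := h1.comp_sub_left x
  refine Integrable.mono' h2 (hm.pow_const 2).aestronglyMeasurable
    (Eventually.of_forall fun y => ?_)
  by_cases hy : y ∈ A
  · rw [indicator_of_mem hy, indicator_of_mem (by simpa using hAx y hy),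
      Real.norm_of_nonneg (by positivity), div_pow, one_pow, ← Real.rpow_mul_natCast
      (norm_nonneg _)]
    apply le_of_eq; congr 2; push_cast; ring
  · rw [indicator_of_notMem hy]
    simp only [ne_eq, OfNat.ofNat_ne_zero, not_false_eq_true, zero_pow, norm_zero]
    exact indicator_nonneg (fun _ _ => by positivity) _

/-- The integral of a mollified function against `k ∈ L²` is the average of the integrals of its
translates. -/
lemma integral_mollify_mul {N : ℕ} {φ u k : Eucl N → ℝ} {η : ℝ} (hφ : IsMollifier φ η)
    (hu : Continuous u) (hu2 : MemLp u 2 volume) (hkm : Measurable k) (hk : MemLp k 2 volume) :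
    Integrable (fun y => mollify φ u y * k y) ∧
    Integrable (fun z => φ z * ∫ y, u (y + z) * k y) ∧
    ∫ y, mollify φ u y * k y = ∫ z, φ z * ∫ y, u (y + z) * k y := by
  have hum := hu.measurable
  have hφm := hφ.continuous.measurable
  have hφi := hφ.continuous.integrable_of_hasCompactSupport hφ.hasCompactSupport (μ := volume)
  have hu2i := (memLp_two_iff_integrable_sq hum.aestronglyMeasurable).1 hu2
  have hk2i := (memLp_two_iff_integrable_sq hkm.aestronglyMeasurable).1 hk
  have huz : ∀ z, Integrable fun y => u (y + z) ^ 2 := fun z => hu2i.comp_add_right z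
  have hmul : ∀ z, Integrable fun y => u (y + z) * k y := fun z => by
    refine Integrable.mono' ((huz z).add hk2i) (by fun_prop) (Eventually.of_forall fun y => ?_)
    simp only [norm_mul, Real.norm_eq_abs, Pi.add_apply]
    nlinarith [sq_abs (u (y + z)), sq_abs (k y), sq_nonneg (|u (y + z)| - |k y|),
      sq_nonneg (u (y + z)), sq_nonneg (k y)]
  set F : Eucl N × Eucl N → ℝ := fun p => φ p.1 * (u (p.2 + p.1) * k p.2) with hF
  have hFm : AEStronglyMeasurable F (volume.prod volume) := by
    have : Measurable F := by fun_prop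
    exact this.aestronglyMeasurable
  have hFi : Integrable F (volume.prod volume) := by
    rw [integrable_prod_iff hFm]
    refine ⟨Eventually.of_forall fun z => (hmul z).const_mul (φ z), ?_⟩
    refine Integrable.mono' (hφi.mul_const ((∫ y, u y ^ 2) + ∫ y, k y ^ 2))
      hFm.norm.integral_prod_right' (Eventually.of_forall fun z => ?_)
    simp only [hF, norm_mul, Real.norm_eq_abs]
    rw [abs_of_nonneg (integral_nonneg fun y => by positivity), integral_const_mul,
      abs_of_nonneg (hφ.nonneg z)]
    refine mul_le_mul_of_nonneg_left ?_ (hφ.nonneg z)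
    rw [← integral_add_right_eq_self (fun y => u y ^ 2) z, ← integral_add (huz z) hk2i]
    refine integral_mono ?_ ((huz z).add hk2i) fun y => ?_
    · simpa [abs_mul] using (hmul z).abs
    · simp only
      nlinarith [sq_abs (u (y + z)), sq_abs (k y), sq_nonneg (|u (y + z)| - |k y|),
        sq_nonneg (u (y + z)), sq_nonneg (k y)]
  have hinner : ∀ y, ∫ z, F (z, y) = mollify φ u y * k y := fun y => by
    simp only [hF, mollify, ← mul_assoc]
    rw [integral_mul_const]
  refine ⟨hFi.integral_prod_right.congr (Eventually.of_forall hinner),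
    hFi.integral_prod_left.congr (Eventually.of_forall fun z => ?_), ?_⟩
  · simp only [hF, integral_const_mul]
  · simp_rw [← hinner]
    rw [← integral_prod_symm F hFi, integral_prod F hFi]
    simp only [hF, integral_const_mul]

/-- Positive nonlocal mass: near `x₀` the far values of `u`, weighted with the kernel
`|x - y|^(-N-2s)`, add up to at least `ε`, whatever part of the ball `B_η(x₀)` is left out. The
integrability hypothesis excludes those sets `A` for which the Bochner integral is meaningless. -/
def HasFarMass {N : ℕ} (s : ℝ) (u : Eucl N → ℝ) (x₀ : Eucl N) : Prop :=
  ∃ ε η ρ : ℝ, 0 < ε ∧ 0 < η ∧ 0 < ρ ∧ ∀ x : Eucl N, ‖x - x₀‖ < ρ → ∀ A : Set (Eucl N),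
    MeasurableSet A → (Metric.ball x₀ η)ᶜ ⊆ A →
    Integrable (fun y => u y * A.indicator (fun y => 1 / ‖x - y‖ ^ ((N : ℝ) + 2 * s)) y) →
    ε ≤ ∫ y, u y * A.indicator (fun y => 1 / ‖x - y‖ ^ ((N : ℝ) + 2 * s)) y

/-! ### Comparison with the barrier -/

/-- If `v - κ b` has a negative minimum over the closed ball at `x`, `b` being the barrier of the
ball, then the fractional Laplacian of `v` at `x` is at most a constant multiple of `κ` minus
the weighted mass of `v` outside the ball. -/
lemma integral_secondDiff_add_le {N : ℕ} (hN : 1 ≤ N) {s L : ℝ} (hs0 : 0 < s)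
    (hL : ∀ p q : ℝ, 0 < p → 0 < q →
      IntegrableOn (fun t => chordDiff s p q t * t ^ (-1 - 2 * s)) (Ioi 0) ∧
      ∫ t in Ioi 0, chordDiff s p q t * t ^ (-1 - 2 * s) ≤ L)
    {v : Eucl N → ℝ} {z x : Eucl N} {r κ : ℝ} (hr : 0 < r) (hκ : 0 ≤ κ)
    (hx : x ∈ Metric.ball z r) (hneg : v x ≤ κ * ballBarrier s z r x)
    (hmin : ∀ y ∈ Metric.ball z r,
      v x - κ * ballBarrier s z r x ≤ v y - κ * ballBarrier s z r y)
    (hv : Integrable fun h : Eucl N =>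
      (2 * v x - v (x + h) - v (x - h)) / ‖h‖ ^ ((N : ℝ) + 2 * s))
    (hw : Integrable fun y : Eucl N =>
      v y * (Metric.ball z r)ᶜ.indicator (fun y => 1 / ‖x - y‖ ^ ((N : ℝ) + 2 * s)) y) :
    (∫ h : Eucl N, (2 * v x - v (x + h) - v (x - h)) / ‖h‖ ^ ((N : ℝ) + 2 * s))
      + 2 * (∫ y : Eucl N,
        v y * (Metric.ball z r)ᶜ.indicator (fun y => 1 / ‖x - y‖ ^ ((N : ℝ) + 2 * s)) y)
      ≤ κ * L * (volume : Measure (Eucl N)).toSphere.real univ := by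
  set B := Metric.ball z r
  set G : Eucl N → ℝ := fun y =>
    v y * Bᶜ.indicator (fun y => 1 / ‖x - y‖ ^ ((N : ℝ) + 2 * s)) y with hG
  have hG1 : Integrable fun h => G (x + h) := hw.comp_add_left x
  have hG2 : Integrable fun h => G (x - h) := hw.comp_sub_left x
  have e1 : ∫ h, G (x + h) = ∫ y, G y := integral_add_left_eq_self G x
  have e2 : ∫ h, G (x - h) = ∫ y, G y := integral_sub_left_eq_self G volume x
  have key := integral_le_of_polar hN (Θ := fun h =>
      (2 * v x - v (x + h) - v (x - h)) / ‖h‖ ^ ((N : ℝ) + 2 * s) + (G (x + h) + G (x - h)))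
    (hv.add (hG1.add hG2))
    (m := fun e t => κ * ((2 * ballBarrier s z r x - ballBarrier s z r (x + t • e)
      - ballBarrier s z r (x - t • e)) * t ^ (-1 - 2 * s))) (L := κ * L) ?_ ?_ ?_
  · have e3 := (integral_add hv (hG1.add hG2)).trans
      (congrArg _ (integral_add hG1 hG2))
    rw [e1, e2] at e3
    simp only [Pi.add_apply] at e3
    rw [e3] at key
    linarith
  · intro e he
    obtain ⟨p, q, hp, hq, h⟩ := exists_chord s hx he
    simp_rw [h]
    exact (hL p q hp hq).1.const_mul κ
  · intro e he
    obtain ⟨p, q, hp, hq, h⟩ := exists_chord s hx he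
    simp_rw [h]
    rw [integral_const_mul]
    exact mul_le_mul_of_nonneg_left (hL p q hp hq).2 hκ
  · intro e he t ht
    have hnorm : ‖t • e‖ = t := by rw [norm_smul, he, mul_one, Real.norm_of_nonneg ht.le]
    have hpow : t ^ (-1 - 2 * s) = t ^ (N - 1) / t ^ ((N : ℝ) + 2 * s) := by
      rw [← Real.rpow_natCast, ← Real.rpow_sub ht, Nat.cast_sub hN]
      congr 1; push_cast; ring
    have hGle : ∀ y : Eucl N, ‖x - y‖ = t →
        (v x - v y) / t ^ ((N : ℝ) + 2 * s) + G y
          ≤ κ * (ballBarrier s z r x - ballBarrier s z r y) / t ^ ((N : ℝ) + 2 * s) := by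
      intro y hy
      by_cases hyB : y ∈ B
      · have : G y = 0 := by simp [hG, hyB]
        rw [this, add_zero]
        gcongr
        linarith [hmin y hyB]
      · have : G y = v y / t ^ ((N : ℝ) + 2 * s) := by
          simp only [hG]
          rw [indicator_of_mem (show y ∈ Bᶜ from hyB), hy]; ring
        rw [this, ← add_div, ballBarrier_eq_zero hs0 hr.le hyB]
        gcongr
        linarith
    have h1 := hGle (x + t • e) (by rw [sub_add_cancel_left, norm_neg, hnorm])
    have h2 := hGle (x - t • e) (by rw [sub_sub_cancel, hnorm])
    rw [hnorm, hpow]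
    have ht0 : 0 ≤ t ^ (N - 1) := by positivity
    calc _ = ((v x - v (x + t • e)) / t ^ ((N : ℝ) + 2 * s) + G (x + t • e)
          + ((v x - v (x - t • e)) / t ^ ((N : ℝ) + 2 * s) + G (x - t • e))) * t ^ (N - 1) := by
            ring
      _ ≤ (κ * (ballBarrier s z r x - ballBarrier s z r (x + t • e)) / t ^ ((N : ℝ) + 2 * s)
          + κ * (ballBarrier s z r x - ballBarrier s z r (x - t • e)) / t ^ ((N : ℝ) + 2 * s))
            * t ^ (N - 1) := mul_le_mul_of_nonneg_right (add_le_add h1 h2) ht0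
      _ = _ := by ring

/-- Tested with the mollifying kernel at `x`, the zeroth order term is at least `-M` times the
mollification of `u` at `x`, as `u` is nonnegative on the support of the kernel. -/
lemma neg_mul_mollify_le {N : ℕ} {Ω : Set (Eucl N)} {c u φ : Eucl N → ℝ} {η M : ℝ} {x : Eucl N}
    (hφ : IsMollifier φ η) (hu : Continuous u) (hM : ∀ᵐ y ∂(volume.restrict Ω), ‖c y‖ ≤ M)
    (hM0 : 0 ≤ M) (hpos : ∀ z, ‖z‖ ≤ η → 0 ≤ u (x + z)) :
    -(M * mollify φ u x) ≤ ∫ y in Ω, c y * u y * φ (y - x) := by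
  have hint := integrable_mul_of_compact (φ := fun a => φ (a - x)) (u := u)
    (by have := hφ.continuous; fun_prop) (hasCompactSupport_comp_sub hφ.hasCompactSupport x) hu
  have hnn : ∀ y, 0 ≤ φ (y - x) * u y := by
    intro y
    rcases le_or_gt ‖y - x‖ η with h | h
    · have := hpos (y - x) h
      rw [add_sub_cancel] at this
      exact mul_nonneg (hφ.nonneg _) this
    · simp [hφ.eq_zero h]
  have h1 : ‖∫ y in Ω, c y * u y * φ (y - x)‖ ≤ ∫ y in Ω, M * (φ (y - x) * u y) := by
    refine norm_integral_le_of_norm_le (hint.const_mul M).integrableOn ?_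
    filter_upwards [hM] with y hy
    have : c y * u y * φ (y - x) = c y * (φ (y - x) * u y) := by ring
    rw [this, norm_mul, Real.norm_of_nonneg (hnn y)]
    exact mul_le_mul_of_nonneg_right hy (hnn y)
  have h2 : ∫ y in Ω, M * (φ (y - x) * u y) ≤ M * mollify φ u x := by
    rw [integral_const_mul, mollify_eq]
    exact mul_le_mul_of_nonneg_left
      (setIntegral_le_integral hint (Eventually.of_forall hnn)) hM0
  have h3 := neg_abs_le (∫ y in Ω, c y * u y * φ (y - x))
  rw [Real.norm_eq_abs] at h1
  linarith

/-- A supersolution with positive far mass dominates a multiple of the barrier in some ball that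
is contained in the given interior ball and touches its boundary at `x₀`. -/
lemma exists_barrier_le {N : ℕ} (hN : 1 ≤ N) {s : ℝ} (hs0 : 0 < s) (hs1 : s < 1)
    {Ω : Set (Eucl N)} {c u : Eucl N → ℝ} (hc : MemLp c ⊤ (volume.restrict Ω))
    (hu_cont : Continuous u)
    (hu_super : IsWeakSupersolution s Ω (fun x => c x * u x) (fun _ => 0) u)
    {x₀ y₀ : Eucl N} {R δ : ℝ} (hball : IsInteriorBall Ω x₀ y₀ R) (hδ : 0 < δ)
    (hnonneg : ∀ x ∈ Metric.ball x₀ δ, 0 ≤ u x) (hmass : HasFarMass s u x₀) :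
    ∃ r κ : ℝ, 0 < r ∧ r ≤ R ∧ 0 < κ ∧ ∀ x ∈ Metric.ball (x₀ + (r / R) • (y₀ - x₀)) r,
      κ * ballBarrier s (x₀ + (r / R) • (y₀ - x₀)) r x ≤ u x := by
  obtain ⟨hR, hBΩ, hx₀⟩ := hball
  obtain ⟨L, hL0, hL⟩ := exists_integral_chordDiff_le hs0 hs1
  obtain ⟨ε, η, ρ, hε, hη, hρ, hmass⟩ := hmass
  set σ := (volume : Measure (Eucl N)).toSphere.real univ
  have hσ : 0 ≤ σ := measureReal_nonneg
  set M := (eLpNorm c ⊤ (volume.restrict Ω)).toReal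
  have hM0 : 0 ≤ M := ENNReal.toReal_nonneg
  have hM : ∀ᵐ y ∂(volume.restrict Ω), ‖c y‖ ≤ M := by
    have h1 := ae_le_eLpNormEssSup (f := c) (μ := volume.restrict Ω)
    rw [← eLpNorm_exponent_top] at h1
    filter_upwards [h1] with y hy
    rw [← toReal_enorm]
    exact ENNReal.toReal_mono hc.2.ne hy
  -- a ball so small that all translates used below stay in the range of the hypotheses
  set r := min R (min δ (min η ρ) / 4) with hrdef
  have hm : 0 < min δ (min η ρ) := by positivity
  have hr : 0 < r := lt_min hR (by positivity)
  have hrR : r ≤ R := min_le_left _ _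
  have hr4 : 4 * r ≤ min δ (min η ρ) := by linarith [min_le_right R (min δ (min η ρ) / 4)]
  have hrδ : 4 * r ≤ δ := hr4.trans (min_le_left _ _)
  have hrη : 4 * r ≤ η := hr4.trans ((min_le_right _ _).trans (min_le_left _ _))
  have hrρ : 4 * r ≤ ρ := hr4.trans ((min_le_right _ _).trans (min_le_right _ _))
  set z := x₀ + (r / R) • (y₀ - x₀) with hz
  have hyx : ‖y₀ - x₀‖ = R := by
    rw [← dist_eq_norm, dist_comm]; exact hx₀
  have hzx : ‖z - x₀‖ = r := by
    rw [hz, add_sub_cancel_left, norm_smul, hyx, Real.norm_of_nonneg (by positivity)]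
    field_simp
  have hzy : ‖z - y₀‖ = R - r := by
    have : z - y₀ = (r / R - 1) • (y₀ - x₀) := by rw [hz, sub_smul, one_smul]; abel
    rw [this, norm_smul, hyx, Real.norm_eq_abs, abs_of_nonpos
      (by rw [sub_nonpos, div_le_one hR]; exact hrR)]
    field_simp; ring
  have hBB : Metric.ball z r ⊆ Metric.ball y₀ R :=
    Metric.ball_subset_ball' (by rw [dist_eq_norm, hzy]; linarith)
  have hzd : ∀ x ∈ Metric.closedBall z r, ‖x - x₀‖ ≤ 2 * r := by
    intro x hx
    rw [Metric.mem_closedBall, dist_eq_norm] at hx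
    have := norm_add_le (x - z) (z - x₀)
    rw [sub_add_sub_cancel] at this
    linarith
  set P := (r ^ 2) ^ s
  have hP : 0 ≤ P := by positivity
  -- the far mass `2 ε` beats both terms of order `κ`
  set κ := ε / (L * σ + M * P + 1)
  have hden : 0 < L * σ + M * P + 1 := by positivity
  have hκ : 0 < κ := by positivity
  have hκe : κ * (L * σ + M * P) < 2 * ε := by
    have : κ * (L * σ + M * P + 1) = ε := div_mul_cancel₀ _ hden.ne'
    nlinarith
  refine ⟨r, κ, hr, hrR, hκ, fun x₁ hx₁ => ?_⟩
  by_contra hlt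
  push Not at hlt
  set b := ballBarrier s z r
  have hb : Continuous b := continuous_ballBarrier hs0 z r
  set m := κ * b x₁ - u x₁
  have hm0 : 0 < m := by simp only [m]; linarith
  -- the sublevel set in which minima of the perturbed function lie
  set K := Metric.closedBall z r ∩ {x | m / 2 ≤ κ * b x}
  have hK : IsCompact K := (isCompact_closedBall z r).inter_right
    (isClosed_le continuous_const (by fun_prop))
  have hKB : K ⊆ Metric.ball z r := by
    rintro x ⟨_, hx⟩
    by_contra hxB
    have : b x = 0 := ballBarrier_eq_zero hs0 hr.le hxB
    simp only [mem_ofPred_eq, this] at hx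
    linarith
  obtain ⟨d, hd, hdK⟩ := hK.exists_cthickening_subset_open Metric.isOpen_ball hKB
  obtain ⟨d', hd', hcont⟩ := Metric.continuousAt_iff.1 (hu_cont.continuousAt (x := x₁)) (m / 2)
    (by positivity)
  set τ := min d (min (d' / 2) r)
  have hτ : 0 < τ := by positivity
  have hτd : τ ≤ d := min_le_left _ _
  have hτd' : τ < d' := ((min_le_right _ _).trans (min_le_left _ _)).trans_lt (by linarith)
  have hτr : τ ≤ r := (min_le_right _ _).trans (min_le_right _ _)
  obtain ⟨φ, hφ⟩ := exists_isMollifier N hτ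
  set v := mollify φ u
  have hv : Continuous v := continuous_mollify hφ hu_cont
  have hv1 : v x₁ ≤ u x₁ + m / 2 := by
    refine mollify_le hφ hu_cont fun y hy => ?_
    have := hcont (x := x₁ + y) (by rw [dist_self_add_left]; linarith)
    rw [Real.dist_eq, abs_lt] at this
    linarith
  have hupos : ∀ x ∈ Metric.closedBall z r, ∀ y : Eucl N, ‖y‖ ≤ τ → 0 ≤ u (x + y) := by
    intro x hx y hy
    apply hnonneg
    rw [Metric.mem_ball, dist_eq_norm, add_sub_right_comm]
    linarith [norm_add_le (x - x₀) y, hzd x hx]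
  obtain ⟨x, hxB, hxmin⟩ := (isCompact_closedBall z r).exists_isMinOn
    ⟨x₁, Metric.ball_subset_closedBall hx₁⟩ (f := fun x => v x - κ * b x)
    (by fun_prop : Continuous fun x => v x - κ * b x).continuousOn
  have hxmin' : ∀ y ∈ Metric.closedBall z r, v x - κ * b x ≤ v y - κ * b y := fun y hy => hxmin hy
  have hx1 : v x - κ * b x ≤ -(m / 2) := by
    have := hxmin' x₁ (Metric.ball_subset_closedBall hx₁)
    simp only [m] at hv1 ⊢
    linarith
  have hvx : 0 ≤ v x := le_mollify hφ hu_cont (hupos x hxB)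
  have hxK : x ∈ K := ⟨hxB, by simp only [mem_ofPred_eq]; linarith⟩
  have hxball : x ∈ Metric.ball z r := hKB hxK
  -- the translated kernel is an admissible test function
  have htsupp : tsupport (fun a => φ (a - x)) ⊆ Ω := by
    have h1 : tsupport (fun a => φ (a - x)) ⊆ Metric.closedBall x τ := by
      refine closure_minimal (fun a ha => ?_) Metric.isClosed_closedBall
      rw [Metric.mem_closedBall, dist_eq_norm]
      by_contra hh
      exact ha (hφ.eq_zero (not_le.1 hh))
    exact h1.trans ((Metric.closedBall_subset_closedBall hτd).trans
      ((Metric.closedBall_subset_cthickening hxK d).trans (hdK.trans (hBB.trans hBΩ))))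
  have hφs : ContDiff ℝ ∞ fun a => φ (a - x) := hφ.smooth.comp (contDiff_id.sub contDiff_const)
  have hφc := hasCompactSupport_comp_sub hφ.hasCompactSupport x
  have htest := hu_super.le_form _ (memHsZero_of_smooth hN hs0 hs1 hφs hφc htsupp)
    (Eventually.of_forall fun a => hφ.nonneg _)
  obtain ⟨hform1, hform2⟩ := gagliardoForm_comp_sub hu_cont hφ.continuous hφ.hasCompactSupport
    hu_super.memHs.2 x (gagliardoSq_lt_top hN hs0 hs1 hφs hφc)
  rw [hform2] at htest
  have hlow := neg_mul_mollify_le hφ hu_cont hM hM0 (hupos x hxB)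
  -- the mass outside the ball
  set k : Eucl N → ℝ := (Metric.ball z r)ᶜ.indicator fun y => 1 / ‖x - y‖ ^ ((N : ℝ) + 2 * s)
  have hkm : Measurable k := (by fun_prop : Measurable fun y : Eucl N =>
    1 / ‖x - y‖ ^ ((N : ℝ) + 2 * s)).indicator Metric.isOpen_ball.measurableSet.compl
  have hk : MemLp k 2 volume := by
    refine memLp_kernel_indicator hs0 hd x Metric.isOpen_ball.measurableSet.compl fun y hy => ?_
    by_contra hlt
    refine hy (hdK (Metric.closedBall_subset_cthickening hxK d ?_))
    rw [Metric.mem_closedBall, dist_comm, dist_eq_norm]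
    exact (not_le.1 hlt).le
  obtain ⟨hw1, hw3, hw2⟩ := integral_mollify_mul hφ hu_cont hu_super.memHs.1 hkm hk
  have hwε : ε ≤ ∫ y, v y * k y := by
    rw [hw2]
    -- averaging over translates by `y` moves the pole to `x + y` and the ball to its translate
    have hshift : ∀ y : Eucl N, ‖y‖ ≤ τ → ε ≤ ∫ a, u (a + y) * k a := by
      intro y hy
      set A : Set (Eucl N) := (fun a => a - y) ⁻¹' (Metric.ball z r)ᶜ
      have hA : MeasurableSet A := (by fun_prop : Measurable fun a : Eucl N => a - y)
        Metric.isOpen_ball.measurableSet.compl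
      have hAη : (Metric.ball x₀ η)ᶜ ⊆ A := by
        intro a ha hay
        apply ha
        have h1 := hzd _ (Metric.ball_subset_closedBall hay)
        have h2 := norm_add_le (a - y - x₀) y
        rw [Metric.mem_ball, dist_eq_norm]
        have h3 : a - y - x₀ + y = a - x₀ := by abel
        rw [h3] at h2
        linarith
      have hfun : (fun a => u a * A.indicator
          (fun a => 1 / ‖x + y - a‖ ^ ((N : ℝ) + 2 * s)) a)
          = fun a => u (a - y + y) * k (a - y) := by
        funext a
        rw [sub_add_cancel]
        congr 1
        by_cases ha : a ∈ A
        · rw [indicator_of_mem ha]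
          simp only [k]
          rw [indicator_of_mem (show a - y ∈ (Metric.ball z r)ᶜ from ha)]
          congr 3; abel
        · rw [indicator_of_notMem ha]
          simp only [k]
          rw [indicator_of_notMem (show a - y ∉ (Metric.ball z r)ᶜ from ha)]
      have hu2 : MemLp (fun a => u (a + y)) 2 volume :=
        hu_super.memHs.1.comp_measurePreserving (measurePreserving_add_right volume y)
      have hprod : Integrable fun a => u (a + y) * k a := hu2.integrable_mul hk
      have := hmass (x + y) ?_ A hA hAη ?_
      · rw [hfun] at this
        rwa [integral_sub_right_eq_self (fun a => u (a + y) * k a) y] at this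
      · rw [add_sub_right_comm]
        linarith [norm_add_le (x - x₀) y, hzd x hxB]
      · rw [hfun]
        exact hprod.comp_sub_right y
    have hφi := hφ.continuous.integrable_of_hasCompactSupport hφ.hasCompactSupport (μ := volume)
    calc ε = ∫ y, φ y * ε := by rw [integral_mul_const, hφ.integral_eq, one_mul]
      _ ≤ _ := by
        refine integral_mono (hφi.mul_const ε) hw3 fun y => ?_
        rcases le_or_gt ‖y‖ τ with hy | hy
        · exact mul_le_mul_of_nonneg_left (hshift y hy) (hφ.nonneg y)
        · simp [hφ.eq_zero hy]
  have hmain := integral_secondDiff_add_le hN hs0 hL hr hκ.le hxball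
    (by linarith : v x ≤ κ * b x)
    (fun y hy => hxmin' y (Metric.ball_subset_closedBall hy)) hform1 hw1
  have hbP : b x ≤ P := ballBarrier_le hs0.le z r x
  have h5 : M * v x ≤ M * (κ * P) :=
    mul_le_mul_of_nonneg_left (by nlinarith) hM0
  nlinarith

/-- Inside a cone about the inner normal the barrier of a ball touching `x₀` is bounded below
by a multiple of `|x - x₀| ^ s`. -/
lemma le_ballBarrier_of_mem_cone {N : ℕ} {s : ℝ} (hs : 0 ≤ s) {Ω : Set (Eucl N)}
    {x₀ y₀ x : Eucl N} {r R β : ℝ} (hr : 0 < r) (hR : 0 < R) (hy : ‖y₀ - x₀‖ = R)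
    (hβ : β ∈ Ioo (0 : ℝ) (Real.pi / 2)) (hx : x ∈ cone Ω x₀ y₀ β) (hx0 : x ≠ x₀)
    (hsmall : ‖x - x₀‖ ≤ r * Real.cos β) :
    x ∈ Metric.ball (x₀ + (r / R) • (y₀ - x₀)) r ∧
    (r * Real.cos β) ^ s * ‖x - x₀‖ ^ s ≤ ballBarrier s (x₀ + (r / R) • (y₀ - x₀)) r x := by
  set n := ‖x - x₀‖
  have hn : 0 < n := norm_pos_iff.2 (sub_ne_zero.2 hx0)
  have hcos : 0 < Real.cos β := Real.cos_pos_of_mem_Ioo ⟨by linarith [hβ.1, Real.pi_pos], hβ.2⟩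
  set a : ℝ := inner ℝ (n⁻¹ • (x - x₀)) (‖y₀ - x₀‖⁻¹ • (y₀ - x₀)) with ha
  have hab : |a| ≤ 1 := by
    refine (abs_real_inner_le_norm _ _).trans ?_
    rw [norm_smul, norm_smul, norm_inv, norm_inv, Real.norm_of_nonneg hn.le, norm_norm, hy,
      inv_mul_cancel₀ hn.ne', inv_mul_cancel₀ hR.ne', one_mul]
  rw [abs_le] at hab
  have hca : Real.cos β < a := by
    have h1 := Real.cos_lt_cos_of_nonneg_of_le_pi (Real.arccos_nonneg a)
      (by linarith [hβ.2, Real.pi_pos]) hx.2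
    rwa [Real.cos_arccos hab.1 hab.2] at h1
  have hinner : inner ℝ (x - x₀) (y₀ - x₀) = n * R * a := by
    rw [ha, inner_smul_left, inner_smul_right, hy]
    simp only [conj_trivial]
    field_simp
  have hsq : ‖x - (x₀ + (r / R) • (y₀ - x₀))‖ ^ 2 = n ^ 2 - 2 * r * n * a + r ^ 2 := by
    rw [show x - (x₀ + (r / R) • (y₀ - x₀)) = (x - x₀) - (r / R) • (y₀ - x₀) by abel,
      norm_sub_sq_real, inner_smul_right, hinner, norm_smul, hy, Real.norm_of_nonneg (by positivity)]
    change n ^ 2 - _ + _ = _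
    field_simp
  have hlow : r * Real.cos β * n ≤ r ^ 2 - ‖x - (x₀ + (r / R) • (y₀ - x₀))‖ ^ 2 := by
    rw [hsq]
    nlinarith [mul_pos hr hn, mul_lt_mul_of_pos_left hca (mul_pos hr hn)]
  have hpos : 0 < r * Real.cos β * n := by positivity
  constructor
  · rw [Metric.mem_ball, dist_eq_norm]
    exact lt_of_pow_lt_pow_left₀ 2 hr.le (by linarith)
  · rw [← Real.mul_rpow (by positivity) hn.le]
    exact Real.rpow_le_rpow hpos.le (hlow.trans (le_max_left _ _)) hs

/-- Positive far mass implies Hopf's lemma. -/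
lemma satisfiesHopfLemma_of_hasFarMass {N : ℕ} (hN : 1 ≤ N) {s : ℝ} (hs0 : 0 < s) (hs1 : s < 1)
    {Ω : Set (Eucl N)} {c u : Eucl N → ℝ} (hc : MemLp c ⊤ (volume.restrict Ω))
    (hu_cont : Continuous u)
    (hu_super : IsWeakSupersolution s Ω (fun x => c x * u x) (fun _ => 0) u)
    {x₀ : Eucl N} (hx₀ : x₀ ∉ Ω) {δ : ℝ} (hδ : 0 < δ)
    (hnonneg : ∀ x ∈ Metric.ball x₀ δ, 0 ≤ u x) (hmass : HasFarMass s u x₀) :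
    SatisfiesHopfLemma s Ω u x₀ := by
  intro y₀ R hball β hβ
  obtain ⟨r, κ, hr, hrR, hκ, hle⟩ :=
    exists_barrier_le hN hs0 hs1 hc hu_cont hu_super hball hδ hnonneg hmass
  have hcos : 0 < Real.cos β := Real.cos_pos_of_mem_Ioo ⟨by linarith [hβ.1, Real.pi_pos], hβ.2⟩
  have hyx : ‖y₀ - x₀‖ = R := by
    rw [← dist_eq_norm, dist_comm]; exact hball.2.2
  set C := κ * (r * Real.cos β) ^ s
  have hC : 0 < C := by positivity
  have hC' : (0 : EReal) < (C : EReal) := by exact_mod_cast hC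
  refine hC'.trans_le (le_liminf_of_le (by isBoundedDefault) ?_)
  have hnear : Metric.ball x₀ (r * Real.cos β) ∈ 𝓝[cone Ω x₀ y₀ β] x₀ :=
    mem_nhdsWithin_of_mem_nhds (Metric.ball_mem_nhds _ (by positivity))
  filter_upwards [hnear, self_mem_nhdsWithin] with x hx hxc
  rw [EReal.coe_le_coe_iff]
  have hx0 : x ≠ x₀ := fun h => hx₀ (h ▸ hxc.1)
  have hn : 0 < ‖x - x₀‖ := norm_pos_iff.2 (sub_ne_zero.2 hx0)
  rw [Metric.mem_ball, dist_eq_norm] at hx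
  obtain ⟨h1, h2⟩ := le_ballBarrier_of_mem_cone hs0.le hr hball.1 hyx hβ hxc hx0 hx.le
  rw [le_div_iff₀ (by positivity)]
  calc C * ‖x - x₀‖ ^ s = κ * ((r * Real.cos β) ^ s * ‖x - x₀‖ ^ s) := by simp only [C]; ring
    _ ≤ _ := mul_le_mul_of_nonneg_left h2 hκ.le
    _ ≤ u x := hle x h1

/-! ### Far mass from Poisson integrals -/

/-- The far part of the nonlocal mass depends continuously on the pole and on the height. -/
lemma continuousAt_far_integral {N : ℕ} {s : ℝ} (hs0 : 0 < s) {u : Eucl N → ℝ}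
    (hu : Continuous u) (hu2 : MemLp u 2 volume) (x₀ : Eucl N) {δ : ℝ} (hδ : 0 < δ) :
    ContinuousAt (fun p : Eucl N × ℝ => ∫ y in (Metric.ball x₀ δ)ᶜ,
      u y / (‖p.1 - y‖ ^ 2 + p.2 ^ 2) ^ (((N : ℝ) + 2 * s) / 2)) (x₀, 0) := by
  set γ := ((N : ℝ) + 2 * s) / 2 with hγ
  have hγ0 : 0 < γ := by positivity
  have hmeas : MeasurableSet (Metric.ball x₀ δ)ᶜ := Metric.isOpen_ball.measurableSet.compl
  have hk := memLp_kernel_indicator hs0 hδ x₀ hmeas (fun y hy => by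
    rw [← dist_eq_norm, dist_comm]; simpa using hy)
  have hbd := hu2.integrable_mul hk
  have hbd2 : IntegrableOn (fun y => 2 ^ (2 * γ) * (‖u y‖ *
      (1 / ‖x₀ - y‖ ^ ((N : ℝ) + 2 * s)))) (Metric.ball x₀ δ)ᶜ := by
    refine Integrable.const_mul ?_ _
    refine (hbd.norm.integrableOn (s := (Metric.ball x₀ δ)ᶜ)).congr_fun (fun y hy => ?_) hmeas
    simp only [Pi.mul_apply, norm_mul]
    rw [indicator_of_mem hy, Real.norm_of_nonneg
      (by positivity : 0 ≤ 1 / ‖x₀ - y‖ ^ ((N : ℝ) + 2 * s))]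
  have hum := hu.measurable
  refine continuousAt_of_dominated (Eventually.of_forall fun p =>
    (by fun_prop : Measurable _).aestronglyMeasurable) ?_ hbd2 ?_
  · have hnear : ∀ᶠ p : Eucl N × ℝ in 𝓝 (x₀, 0), ‖p.1 - x₀‖ < δ / 2 := by
      have : Continuous fun p : Eucl N × ℝ => ‖p.1 - x₀‖ := by fun_prop
      exact this.continuousAt.eventually_lt continuousAt_const (by simpa using half_pos hδ)
    filter_upwards [hnear] with p hp
    filter_upwards [ae_restrict_mem hmeas] with y hy
    have hy' : δ ≤ ‖x₀ - y‖ := by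
      rw [← dist_eq_norm, dist_comm]; simpa using hy
    have h1 : ‖x₀ - y‖ ≤ 2 * ‖p.1 - y‖ := by
      have := norm_sub_le (p.1 - y) (p.1 - x₀)
      rw [sub_sub_sub_cancel_left] at this
      have e : ‖x₀ - y‖ = ‖p.1 - y - (p.1 - x₀)‖ := by congr 1; abel
      have := norm_sub_le (p.1 - y) (p.1 - x₀)
      linarith
    have h2 : ‖x₀ - y‖ ^ ((N : ℝ) + 2 * s)
        ≤ 2 ^ (2 * γ) * (‖p.1 - y‖ ^ 2 + p.2 ^ 2) ^ γ := by
      have e1 : ‖x₀ - y‖ ^ ((N : ℝ) + 2 * s) = (‖x₀ - y‖ ^ 2) ^ γ := by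
        rw [← Real.rpow_natCast, ← Real.rpow_mul (norm_nonneg _)]
        congr 1; rw [hγ]; push_cast; ring
      have e2 : (2 : ℝ) ^ (2 * γ) = (2 ^ 2) ^ γ := by
        rw [← Real.rpow_natCast, ← Real.rpow_mul (by norm_num)]; norm_num
      rw [e1, e2, ← Real.mul_rpow (by positivity) (by positivity)]
      refine Real.rpow_le_rpow (by positivity) ?_ hγ0.le
      nlinarith [sq_nonneg p.2, norm_nonneg (x₀ - y), norm_nonneg (p.1 - y)]
    have hpos : 0 < ‖x₀ - y‖ := hδ.trans_le hy'
    have hpos2 : 0 < ‖p.1 - y‖ := by linarith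
    rw [norm_div, Real.norm_of_nonneg (by positivity : 0 ≤ (‖p.1 - y‖ ^ 2 + p.2 ^ 2) ^ γ),
      div_le_iff₀ (by positivity)]
    calc ‖u y‖ = ‖u y‖ * (1 / ‖x₀ - y‖ ^ ((N : ℝ) + 2 * s)) * ‖x₀ - y‖ ^ ((N : ℝ) + 2 * s) := by
          field_simp
      _ ≤ ‖u y‖ * (1 / ‖x₀ - y‖ ^ ((N : ℝ) + 2 * s)) *
          (2 ^ (2 * γ) * (‖p.1 - y‖ ^ 2 + p.2 ^ 2) ^ γ) := by gcongr
      _ = _ := by ring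
  · filter_upwards [ae_restrict_mem hmeas] with y hy
    have hy' : δ ≤ ‖x₀ - y‖ := by
      rw [← dist_eq_norm, dist_comm]; simpa using hy
    have hpos : 0 < ‖x₀ - y‖ := hδ.trans_le hy'
    have hb : 0 < ‖x₀ - y‖ ^ 2 + (0 : ℝ) ^ 2 := by positivity
    refine ContinuousAt.div continuousAt_const ?_ (Real.rpow_pos_of_pos hb _).ne'
    exact ContinuousAt.rpow_const (by fun_prop) (Or.inl hb.ne')

/-- If the Poisson integrals of `u` at `x₀`, divided by `t ^ (2s)`, stay bounded below as the
height `t` tends to `0`, then `u` has positive far mass at `x₀`. -/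
lemma hasFarMass_of_poisson {N : ℕ} (hN : 1 ≤ N) {s : ℝ} (hs0 : 0 < s) {u : Eucl N → ℝ}
    (hu : Continuous u) (hu2 : MemLp u 2 volume) {x₀ : Eucl N} {δ : ℝ} (hδ : 0 < δ)
    (hnonneg : ∀ x ∈ Metric.ball x₀ δ, 0 ≤ u x) {a : ℝ} (ha : 0 < a)
    (hP : ∀ᶠ t : ℝ in 𝓝[>] 0, a ≤ ∫ y, u y / (‖x₀ - y‖ ^ 2 + t ^ 2) ^ (((N : ℝ) + 2 * s) / 2)) :
    HasFarMass s u x₀ := by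
  have := nontrivial_eucl hN
  set γ := ((N : ℝ) + 2 * s) / 2 with hγ
  have hγ0 : 0 < γ := by positivity
  set F : Eucl N × ℝ → ℝ := fun p => ∫ y in (Metric.ball x₀ δ)ᶜ,
      u y / (‖p.1 - y‖ ^ 2 + p.2 ^ 2) ^ γ with hF
  have hFc : ContinuousAt F (x₀, 0) := continuousAt_far_integral hs0 hu hu2 x₀ hδ
  obtain ⟨ρ₁, hρ₁, hFρ⟩ := Metric.continuousAt_iff.1 hFc (a / 8) (by positivity)
  -- a height at which the Poisson integral is large and the far part has stabilized
  obtain ⟨t, ht1, ht2⟩ := (hP.and (Ioo_mem_nhdsGT hρ₁)).exists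
  have ht0 : 0 < t := ht2.1
  set W : Eucl N → ℝ := fun y => u y / (‖x₀ - y‖ ^ 2 + t ^ 2) ^ γ with hW
  -- the Bochner integral of a function that is not integrable is `0`, which is less than `a`
  have hWi : Integrable W := by
    by_contra h
    rw [integral_undef h] at ht1
    linarith
  have hsmall : Tendsto (fun η => ∫ y in Metric.cthickening η {x₀}, W y) (𝓝 0) (𝓝 0) := by
    refine hWi.tendsto_setIntegral_nhds_zero ?_
    have h1 : ∃ R > 0, volume (Metric.cthickening R {x₀}) ≠ ⊤ :=
      ⟨1, one_pos, (isCompact_singleton.cthickening).measure_lt_top.ne⟩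
    have h2 := tendsto_measure_cthickening_of_isClosed h1 isClosed_singleton
    rwa [measure_singleton] at h2
  have hsmall' : ∀ᶠ η in 𝓝[>] (0 : ℝ), |∫ y in Metric.cthickening η {x₀}, W y| < a / 8 := by
    have := (hsmall.mono_left (nhdsWithin_le_nhds (s := Ioi 0))).abs
    rw [abs_zero] at this
    exact this.eventually_lt_const (by positivity)
  obtain ⟨η, hη1, hη2⟩ := (hsmall'.and (Ioo_mem_nhdsGT hδ)).exists
  have hη0 : 0 < η := hη2.1
  rw [Metric.cthickening_singleton _ hη0.le] at hη1
  set ρ := min ρ₁ (min η (t ^ 2 / (3 * δ))) with hρdef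
  have hρ0 : 0 < ρ := by positivity
  have hρρ : ρ ≤ ρ₁ := min_le_left _ _
  have hρη : ρ ≤ η := (min_le_right _ _).trans (min_le_left _ _)
  have hρt : ρ * (3 * δ) ≤ t ^ 2 := by
    have : ρ ≤ t ^ 2 / (3 * δ) := (min_le_right _ _).trans (min_le_right _ _)
    rwa [le_div_iff₀ (by positivity)] at this
  refine ⟨a / 2, η, ρ, by positivity, hη0, hρ0, fun x hx A hA hAη hG => ?_⟩
  set D := (Metric.ball x₀ δ)ᶜ
  have hD : MeasurableSet D := Metric.isOpen_ball.measurableSet.compl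
  set E := (Metric.closedBall x₀ η ∪ D)ᶜ
  have hE : MeasurableSet E := (measurableSet_closedBall.union hD).compl
  have hdisj : Disjoint (Metric.closedBall x₀ η) D := by
    rw [Set.disjoint_left]
    intro y hy hyD
    exact hyD (Metric.closedBall_subset_ball hη2.2 hy)
  have hsplit : ∫ y in E, W y
      = (∫ y, W y) - (∫ y in Metric.closedBall x₀ η, W y) - ∫ y in D, W y := by
    have h1 := integral_add_compl (measurableSet_closedBall.union hD) hWi
      (s := Metric.closedBall x₀ η ∪ D)
    rw [setIntegral_union hdisj hD hWi.integrableOn hWi.integrableOn] at h1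
    linarith
  set G : Eucl N → ℝ := fun y => u y * A.indicator (fun y => 1 / ‖x - y‖ ^ ((N : ℝ) + 2 * s)) y
  have hker : ∀ y, ‖x - y‖ ^ ((N : ℝ) + 2 * s) = (‖x - y‖ ^ 2 + (0 : ℝ) ^ 2) ^ γ := by
    intro y
    rw [zero_pow two_ne_zero, add_zero, ← Real.rpow_natCast, ← Real.rpow_mul (norm_nonneg _)]
    congr 1; rw [hγ]; push_cast; ring
  -- outside `B_η(x₀)` the height `t` outweighs the displacement of the pole, as `ρ` is small
  have hle : ∀ y, E.indicator W y + D.indicator G y ≤ G y := by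
    intro y
    by_cases hyD : y ∈ D
    · have : y ∉ E := fun h => h (Or.inr hyD)
      rw [indicator_of_notMem this, indicator_of_mem hyD, zero_add]
    · rw [indicator_of_notMem hyD, add_zero]
      have hyδ : y ∈ Metric.ball x₀ δ := not_not.1 hyD
      have huy := hnonneg y hyδ
      by_cases hyE : y ∈ E
      · rw [indicator_of_mem hyE]
        have hyη : y ∉ Metric.closedBall x₀ η := fun h => hyE (Or.inl h)
        have hyA : y ∈ A := hAη fun h => hyη (Metric.ball_subset_closedBall h)
        simp only [G, hW]
        rw [indicator_of_mem hyA, hker, div_eq_mul_one_div]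
        rw [Metric.mem_closedBall, dist_comm, dist_eq_norm, not_le] at hyη
        rw [Metric.mem_ball, dist_comm, dist_eq_norm] at hyδ
        have htri1 : ‖x₀ - y‖ ≤ ‖x - y‖ + ‖x - x₀‖ := by
          have e : x₀ - y = (x - y) - (x - x₀) := by abel
          rw [e]; exact norm_sub_le _ _
        have htri2 : ‖x - y‖ ≤ ‖x₀ - y‖ + ‖x - x₀‖ := by
          have e : x - y = (x₀ - y) + (x - x₀) := by abel
          rw [e]; exact norm_add_le _ _
        have hpos : 0 < ‖x - y‖ := by linarith
        refine mul_le_mul_of_nonneg_left (one_div_le_one_div_of_le (by positivity)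
          (Real.rpow_le_rpow (by positivity) ?_ hγ0.le)) huy
        have hd : ‖x - y‖ ^ 2 ≤ (‖x₀ - y‖ + ρ) ^ 2 :=
          pow_le_pow_left₀ (norm_nonneg _) (by linarith) 2
        nlinarith
      · rw [indicator_of_notMem hyE]
        exact mul_nonneg huy (indicator_nonneg (fun _ _ => by positivity) _)
  have hH := integral_mono ((hWi.indicator hE).add (hG.indicator hD)) hG hle
  have hsum : ∫ y, (E.indicator W + D.indicator G) y = (∫ y in E, W y) + ∫ y in D, G y := by
    rw [integral_add' (hWi.indicator hE) (hG.indicator hD), integral_indicator hE,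
      integral_indicator hD]
  rw [hsum] at hH
  have hGF : ∫ y in D, G y = F (x, 0) := by
    refine setIntegral_congr_fun hD fun y hy => ?_
    have hyA : y ∈ A := hAη fun h => hy (Metric.ball_subset_ball hη2.2.le h)
    simp only [G]
    rw [indicator_of_mem hyA, hker, ← div_eq_mul_one_div]
  have hF1 := hFρ (x := (x, 0)) (by
    rw [Prod.dist_eq, max_lt_iff, dist_self, dist_eq_norm]
    exact ⟨hx.trans_le hρρ, hρ₁⟩)
  have hF2 := hFρ (x := (x₀, t)) (by
    rw [Prod.dist_eq, max_lt_iff, dist_self, Real.dist_eq, sub_zero, abs_of_pos ht0]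
    exact ⟨hρ₁, ht2.2⟩)
  have hF3 : ∫ y in D, W y = F (x₀, t) := rfl
  rw [Real.dist_eq, abs_lt] at hF1 hF2
  rw [abs_lt] at hη1
  rw [hsplit, hGF, hF3] at hH
  linarith

/-! ### The weighted Laplacian and its maximum principle -/

/-- `f` is differentiable near `τ₀` with `f'(τ₀) = f₁`, and its derivative has derivative `f₂`
at `τ₀`. -/
def HasSecondDerivAt (f : ℝ → ℝ) (f₁ f₂ τ₀ : ℝ) : Prop :=
  ∃ g : ℝ → ℝ, (∀ᶠ τ in 𝓝 τ₀, HasDerivAt f (g τ) τ) ∧ g τ₀ = f₁ ∧ HasDerivAt g f₂ τ₀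

namespace HasSecondDerivAt

variable {f h : ℝ → ℝ} {f₁ f₂ h₁ h₂ τ₀ : ℝ}

lemma hasDerivAt (hf : HasSecondDerivAt f f₁ f₂ τ₀) : HasDerivAt f f₁ τ₀ := by
  obtain ⟨g, h1, rfl, _⟩ := hf
  exact h1.self_of_nhds

lemma hasDerivAt_deriv (hf : HasSecondDerivAt f f₁ f₂ τ₀) : HasDerivAt (deriv f) f₂ τ₀ := by
  obtain ⟨g, h1, _, h3⟩ := hf
  exact h3.congr_of_eventuallyEq (h1.mono fun τ hτ => hτ.deriv)

lemma unique (hf : HasSecondDerivAt f f₁ f₂ τ₀) (hf' : HasSecondDerivAt f h₁ h₂ τ₀) :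
    f₁ = h₁ ∧ f₂ = h₂ :=
  ⟨hf.hasDerivAt.unique hf'.hasDerivAt, hf.hasDerivAt_deriv.unique hf'.hasDerivAt_deriv⟩

lemma congr (hf : HasSecondDerivAt f f₁ f₂ τ₀) (he : h =ᶠ[𝓝 τ₀] f) :
    HasSecondDerivAt h f₁ f₂ τ₀ := by
  obtain ⟨g, h1, h2, h3⟩ := hf
  refine ⟨g, ?_, h2, h3⟩
  filter_upwards [h1, he.eventuallyEq_nhds] with τ hτ hτ'
  exact hτ.congr_of_eventuallyEq hτ'

lemma sub (hf : HasSecondDerivAt f f₁ f₂ τ₀) (hh : HasSecondDerivAt h h₁ h₂ τ₀) :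
    HasSecondDerivAt (fun τ => f τ - h τ) (f₁ - h₁) (f₂ - h₂) τ₀ := by
  obtain ⟨g, a1, rfl, a3⟩ := hf
  obtain ⟨k, b1, rfl, b3⟩ := hh
  exact ⟨fun τ => g τ - k τ, (a1.and b1).mono fun τ hτ => hτ.1.sub hτ.2, rfl, a3.sub b3⟩

lemma mul (hf : HasSecondDerivAt f f₁ f₂ τ₀) (hh : HasSecondDerivAt h h₁ h₂ τ₀) :
    HasSecondDerivAt (fun τ => f τ * h τ) (f₁ * h τ₀ + f τ₀ * h₁)
      (f₂ * h τ₀ + 2 * (f₁ * h₁) + f τ₀ * h₂) τ₀ := by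
  have df := hf.hasDerivAt
  have dh := hh.hasDerivAt
  obtain ⟨g, a1, rfl, a3⟩ := hf
  obtain ⟨k, b1, rfl, b3⟩ := hh
  refine ⟨fun τ => g τ * h τ + f τ * k τ, (a1.and b1).mono fun τ hτ => hτ.1.mul hτ.2, rfl, ?_⟩
  exact ((a3.mul dh).add (df.mul b3)).congr_deriv (by ring)

lemma const (c τ₀ : ℝ) : HasSecondDerivAt (fun _ => c) 0 0 τ₀ :=
  ⟨fun _ => 0, Eventually.of_forall fun _ => hasDerivAt_const _ _, rfl, hasDerivAt_const _ _⟩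

lemma const_mul (c : ℝ) (hf : HasSecondDerivAt f f₁ f₂ τ₀) :
    HasSecondDerivAt (fun τ => c * f τ) (c * f₁) (c * f₂) τ₀ := by
  obtain ⟨g, a1, rfl, a3⟩ := hf
  exact ⟨fun τ => c * g τ, a1.mono fun τ hτ => hτ.const_mul c, rfl, a3.const_mul c⟩

lemma rpow (a : ℝ) (hτ : 0 < τ₀) :
    HasSecondDerivAt (fun τ => τ ^ a) (a * τ₀ ^ (a - 1)) (a * ((a - 1) * τ₀ ^ (a - 2))) τ₀ := by
  refine ⟨fun τ => a * τ ^ (a - 1), ?_, rfl, ?_⟩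
  · filter_upwards [lt_mem_nhds hτ] with τ hτ'
    exact Real.hasDerivAt_rpow_const (Or.inl hτ'.ne')
  · have := (Real.hasDerivAt_rpow_const (p := a - 1) (Or.inl hτ.ne')).const_mul a
    rwa [show a - 1 - 1 = a - 2 by ring] at this

lemma quadratic (c b e τ₀ : ℝ) :
    HasSecondDerivAt (fun τ => c + b * τ + e * τ ^ 2) (b + 2 * e * τ₀) (2 * e) τ₀ := by
  refine ⟨fun τ => b + 2 * e * τ, Eventually.of_forall fun τ => ?_, rfl, ?_⟩
  · have := (((hasDerivAt_id τ).const_mul b).const_add c).add (((hasDerivAt_id τ).pow 2).const_mul e)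
    refine this.congr_deriv ?_
    simp; ring
  · simpa using ((hasDerivAt_id τ₀).const_mul (2 * e)).const_add b

lemma nonpos_of_isLocalMax (hf : HasSecondDerivAt f f₁ f₂ τ₀) (hm : IsLocalMax f τ₀) :
    f₁ = 0 ∧ f₂ ≤ 0 := by
  have h0 : f₁ = 0 := hm.hasDerivAt_eq_zero hf.hasDerivAt
  refine ⟨h0, ?_⟩
  by_contra hpos
  push Not at hpos
  have hmin : IsLocalMin f τ₀ := by
    refine isLocalMin_of_deriv_deriv_pos ?_ ?_ hf.hasDerivAt.continuousAt
    · rw [hf.hasDerivAt_deriv.deriv]; exact hpos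
    · rw [hf.hasDerivAt.deriv, h0]
  have hconst : f =ᶠ[𝓝 τ₀] fun _ => f τ₀ := by
    filter_upwards [hm, hmin] with τ h1 h2 using le_antisymm h1 h2
  have := (((HasSecondDerivAt.const (f τ₀) τ₀).congr hconst).unique hf).2
  linarith

end HasSecondDerivAt

/-- At `(x, t)` the function `W` has second derivatives along the coordinate lines, and
`Δ_x W + ∂_t² W + (a / t) ∂_t W = ℓ`. Up to the factor `t ^ a` this is `div (t ^ a ∇ W)`. -/
def HasWeightedLaplacianAt {N : ℕ} (a : ℝ) (W : Eucl N → ℝ → ℝ) (x : Eucl N) (t ℓ : ℝ) : Prop :=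
  ∃ (d₁ d₂ : Fin N → ℝ) (p₁ p₂ : ℝ),
    (∀ i, HasSecondDerivAt (fun τ => W (x + τ • EuclideanSpace.single i 1) t) (d₁ i) (d₂ i) 0) ∧
    HasSecondDerivAt (W x) p₁ p₂ t ∧ ℓ = ∑ i, d₂ i + p₂ + a / t * p₁

namespace HasWeightedLaplacianAt

variable {N : ℕ} {a : ℝ} {W Z : Eucl N → ℝ → ℝ} {x : Eucl N} {t ℓ m : ℝ}

lemma sub (hW : HasWeightedLaplacianAt a W x t ℓ) (hZ : HasWeightedLaplacianAt a Z x t m) :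
    HasWeightedLaplacianAt a (fun x t => W x t - Z x t) x t (ℓ - m) := by
  obtain ⟨d₁, d₂, p₁, p₂, h1, h2, rfl⟩ := hW
  obtain ⟨e₁, e₂, q₁, q₂, k1, k2, rfl⟩ := hZ
  refine ⟨fun i => d₁ i - e₁ i, fun i => d₂ i - e₂ i, p₁ - q₁, p₂ - q₂,
    fun i => (h1 i).sub (k1 i), h2.sub k2, ?_⟩
  rw [Finset.sum_sub_distrib]; ring

lemma const_mul (c : ℝ) (hW : HasWeightedLaplacianAt a W x t ℓ) :
    HasWeightedLaplacianAt a (fun x t => c * W x t) x t (c * ℓ) := by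
  obtain ⟨d₁, d₂, p₁, p₂, h1, h2, rfl⟩ := hW
  refine ⟨fun i => c * d₁ i, fun i => c * d₂ i, c * p₁, c * p₂,
    fun i => (h1 i).const_mul c, h2.const_mul c, ?_⟩
  rw [← Finset.mul_sum]; ring

lemma congr_of_pos (hW : HasWeightedLaplacianAt a W x t ℓ) (ht : 0 < t)
    (h : ∀ y τ, 0 < τ → Z y τ = W y τ) : HasWeightedLaplacianAt a Z x t ℓ := by
  obtain ⟨d₁, d₂, p₁, p₂, h1, h2, rfl⟩ := hW
  refine ⟨d₁, d₂, p₁, p₂, fun i => (h1 i).congr (Eventually.of_forall fun τ => h _ t ht),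
    h2.congr ?_, rfl⟩
  filter_upwards [lt_mem_nhds ht] with τ hτ using h x τ hτ

/-- The power `t ^ (2s)` solves the equation with weight `t ^ (1 - 2s)`. -/
lemma rpow_height (s : ℝ) (x : Eucl N) (ht : 0 < t) :
    HasWeightedLaplacianAt (1 - 2 * s) (fun _ t => t ^ (2 * s)) x t 0 := by
  refine ⟨fun _ => 0, fun _ => 0, _, _, fun i => HasSecondDerivAt.const _ _,
    HasSecondDerivAt.rpow (2 * s) ht, ?_⟩
  have e : t ^ (2 * s - 1) = t ^ (2 * s - 2) * t := by
    rw [← Real.rpow_add_one ht.ne']; ring_nf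
  rw [e]
  simp only [Finset.sum_const_zero]
  field_simp
  ring

lemma const (c : ℝ) (x : Eucl N) (t : ℝ) :
    HasWeightedLaplacianAt a (fun _ _ => c) x t 0 :=
  ⟨fun _ => 0, fun _ => 0, 0, 0, fun _ => HasSecondDerivAt.const _ _,
    HasSecondDerivAt.const _ _, by simp⟩

lemma norm_add_smul_single_sq (x : Eucl N) (i : Fin N) (τ : ℝ) :
    ‖x + τ • EuclideanSpace.single i (1 : ℝ)‖ ^ 2 = ‖x‖ ^ 2 + 2 * x i * τ + 1 * τ ^ 2 := by
  rw [norm_add_sq_real, inner_smul_right, norm_smul,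
    EuclideanSpace.inner_single_right]
  simp
  ring

/-- The quadratic `|x|² - μ t²` used as a barrier at infinity. -/
lemma quadratic (μ : ℝ) (x : Eucl N) (ht : 0 < t) :
    HasWeightedLaplacianAt a (fun x t => ‖x‖ ^ 2 - μ * t ^ 2) x t (2 * N - 2 * μ * (1 + a)) := by
  refine ⟨fun i => 2 * x i, fun _ => 2, -(2 * μ * t), -(2 * μ), fun i => ?_, ?_, ?_⟩
  · have h := HasSecondDerivAt.quadratic (‖x‖ ^ 2 - μ * t ^ 2) (2 * x i) 1 0
    simp only [mul_zero, add_zero, mul_one] at h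
    refine h.congr (Eventually.of_forall fun τ => ?_)
    simp only [norm_add_smul_single_sq]; ring
  · have h := HasSecondDerivAt.quadratic (‖x‖ ^ 2) 0 (-μ) t
    convert h.congr (h := fun t => ‖x‖ ^ 2 - μ * t ^ 2)
      (Eventually.of_forall fun τ => by ring) using 1 <;> ring
  · simp only [Finset.sum_const, Finset.card_univ, Fintype.card_fin, nsmul_eq_mul]
    field_simp
    ring

/-- At an interior maximum the weighted Laplacian is nonpositive. -/
lemma nonpos_of_isLocalMax (hW : HasWeightedLaplacianAt a W x t ℓ)
    (hm : ∀ᶠ p : Eucl N × ℝ in 𝓝 (x, t), W p.1 p.2 ≤ W x t) : ℓ ≤ 0 := by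
  obtain ⟨d₁, d₂, p₁, p₂, h1, h2, rfl⟩ := hW
  have ht := h2.nonpos_of_isLocalMax
    ((show Tendsto (fun τ : ℝ => (x, τ)) (𝓝 t) (𝓝 (x, t)) from
      (by fun_prop : Continuous fun τ : ℝ => (x, τ)).continuousAt).eventually hm)
  have hx : ∀ i, d₂ i ≤ 0 := fun i => by
    refine ((h1 i).nonpos_of_isLocalMax ?_).2
    have : Tendsto (fun τ : ℝ => (x + τ • EuclideanSpace.single i (1 : ℝ), t)) (𝓝 0)
        (𝓝 (x, t)) := by
      have hc : Continuous fun τ : ℝ => (x + τ • EuclideanSpace.single i (1 : ℝ), t) := by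
        fun_prop
      simpa using hc.tendsto 0
    have h3 := this.eventually hm
    simpa [IsLocalMax, IsMaxFilter] using h3
  rw [ht.1, mul_zero, add_zero]
  have := Finset.sum_nonpos fun i (_ : i ∈ Finset.univ) => hx i
  linarith [ht.2]

/-- If `G` solves the equation with weight `t ^ (1 + 2s)`, then `t ^ (2s) G` solves the one with
weight `t ^ (1 - 2s)`. -/
lemma rpow_mul {s : ℝ} {G : Eucl N → ℝ → ℝ} (ht : 0 < t)
    (hG : HasWeightedLaplacianAt (1 + 2 * s) G x t 0) :
    HasWeightedLaplacianAt (1 - 2 * s) (fun x t => t ^ (2 * s) * G x t) x t 0 := by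
  obtain ⟨d₁, d₂, p₁, p₂, h1, h2, h3⟩ := hG
  refine ⟨fun i => t ^ (2 * s) * d₁ i, fun i => t ^ (2 * s) * d₂ i, _, _,
    fun i => (h1 i).const_mul _, (HasSecondDerivAt.rpow (2 * s) ht).mul h2, ?_⟩
  rw [← Finset.mul_sum]
  have e1 : t ^ (2 * s - 1) = t ^ (2 * s - 2) * t := by
    rw [← Real.rpow_add_one ht.ne']; ring_nf
  have e2 : t ^ (2 * s) = t ^ (2 * s - 2) * t ^ 2 := by
    rw [← Real.rpow_natCast, ← Real.rpow_add ht]; push_cast; ring_nf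
  have e3 : ∑ i, d₂ i = -p₂ - (1 + 2 * s) / t * p₁ := by linarith
  rw [e3, e1, e2]
  field_simp
  ring

end HasWeightedLaplacianAt

/-- One-sided maximum principle in the half-space: a solution of `div (t ^ (1 - 2s) ∇ W) = 0`
that grows at most like `t ^ s` and has limit `0` at the boundary, locally uniformly,
is nonpositive. -/
lemma nonpos_of_hasWeightedLaplacianAt {N : ℕ} {s : ℝ} (hs0 : 0 < s) (hs1 : s < 1)
    {W : Eucl N → ℝ → ℝ} {C : ℝ} (hC : 0 ≤ C)
    (hcont : ContinuousOn (fun p : Eucl N × ℝ => W p.1 p.2) {p | 0 < p.2})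
    (heq : ∀ x t, 0 < t → HasWeightedLaplacianAt (1 - 2 * s) W x t 0)
    (hgrowth : ∀ x t, 0 < t → W x t ≤ C * (1 + t ^ s))
    (hbdry : ∀ R ζ : ℝ, 0 < ζ → ∀ᶠ t in 𝓝[>] (0 : ℝ), ∀ x ∈ Metric.closedBall (0 : Eucl N) R,
      W x t ≤ ζ)
    (x₁ : Eucl N) (t₁ : ℝ) (ht₁ : 0 < t₁) : W x₁ t₁ ≤ 0 := by
  have key : ∀ ζ : ℝ, 0 < ζ → W x₁ t₁ ≤ ζ * (3 + t₁ ^ (2 * s)) := by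
    intro ζ hζ
    -- `|x|² - μ t²` then has negative weighted Laplacian `-4 (1 - s)`
    set μ : ℝ := N / (2 * (1 - s)) + 1
    have h1s : 0 < 1 - s := by linarith
    have hμ : 0 < μ := by positivity
    have hμN : 2 * (N : ℝ) - 2 * μ * (1 + (1 - 2 * s)) = -(4 * (1 - s)) := by
      simp only [μ]; field_simp; ring
    -- the height `T` beyond which `t ^ (2s)` beats the growth of `W`
    obtain ⟨T, hT1, hTt, hTC⟩ : ∃ T : ℝ, 1 ≤ T ∧ t₁ < T ∧ C * (1 + T ^ s) ≤ ζ * T ^ (2 * s) := by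
      have h1 : ∀ᶠ T : ℝ in atTop, 2 * C / ζ ≤ T ^ s :=
        (tendsto_rpow_atTop hs0).eventually_ge_atTop _
      obtain ⟨T, hT, hT1, hT2⟩ :=
        (h1.and ((eventually_ge_atTop 1).and (eventually_gt_atTop t₁))).exists
      refine ⟨T, hT1, hT2, ?_⟩
      rw [div_le_iff₀ hζ] at hT
      have h2 : 1 ≤ T ^ s := Real.one_le_rpow hT1 hs0.le
      have h3 : T ^ (2 * s) = T ^ s * T ^ s := by
        rw [← Real.rpow_add (by linarith)]; ring_nf
      rw [h3]
      nlinarith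
    have hT0 : 0 < T := by linarith
    -- the weight of the quadratic barrier, harmless at `(x₁, t₁)` and up to the height `T`
    set ξ : ℝ := ζ / (μ * T ^ 2 + ‖x₁‖ ^ 2 + 1)
    have hξ : 0 < ξ := by positivity
    have hξe : ξ * (μ * T ^ 2 + ‖x₁‖ ^ 2 + 1) = ζ := div_mul_cancel₀ _ (by positivity)
    have hξ1 : ξ * (μ * T ^ 2) ≤ ζ := by nlinarith [mul_nonneg hξ.le (sq_nonneg ‖x₁‖)]
    have hξ2 : ξ * ‖x₁‖ ^ 2 ≤ ζ := by
      nlinarith [mul_nonneg hξ.le (mul_nonneg hμ.le (sq_nonneg T))]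
    -- the radius beyond which the quadratic barrier beats the growth of `W`
    obtain ⟨R, hR1, hR2⟩ : ∃ R : ℝ, ‖x₁‖ < R ∧ C * (1 + T ^ s) + ξ * (μ * T ^ 2) ≤ ξ * R ^ 2 := by
      have h1 : Tendsto (fun R : ℝ => ξ * R ^ 2) atTop atTop :=
        (tendsto_pow_atTop two_ne_zero).const_mul_atTop hξ
      obtain ⟨R, h2, h3⟩ := ((h1.eventually_ge_atTop (C * (1 + T ^ s) + ξ * (μ * T ^ 2))).and
        (eventually_gt_atTop ‖x₁‖)).exists
      exact ⟨R, h3, h2⟩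
    obtain ⟨t₀, ht₀, ht₀'⟩ := ((hbdry R ζ hζ).and (Ioo_mem_nhdsGT ht₁)).exists
    set Φ : Eucl N → ℝ → ℝ := fun x t => W x t - ζ - ζ * t ^ (2 * s) - ξ * (‖x‖ ^ 2 - μ * t ^ 2)
      with hΦ
    set K : Set (Eucl N × ℝ) := Metric.closedBall 0 R ×ˢ Icc t₀ T
    have hK : IsCompact K := (isCompact_closedBall _ _).prod isCompact_Icc
    have hΦc : ContinuousOn (fun p : Eucl N × ℝ => Φ p.1 p.2) K := by
      have hp : ∀ p ∈ K, 0 < p.2 := fun p hp => ht₀'.1.trans_le hp.2.1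
      have h1 : ContinuousOn (fun p : Eucl N × ℝ => W p.1 p.2) K := hcont.mono hp
      have h2 : Continuous fun p : Eucl N × ℝ => p.2 ^ (2 * s) :=
        continuous_snd.rpow_const fun _ => Or.inr (by positivity)
      exact (((h1.sub continuousOn_const).sub (continuous_const.mul h2).continuousOn).sub (by fun_prop))
    have hx1K : (x₁, t₁) ∈ K := ⟨by simpa using hR1.le, ht₀'.2.le, hTt.le⟩
    obtain ⟨⟨x, t⟩, ⟨hxR, htI⟩, hmax⟩ := hK.exists_isMaxOn ⟨_, hx1K⟩ hΦc
    have ht0 : 0 < t := ht₀'.1.trans_le htI.1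
    have htT : t ^ 2 ≤ T ^ 2 := pow_le_pow_left₀ ht0.le htI.2 2
    have hξt : ξ * (μ * t ^ 2) ≤ ξ * (μ * T ^ 2) := by gcongr
    have hrp : 0 ≤ t ^ (2 * s) := Real.rpow_nonneg ht0.le _
    -- a value above `ζ` forces an interior maximum, where the weighted Laplacian would be positive
    have hsmall : Φ x t ≤ ζ := by
      by_contra hbig
      push Not at hbig
      have hW : W x t = Φ x t + ζ + ζ * t ^ (2 * s) + ξ * ‖x‖ ^ 2 - ξ * (μ * t ^ 2) := by
        simp only [hΦ]; ring
      have hξx : 0 ≤ ξ * ‖x‖ ^ 2 := by positivity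
      have hζt : 0 ≤ ζ * t ^ (2 * s) := by positivity
      -- on each part of the boundary of the cylinder the perturbed function is small
      have c1 : t ≠ t₀ := by
        rintro rfl
        have := ht₀ x hxR
        linarith
      have c2 : t ≠ T := by
        rintro rfl
        have := hgrowth x t ht0
        linarith
      have c3 : ‖x‖ ≠ R := by
        intro hxn
        have h1 := hgrowth x t ht0
        have h2 : C * (1 + t ^ s) ≤ C * (1 + T ^ s) := by
          have := htI.2
          gcongr
        rw [hxn] at hW
        linarith
      have hxR' : ‖x‖ < R := lt_of_le_of_ne (by simpa using hxR) c3
      have hnb : K ∈ 𝓝 (x, t) := by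
        refine prod_mem_nhds (Metric.closedBall_mem_nhds_of_mem (by simpa using hxR')) ?_
        exact Icc_mem_nhds (lt_of_le_of_ne htI.1 (Ne.symm c1)) (lt_of_le_of_ne htI.2 c2)
      have hop := (((heq x t ht0).sub (HasWeightedLaplacianAt.const ζ x t)).sub
        ((HasWeightedLaplacianAt.rpow_height s x ht0).const_mul ζ)).sub
        ((HasWeightedLaplacianAt.quadratic (a := 1 - 2 * s) μ x ht0).const_mul ξ)
      have := hop.nonpos_of_isLocalMax (by filter_upwards [hnb] with p hp using hmax hp)
      rw [hμN] at this
      nlinarith [mul_pos hξ h1s]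
    have h1 := hmax hx1K
    simp only [mem_ofPred_eq, hΦ] at h1 hsmall
    have hξμ : 0 ≤ ξ * (μ * t₁ ^ 2) := by positivity
    linarith
  refine le_of_forall_pos_lt_add fun ε hε => ?_
  have h3 : 0 < 3 + t₁ ^ (2 * s) := by positivity
  have := key (ε / 2 / (3 + t₁ ^ (2 * s))) (by positivity)
  rw [div_mul_cancel₀ _ h3.ne'] at this
  linarith

/-! ### Horizontal averages of the extension -/

/-- Twofold differentiation under the integral sign. -/
lemma HasSecondDerivAt.integral {Y : Type*} [MeasurableSpace Y] {μ : Measure Y}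
    {F F₁ F₂ : ℝ → Y → ℝ} {τ₀ r : ℝ} (hr : 0 < r) {B₁ B₂ : Y → ℝ}
    (hF : ∀ τ ∈ Metric.ball τ₀ r, Integrable (F τ) μ)
    (hF₁ : ∀ τ ∈ Metric.ball τ₀ r, AEStronglyMeasurable (F₁ τ) μ)
    (hF₂ : AEStronglyMeasurable (F₂ τ₀) μ)
    (hd₁ : ∀ y, ∀ τ ∈ Metric.ball τ₀ r, HasDerivAt (fun τ => F τ y) (F₁ τ y) τ)
    (hd₂ : ∀ y, ∀ τ ∈ Metric.ball τ₀ r, HasDerivAt (fun τ => F₁ τ y) (F₂ τ y) τ)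
    (hb₁ : ∀ y, ∀ τ ∈ Metric.ball τ₀ r, ‖F₁ τ y‖ ≤ B₁ y) (hB₁ : Integrable B₁ μ)
    (hb₂ : ∀ y, ∀ τ ∈ Metric.ball τ₀ r, ‖F₂ τ y‖ ≤ B₂ y) (hB₂ : Integrable B₂ μ) :
    HasSecondDerivAt (fun τ => ∫ y, F τ y ∂μ) (∫ y, F₁ τ₀ y ∂μ) (∫ y, F₂ τ₀ y ∂μ) τ₀ := by
  have hball : ∀ τ ∈ Metric.ball τ₀ r, Metric.ball τ₀ r ∈ 𝓝 τ := fun τ hτ =>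
    Metric.isOpen_ball.mem_nhds hτ
  have h0 : τ₀ ∈ Metric.ball τ₀ r := Metric.mem_ball_self hr
  refine ⟨fun τ => ∫ y, F₁ τ y ∂μ, ?_, rfl, ?_⟩
  · filter_upwards [Metric.ball_mem_nhds τ₀ hr] with τ hτ
    refine (hasDerivAt_integral_of_dominated_loc_of_deriv_le (hball τ hτ) ?_ (hF τ hτ) (hF₁ τ hτ)
      (Eventually.of_forall fun y => hb₁ y) hB₁ (Eventually.of_forall fun y => hd₁ y)).2
    filter_upwards [hball τ hτ] with σ hσ using (hF σ hσ).aestronglyMeasurable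
  · refine (hasDerivAt_integral_of_dominated_loc_of_deriv_le (hball τ₀ h0) ?_
      (Integrable.mono' hB₁ (hF₁ τ₀ h0) (Eventually.of_forall fun y => hb₁ y τ₀ h0)) hF₂
      (Eventually.of_forall fun y => hb₂ y) hB₂ (Eventually.of_forall fun y => hd₂ y)).2
    filter_upwards [hball τ₀ h0] with σ hσ using hF₁ σ hσ

section Line

variable {E : Type*} [NormedAddCommGroup E] [NormedSpace ℝ E] {f : E → ℝ} {O : Set E}

lemma hasDerivAt_line (hO : IsOpen O) (hf : ContDiffOn ℝ ∞ f O) {q w : E} {τ : ℝ}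
    (hq : q + τ • w ∈ O) :
    HasDerivAt (fun τ : ℝ => f (q + τ • w)) (fderiv ℝ f (q + τ • w) w) τ := by
  have h1 : HasFDerivAt f (fderiv ℝ f (q + τ • w)) (q + τ • w) :=
    ((hf.contDiffAt (hO.mem_nhds hq)).differentiableAt (by simp)).hasFDerivAt
  have h2 : HasDerivAt (fun τ : ℝ => q + τ • w) w τ := by
    simpa using ((hasDerivAt_id τ).smul_const w).const_add q
  exact h1.comp_hasDerivAt τ h2

lemma hasDerivAt_fderiv_line (hO : IsOpen O) (hf : ContDiffOn ℝ ∞ f O) {q w : E} {τ : ℝ}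
    (hq : q + τ • w ∈ O) :
    HasDerivAt (fun τ : ℝ => fderiv ℝ f (q + τ • w) w)
      (fderiv ℝ (fderiv ℝ f) (q + τ • w) w w) τ := by
  have h0 : ContDiffOn ℝ ∞ (fderiv ℝ f) O := hf.fderiv_of_isOpen hO (by simp)
  have h1 : HasFDerivAt (fderiv ℝ f) (fderiv ℝ (fderiv ℝ f) (q + τ • w)) (q + τ • w) :=
    ((h0.contDiffAt (hO.mem_nhds hq)).differentiableAt (by simp)).hasFDerivAt
  have h2 : HasDerivAt (fun τ : ℝ => q + τ • w) w τ := by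
    simpa using ((hasDerivAt_id τ).smul_const w).const_add q
  have h3 := h1.comp_hasDerivAt τ h2
  exact (h3.clm_apply (hasDerivAt_const τ w)).congr_deriv (by simp)

lemma hasSecondDerivAt_line (hO : IsOpen O) (hf : ContDiffOn ℝ ∞ f O) {q w : E} {τ₀ : ℝ}
    (hq : q + τ₀ • w ∈ O) :
    HasSecondDerivAt (fun τ : ℝ => f (q + τ • w)) (fderiv ℝ f (q + τ₀ • w) w)
      (fderiv ℝ (fderiv ℝ f) (q + τ₀ • w) w w) τ₀ := by
  refine ⟨fun τ => fderiv ℝ f (q + τ • w) w, ?_, rfl, hasDerivAt_fderiv_line hO hf hq⟩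
  have hc : Continuous fun τ : ℝ => q + τ • w := by fun_prop
  filter_upwards [(hO.preimage hc).mem_nhds hq] with τ hτ using hasDerivAt_line hO hf hτ

end Line

/-- The open upper half-space. -/
def upperHalf (N : ℕ) : Set (Eucl N × ℝ) := {p | 0 < p.2}

lemma isOpen_upperHalf (N : ℕ) : IsOpen (upperHalf N) := isOpen_lt continuous_const continuous_snd

lemma continuousOn_fderiv_apply {N : ℕ} {f : Eucl N × ℝ → ℝ} (hf : ContDiffOn ℝ ∞ f (upperHalf N))
    (w : Eucl N × ℝ) : ContinuousOn (fun p => fderiv ℝ f p w) (upperHalf N) :=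
  (hf.fderiv_of_isOpen (isOpen_upperHalf N) (m := ∞) (by simp)).continuousOn.clm_apply
    continuousOn_const

lemma continuousOn_fderiv_fderiv_apply {N : ℕ} {f : Eucl N × ℝ → ℝ}
    (hf : ContDiffOn ℝ ∞ f (upperHalf N)) (w : Eucl N × ℝ) :
    ContinuousOn (fun p => fderiv ℝ (fderiv ℝ f) p w w) (upperHalf N) :=
  (((hf.fderiv_of_isOpen (isOpen_upperHalf N) (m := ∞) (by simp)).fderiv_of_isOpen
    (isOpen_upperHalf N) (m := ∞) (by simp)).continuousOn.clm_apply
    continuousOn_const).clm_apply continuousOn_const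

lemma integrable_mollifier_mul_comp {N : ℕ} {φ : Eucl N → ℝ} {η : ℝ} (hφ : IsMollifier φ η)
    {g : Eucl N × ℝ → ℝ} (hg : ContinuousOn g (upperHalf N)) {q : Eucl N × ℝ} (hq : 0 < q.2) :
    Integrable fun z => φ z * g (q + (z, 0)) := by
  refine integrable_mul_of_compact hφ.continuous hφ.hasCompactSupport ?_
  refine hg.comp_continuous (by fun_prop) fun z => ?_
  simpa [upperHalf] using hq

/-- Averaging in the horizontal variables commutes with differentiation along lines. -/
lemma hasSecondDerivAt_mollify {N : ℕ} {φ : Eucl N → ℝ} {η : ℝ} (hφ : IsMollifier φ η)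
    {f : Eucl N × ℝ → ℝ} (hf : ContDiffOn ℝ ∞ f (upperHalf N)) {q w : Eucl N × ℝ} {τ₀ : ℝ}
    (hq : 0 < (q + τ₀ • w).2) :
    HasSecondDerivAt (fun τ => ∫ z, φ z * f (q + τ • w + (z, 0)))
      (∫ z, φ z * fderiv ℝ f (q + τ₀ • w + (z, 0)) w)
      (∫ z, φ z * fderiv ℝ (fderiv ℝ f) (q + τ₀ • w + (z, 0)) w w) τ₀ := by
  have hc : Continuous fun τ : ℝ => (q + τ • w).2 := by fun_prop
  obtain ⟨r, hr, hball⟩ := Metric.nhds_basis_closedBall.mem_iff.1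
    ((isOpen_lt continuous_const hc).mem_nhds hq)
  have hball' : ∀ τ ∈ Metric.ball τ₀ r, 0 < (q + τ • w).2 := fun τ hτ =>
    hball (Metric.ball_subset_closedBall hτ)
  set S : Set (Eucl N × ℝ) := (fun p : ℝ × Eucl N => q + p.1 • w + (p.2, 0)) ''
    (Metric.closedBall τ₀ r ×ˢ Metric.closedBall 0 η)
  have hS : IsCompact S :=
    ((isCompact_closedBall _ _).prod (isCompact_closedBall _ _)).image (by fun_prop)
  have hSH : S ⊆ upperHalf N := by
    rintro _ ⟨⟨τ, z⟩, ⟨hτ, _⟩, rfl⟩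
    have := hball hτ
    simpa [upperHalf] using this
  obtain ⟨M₁, hM₁⟩ := hS.exists_bound_of_continuousOn ((continuousOn_fderiv_apply hf w).mono hSH)
  obtain ⟨M₂, hM₂⟩ := hS.exists_bound_of_continuousOn
    ((continuousOn_fderiv_fderiv_apply hf w).mono hSH)
  have hφi := hφ.continuous.integrable_of_hasCompactSupport hφ.hasCompactSupport (μ := volume)
  have hmem : ∀ τ ∈ Metric.ball τ₀ r, ∀ z : Eucl N, q + (z, 0) + τ • w ∈ upperHalf N := by
    intro τ hτ z
    have := hball' τ hτ
    simpa [upperHalf] using this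
  have hbound : ∀ (g : Eucl N × ℝ → ℝ) (M : ℝ), (∀ p ∈ S, ‖g p‖ ≤ M) →
      ∀ z, ∀ τ ∈ Metric.ball τ₀ r, ‖φ z * g (q + τ • w + (z, 0))‖ ≤ φ z * M := by
    intro g M hM z τ hτ
    rw [norm_mul, Real.norm_of_nonneg (hφ.nonneg z)]
    rcases le_or_gt ‖z‖ η with hz | hz
    · exact mul_le_mul_of_nonneg_left (hM _ ⟨(τ, z), ⟨Metric.ball_subset_closedBall hτ,
        by simpa using hz⟩, rfl⟩) (hφ.nonneg z)
    · simp [hφ.eq_zero hz]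
  refine HasSecondDerivAt.integral hr (F₁ := fun τ z => φ z * fderiv ℝ f (q + τ • w + (z, 0)) w)
    (F₂ := fun τ z => φ z * fderiv ℝ (fderiv ℝ f) (q + τ • w + (z, 0)) w w)
    (B₁ := fun z => φ z * M₁) (B₂ := fun z => φ z * M₂)
    (fun τ hτ => integrable_mollifier_mul_comp hφ hf.continuousOn (hball' τ hτ))
    (fun τ hτ => (integrable_mollifier_mul_comp hφ (continuousOn_fderiv_apply hf w)
      (hball' τ hτ)).aestronglyMeasurable)
    (integrable_mollifier_mul_comp hφ (continuousOn_fderiv_fderiv_apply hf w)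
      hq).aestronglyMeasurable ?_ ?_
    (hbound _ M₁ hM₁) (hφi.mul_const _) (hbound _ M₂ hM₂) (hφi.mul_const _)
  · intro z τ hτ
    have := (hasDerivAt_line (isOpen_upperHalf N) hf (hmem τ hτ z)).const_mul (φ z)
    simpa only [add_right_comm] using this
  · intro z τ hτ
    have := (hasDerivAt_fderiv_line (isOpen_upperHalf N) hf (hmem τ hτ z)).const_mul (φ z)
    simpa only [add_right_comm] using this

/-- The extension equation in terms of second directional derivatives. -/
lemma IsCaffarelliSilvestreExtension.sum_fderiv_eq_zero {N : ℕ} {s : ℝ} {u : Eucl N → ℝ}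
    {U : Eucl N → ℝ → ℝ} (hU : IsCaffarelliSilvestreExtension s u U) (x : Eucl N) {t : ℝ}
    (ht : 0 < t) :
    ∑ i : Fin N, fderiv ℝ (fderiv ℝ fun p : Eucl N × ℝ => U p.1 p.2) (x, t)
        (EuclideanSpace.single i 1, 0) (EuclideanSpace.single i 1, 0)
      + fderiv ℝ (fderiv ℝ fun p : Eucl N × ℝ => U p.1 p.2) (x, t) (0, 1) (0, 1)
      + (1 - 2 * s) / t * fderiv ℝ (fun p : Eucl N × ℝ => U p.1 p.2) (x, t) (0, 1) = 0 := by
  set f : Eucl N × ℝ → ℝ := fun p => U p.1 p.2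
  have hf : ContDiffOn ℝ ∞ f (upperHalf N) := hU.smooth
  have hg : ContDiff ℝ ∞ fun z => U z t := by
    have h1 : ContDiffOn ℝ ∞ (f ∘ fun z : Eucl N => (z, t)) univ :=
      hf.comp (contDiff_id.prodMk contDiff_const).contDiffOn fun z _ => ht
    exact contDiffOn_univ.1 h1
  have hlap : Laplacian.laplacian (fun z => U z t) x
      = ∑ i : Fin N, fderiv ℝ (fderiv ℝ f) (x, t)
        (EuclideanSpace.single i 1, 0) (EuclideanSpace.single i 1, 0) := by
    rw [InnerProductSpace.laplacian_eq_iteratedFDeriv_orthonormalBasis _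
      (EuclideanSpace.basisFun (Fin N) ℝ)]
    refine Finset.sum_congr rfl fun i _ => ?_
    rw [iteratedFDeriv_two_apply]
    have h1 := hasSecondDerivAt_line isOpen_univ hg.contDiffOn (q := x)
      (w := EuclideanSpace.single i (1 : ℝ)) (τ₀ := 0) (mem_univ _)
    have h2 := hasSecondDerivAt_line (isOpen_upperHalf N) hf (q := (x, t))
      (w := (EuclideanSpace.single i (1 : ℝ), 0)) (τ₀ := 0) (by simpa [upperHalf] using ht)
    have h3 := (h1.unique (h2.congr (Eventually.of_forall fun τ => by simp [f]))).2
    simpa using h3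
  have ht2 : HasSecondDerivAt (U x) (fderiv ℝ f (x, t) (0, 1))
      (fderiv ℝ (fderiv ℝ f) (x, t) (0, 1) (0, 1)) t := by
    have h2 := hasSecondDerivAt_line (isOpen_upperHalf N) hf (q := (x, 0))
      (w := ((0 : Eucl N), (1 : ℝ))) (τ₀ := t) (by simpa [upperHalf] using ht)
    simpa [f] using h2
  have heq := hU.equation x t ht
  have hd : HasDerivAt (fun τ : ℝ => τ ^ (1 - 2 * s) * deriv (fun σ : ℝ => U x σ) τ)
      ((1 - 2 * s) * t ^ (1 - 2 * s - 1) * fderiv ℝ f (x, t) (0, 1)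
        + t ^ (1 - 2 * s) * fderiv ℝ (fderiv ℝ f) (x, t) (0, 1) (0, 1)) t := by
    have := (Real.hasDerivAt_rpow_const (p := 1 - 2 * s) (Or.inl ht.ne')).mul ht2.hasDerivAt_deriv
    rwa [ht2.hasDerivAt.deriv] at this
  rw [hd.deriv, hlap] at heq
  have e1 : t ^ (1 - 2 * s) = t ^ (1 - 2 * s - 1) * t := by
    rw [← Real.rpow_add_one ht.ne']; ring_nf
  have hp : 0 < t ^ (1 - 2 * s - 1) := Real.rpow_pos_of_pos ht _
  rw [e1] at heq
  have h5 : t ^ (1 - 2 * s - 1) * t * (∑ i : Fin N, fderiv ℝ (fderiv ℝ f) (x, t)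
        (EuclideanSpace.single i 1, 0) (EuclideanSpace.single i 1, 0)
      + fderiv ℝ (fderiv ℝ f) (x, t) (0, 1) (0, 1)
      + (1 - 2 * s) / t * fderiv ℝ f (x, t) (0, 1)) = 0 := by
    refine Eq.trans ?_ heq
    field_simp
    ring
  exact (mul_eq_zero.1 h5).resolve_left (mul_pos hp ht).ne'

/-- Averages of the extension in the horizontal variables solve the same equation. -/
lemma IsCaffarelliSilvestreExtension.hasWeightedLaplacianAt_mollify {N : ℕ} {s : ℝ}
    {u : Eucl N → ℝ} {U : Eucl N → ℝ → ℝ} (hU : IsCaffarelliSilvestreExtension s u U)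
    {φ : Eucl N → ℝ} {η : ℝ} (hφ : IsMollifier φ η) (x : Eucl N) {t : ℝ} (ht : 0 < t) :
    HasWeightedLaplacianAt (1 - 2 * s) (fun x t => mollify φ (fun y => U y t) x) x t 0 := by
  set f : Eucl N × ℝ → ℝ := fun p => U p.1 p.2
  have hf : ContDiffOn ℝ ∞ f (upperHalf N) := hU.smooth
  have hxt : 0 < ((x, t) : Eucl N × ℝ).2 := ht
  refine ⟨fun i => ∫ z, φ z * fderiv ℝ f ((x, t) + (z, 0)) (EuclideanSpace.single i 1, 0),
    fun i => ∫ z, φ z * fderiv ℝ (fderiv ℝ f) ((x, t) + (z, 0))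
      (EuclideanSpace.single i 1, 0) (EuclideanSpace.single i 1, 0),
    ∫ z, φ z * fderiv ℝ f ((x, t) + (z, 0)) (0, 1),
    ∫ z, φ z * fderiv ℝ (fderiv ℝ f) ((x, t) + (z, 0)) (0, 1) (0, 1), fun i => ?_, ?_, ?_⟩
  · have h := hasSecondDerivAt_mollify hφ hf (q := (x, t))
      (w := (EuclideanSpace.single i (1 : ℝ), 0)) (τ₀ := 0) (by simpa using ht)
    rw [zero_smul, add_zero] at h
    refine h.congr (Eventually.of_forall fun τ => ?_)
    simp [mollify, f]
  · have h := hasSecondDerivAt_mollify hφ hf (q := (x, 0))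
      (w := ((0 : Eucl N), (1 : ℝ))) (τ₀ := t) (by simpa using ht)
    have e : ((x, 0) : Eucl N × ℝ) + t • ((0 : Eucl N), (1 : ℝ)) = (x, t) := by simp
    rw [e] at h
    refine h.congr (Eventually.of_forall fun τ => ?_)
    simp [mollify, f]
  · have i1 : ∀ i : Fin N, Integrable fun z => φ z * fderiv ℝ (fderiv ℝ f) ((x, t) + (z, 0))
        (EuclideanSpace.single i 1, 0) (EuclideanSpace.single i 1, 0) := fun i =>
      integrable_mollifier_mul_comp hφ (continuousOn_fderiv_fderiv_apply hf _) hxt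
    have i2 := integrable_mollifier_mul_comp hφ
      (continuousOn_fderiv_fderiv_apply hf ((0 : Eucl N), (1 : ℝ))) hxt
    have i3 := (integrable_mollifier_mul_comp hφ
      (continuousOn_fderiv_apply hf ((0 : Eucl N), (1 : ℝ))) hxt).const_mul ((1 - 2 * s) / t)
    have i12 := (integrable_finsetSum Finset.univ fun i _ => i1 i).add i2
    have h3 := integral_add i12 i3
    have h2 := integral_add (integrable_finsetSum Finset.univ fun i _ => i1 i) i2
    have h1 := integral_finsetSum Finset.univ fun i _ => i1 i
    simp only [Pi.add_apply] at h3
    rw [← integral_const_mul, ← h1]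
    refine Eq.trans ?_ (h3.trans (congrArg (· + _) h2))
    symm
    refine integral_eq_zero_of_ae (Eventually.of_forall fun z => ?_)
    have h4 := hU.sum_fderiv_eq_zero (x + z) ht
    have e : ((x, t) : Eucl N × ℝ) + (z, 0) = (x + z, t) := by simp
    simp only [e, Pi.zero_apply]
    rw [← Finset.mul_sum]
    linear_combination φ z * h4

/-! ### Attainment of the boundary values -/

/-- The part of the weighted Dirichlet energy carried by the vertical line over `x`. -/
noncomputable def lineEnergy {N : ℕ} (s : ℝ) (U : Eucl N → ℝ → ℝ) (x : Eucl N) : ℝ≥0∞ :=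
  ∫⁻ t in Ioi (0 : ℝ), ENNReal.ofReal (t ^ (1 - 2 * s) *
        (‖gradient (fun z => U z t) x‖ ^ 2 + deriv (fun σ : ℝ => U x σ) t ^ 2))

lemma IsCaffarelliSilvestreExtension.continuousOn_deriv {N : ℕ} {s : ℝ} {u : Eucl N → ℝ}
    {U : Eucl N → ℝ → ℝ} (hU : IsCaffarelliSilvestreExtension s u U) (x : Eucl N) :
    (∀ t, 0 < t → HasDerivAt (U x) (deriv (U x) t) t) ∧ ContinuousOn (deriv (U x)) (Ioi 0) := by
  have h1 : ContDiffOn ℝ ∞ (U x) (Ioi 0) := by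
    have : ContDiffOn ℝ ∞ ((fun p : Eucl N × ℝ => U p.1 p.2) ∘ fun t : ℝ => (x, t)) (Ioi 0) :=
      hU.smooth.comp (contDiff_const.prodMk contDiff_id).contDiffOn fun t ht => ht
    exact this
  exact ⟨fun t ht => ((h1.contDiffAt (Ioi_mem_nhds ht)).differentiableAt (by simp)).hasDerivAt,
    h1.continuousOn_deriv_of_isOpen isOpen_Ioi (by simp)⟩

/-- Cauchy–Schwarz from the weighted inequality between arithmetic and geometric means. -/
lemma sq_le_mul_of_forall {d A E : ℝ} (hA : 0 < A) (hE : 0 ≤ E)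
    (h : ∀ c : ℝ, 0 < c → 2 * |d| ≤ c * A + E / c) : d ^ 2 ≤ A * E := by
  rcases eq_or_ne d 0 with rfl | hd
  · simp; positivity
  · have hd' : 0 < |d| := abs_pos.2 hd
    have h1 := h (|d| / A) (by positivity)
    rw [div_mul_cancel₀ _ hA.ne', div_div_eq_mul_div] at h1
    have h2 : |d| ≤ E * A / |d| := by linarith
    rw [le_div_iff₀ hd'] at h2
    rw [← sq_abs]; nlinarith

/-- Vertical increments are controlled by the energy of the line, by Cauchy–Schwarz with the
weights `τ ^ (2s - 1)` and `τ ^ (1 - 2s)`. -/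
lemma IsCaffarelliSilvestreExtension.sq_sub_le {N : ℕ} {s : ℝ} (hs0 : 0 < s) {u : Eucl N → ℝ}
    {U : Eucl N → ℝ → ℝ} (hU : IsCaffarelliSilvestreExtension s u U) (x : Eucl N) {t₀ t : ℝ}
    (ht₀ : 0 < t₀) (ht : t₀ ≤ t) :
    ENNReal.ofReal ((U x t - U x t₀) ^ 2)
      ≤ ENNReal.ofReal (t ^ (2 * s) / (2 * s)) * lineEnergy s U x := by
  have htpos : 0 < t := ht₀.trans_le ht
  have hA : 0 < t ^ (2 * s) / (2 * s) := by positivity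
  rcases eq_or_ne (lineEnergy s U x) ⊤ with hE | hE
  · rw [hE, ENNReal.mul_top (by simpa using hA)]
    exact le_top
  obtain ⟨hd, hdc⟩ := hU.continuousOn_deriv x
  have hsub : Icc t₀ t ⊆ Ioi 0 := fun τ hτ => ht₀.trans_le hτ.1
  have hdc' : ContinuousOn (deriv (U x)) (Icc t₀ t) := hdc.mono hsub
  set g : ℝ → ℝ := fun τ => τ ^ (1 - 2 * s) * deriv (U x) τ ^ 2
  have hpow : ∀ a : ℝ, ContinuousOn (fun τ : ℝ => τ ^ a) (Icc t₀ t) := fun a =>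
    continuousOn_id.rpow_const fun τ hτ => Or.inl (hsub hτ).ne'
  have hgc : ContinuousOn g (Icc t₀ t) := (hpow _).mul (hdc'.pow 2)
  have hgi : IntegrableOn g (Icc t₀ t) := hgc.integrableOn_Icc
  have hgE : ∫ τ in Icc t₀ t, g τ ≤ (lineEnergy s U x).toReal := by
    rw [integral_eq_lintegral_of_nonneg_ae _ hgi.aestronglyMeasurable]
    · refine ENNReal.toReal_mono hE ((lintegral_mono_set hsub).trans ?_)
      refine setLIntegral_mono' measurableSet_Ioi fun τ hτ => ENNReal.ofReal_le_ofReal ?_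
      have hτ0 : 0 ≤ τ ^ (1 - 2 * s) := Real.rpow_nonneg (le_of_lt hτ) _
      refine mul_le_mul_of_nonneg_left ?_ hτ0
      exact le_add_of_nonneg_left (sq_nonneg _)
    · filter_upwards [ae_restrict_mem measurableSet_Icc] with τ hτ
      have := hsub hτ
      exact mul_nonneg (Real.rpow_nonneg (le_of_lt this) _) (sq_nonneg _)
  have hftc : U x t - U x t₀ = ∫ τ in Icc t₀ t, deriv (U x) τ := by
    rw [integral_Icc_eq_integral_Ioc, ← intervalIntegral.integral_of_le ht,
      intervalIntegral.integral_eq_sub_of_hasDerivAt]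
    · intro τ hτ
      rw [uIcc_of_le ht] at hτ
      exact hd τ (hsub hτ)
    · exact hdc'.intervalIntegrable_of_Icc ht
  have hreal : (U x t - U x t₀) ^ 2 ≤ t ^ (2 * s) / (2 * s) * (lineEnergy s U x).toReal := by
    refine sq_le_mul_of_forall hA ENNReal.toReal_nonneg fun c hc => ?_
    have hpi : IntegrableOn (fun τ : ℝ => τ ^ (2 * s - 1)) (Icc t₀ t) := (hpow _).integrableOn_Icc
    have h1 : 2 * |U x t - U x t₀| ≤ ∫ τ in Icc t₀ t, (c * τ ^ (2 * s - 1) + c⁻¹ * g τ) := by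
      rw [hftc, ← Real.norm_eq_abs]
      have := norm_integral_le_of_norm_le (f := fun τ => deriv (U x) τ)
        (((hpi.const_mul c).add (hgi.const_mul c⁻¹)).div_const 2) (by
          filter_upwards [ae_restrict_mem measurableSet_Icc] with τ hτ
          have hτ0 : 0 < τ := hsub hτ
          have hp : 0 < τ ^ (2 * s - 1) := Real.rpow_pos_of_pos hτ0 _
          have e : τ ^ (1 - 2 * s) = (τ ^ (2 * s - 1))⁻¹ := by
            rw [← Real.rpow_neg hτ0.le]; ring_nf
          simp only [Pi.add_apply, g, e, Real.norm_eq_abs]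
          rw [le_div_iff₀ two_pos]
          set p := τ ^ (2 * s - 1)
          have h2 : 0 ≤ (c * p - |deriv (U x) τ|) ^ 2 := sq_nonneg _
          have h3 : c * p + c⁻¹ * (p⁻¹ * deriv (U x) τ ^ 2)
              = ((c * p) ^ 2 + |deriv (U x) τ| ^ 2) / (c * p) := by
            rw [sq_abs]; field_simp
          rw [h3, le_div_iff₀ (by positivity)]
          nlinarith)
      rw [integral_div] at this
      simp only [Pi.add_apply] at this
      linarith
    have h2 : ∫ τ in Icc t₀ t, τ ^ (2 * s - 1) ≤ t ^ (2 * s) / (2 * s) := by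
      rw [integral_Icc_eq_integral_Ioc]
      calc ∫ τ in Ioc t₀ t, τ ^ (2 * s - 1) ≤ ∫ τ in Ioc 0 t, τ ^ (2 * s - 1) := by
            refine setIntegral_mono_set (integrableOn_Ioc_rpow (by linarith) htpos.le) ?_
              (Ioc_subset_Ioc_left ht₀.le).eventuallyLE
            filter_upwards [ae_restrict_mem measurableSet_Ioc] with τ hτ
            exact Real.rpow_nonneg hτ.1.le _
        _ = _ := by rw [setIntegral_Ioc_rpow (by linarith) htpos.le]; ring_nf
    rw [integral_add (hpi.const_mul c) (hgi.const_mul c⁻¹), integral_const_mul,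
      integral_const_mul] at h1
    have h3 := mul_le_mul_of_nonneg_left h2 hc.le
    have h4 := mul_le_mul_of_nonneg_left hgE (inv_nonneg.2 hc.le)
    rw [div_eq_inv_mul (lineEnergy s U x).toReal c]
    linarith
  calc _ ≤ ENNReal.ofReal (t ^ (2 * s) / (2 * s) * (lineEnergy s U x).toReal) :=
        ENNReal.ofReal_le_ofReal hreal
    _ = _ := by rw [ENNReal.ofReal_mul hA.le, ENNReal.ofReal_toReal hE]

lemma IsCaffarelliSilvestreExtension.continuous_slice {N : ℕ} {s : ℝ} {u : Eucl N → ℝ}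
    {U : Eucl N → ℝ → ℝ} (hU : IsCaffarelliSilvestreExtension s u U) {t : ℝ} (ht : 0 < t) :
    Continuous fun x => U x t :=
  hU.smooth.continuousOn.comp_continuous (f := fun x : Eucl N => (x, t)) (by fun_prop)
    fun _ => ht

/-- In mean square the extension approaches its boundary values at the rate `t ^ s`. -/
lemma IsCaffarelliSilvestreExtension.setLIntegral_sq_sub_le {N : ℕ} {s : ℝ} (hs0 : 0 < s)
    {u : Eucl N → ℝ} (hu : Continuous u) {U : Eucl N → ℝ → ℝ}
    (hU : IsCaffarelliSilvestreExtension s u U) {K : Set (Eucl N)} (hK : IsCompact K) {t : ℝ}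
    (ht : 0 < t) :
    ∫⁻ x in K, ENNReal.ofReal ((U x t - u x) ^ 2)
      ≤ 2 * (ENNReal.ofReal (t ^ (2 * s) / (2 * s)) * ∫⁻ x, lineEnergy s U x) := by
  have hlim := (tendsto_const_nhds (x := 2 * (ENNReal.ofReal (t ^ (2 * s) / (2 * s)) *
    ∫⁻ x, lineEnergy s U x))).add
    (ENNReal.Tendsto.const_mul (a := 2) (hU.trace K hK) (Or.inr (by simp)))
  rw [mul_zero, add_zero] at hlim
  refine ge_of_tendsto hlim ?_
  filter_upwards [Ioo_mem_nhdsGT ht] with t₀ ht₀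
  have hc0 := hU.continuous_slice ht₀.1
  have hc := hU.continuous_slice ht
  calc ∫⁻ x in K, ENNReal.ofReal ((U x t - u x) ^ 2)
      ≤ ∫⁻ x in K, (2 * ENNReal.ofReal ((U x t - U x t₀) ^ 2)
        + 2 * ENNReal.ofReal ((U x t₀ - u x) ^ 2)) := by
        refine lintegral_mono fun x => ?_
        rw [show (2 : ℝ≥0∞) = ENNReal.ofReal 2 by simp, ← ENNReal.ofReal_mul zero_le_two,
          ← ENNReal.ofReal_mul zero_le_two, ← ENNReal.ofReal_add (by positivity) (by positivity)]
        refine ENNReal.ofReal_le_ofReal ?_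
        nlinarith [sq_nonneg ((U x t - U x t₀) - (U x t₀ - u x))]
    _ = 2 * (∫⁻ x in K, ENNReal.ofReal ((U x t - U x t₀) ^ 2))
        + 2 * ∫⁻ x in K, ENNReal.ofReal ((U x t₀ - u x) ^ 2) := by
        have m1 : Measurable fun x => ENNReal.ofReal ((U x t - U x t₀) ^ 2) := by
          have := hc.measurable; have := hc0.measurable; fun_prop
        have m2 : Measurable fun x => ENNReal.ofReal ((U x t₀ - u x) ^ 2) := by
          have := hu.measurable; have := hc0.measurable; fun_prop
        rw [lintegral_add_left (m1.const_mul 2), lintegral_const_mul _ m1,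
          lintegral_const_mul _ m2]
    _ ≤ _ := by
        gcongr
        calc _ ≤ ∫⁻ x in K, ENNReal.ofReal (t ^ (2 * s) / (2 * s)) * lineEnergy s U x :=
              lintegral_mono fun x => hU.sq_sub_le hs0 x ht₀.1 ht₀.2.le
          _ ≤ ∫⁻ x, ENNReal.ofReal (t ^ (2 * s) / (2 * s)) * lineEnergy s U x :=
              setLIntegral_le_lintegral _ _
          _ = _ := lintegral_const_mul' _ _ ENNReal.ofReal_ne_top

/-- Jensen's inequality for the mollifying kernel, with the geometric mean linearized. -/
lemma mollify_abs_le {N : ℕ} {φ w : Eucl N → ℝ} {η : ℝ} (hφ : IsMollifier φ η)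
    (hw : Continuous w) {c : ℝ} (hc : 0 < c) (x : Eucl N) :
    |mollify φ w x| ≤ (c + c⁻¹ * mollify φ (fun y => w y ^ 2) x) / 2 := by
  have hφi := hφ.continuous.integrable_of_hasCompactSupport hφ.hasCompactSupport (μ := volume)
  have hw2 := integrable_mollify hφ.continuous hφ.hasCompactSupport (hw.pow 2) x
  have hB := ((hφi.mul_const c).add (hw2.const_mul c⁻¹)).div_const 2
  have := norm_integral_le_of_norm_le (f := fun z => φ z * w (x + z)) hB
    (Eventually.of_forall fun z => by
      simp only [Pi.add_apply, Pi.pow_apply]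
      rw [norm_mul, Real.norm_of_nonneg (hφ.nonneg z), Real.norm_eq_abs, le_div_iff₀ two_pos]
      have h1 : 2 * |w (x + z)| ≤ c + c⁻¹ * w (x + z) ^ 2 := by
        have h3 : c + c⁻¹ * w (x + z) ^ 2 = (c ^ 2 + |w (x + z)| ^ 2) / c := by
          rw [sq_abs]; field_simp
        rw [h3, le_div_iff₀ hc]
        nlinarith [sq_nonneg (c - |w (x + z)|)]
      nlinarith [mul_le_mul_of_nonneg_left h1 (hφ.nonneg z)])
  rw [integral_div] at this
  refine this.trans (le_of_eq ?_)
  congr 1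
  refine (integral_add (hφi.mul_const c) (hw2.const_mul c⁻¹)).trans ?_
  rw [integral_mul_const, hφ.integral_eq, one_mul, integral_const_mul]
  rfl

lemma mollify_sq_le {N : ℕ} {φ w : Eucl N → ℝ} {η M : ℝ} (hφ : IsMollifier φ η)
    (hM : ∀ z, φ z ≤ M) (hw : Continuous w) (x : Eucl N) :
    mollify φ (fun y => w y ^ 2) x ≤ M * ∫ y in Metric.closedBall x η, w y ^ 2 := by
  rw [mollify_eq, ← integral_const_mul, ← integral_indicator measurableSet_closedBall]
  refine integral_mono (integrable_mul_of_compact (by have := hφ.continuous; fun_prop)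
    (hasCompactSupport_comp_sub hφ.hasCompactSupport x) (by fun_prop)) ?_ fun y => ?_
  · refine IntegrableOn.integrable_indicator ?_ measurableSet_closedBall
    exact (Continuous.continuousOn (by fun_prop)).integrableOn_compact (isCompact_closedBall _ _)
  · by_cases hy : y ∈ Metric.closedBall x η
    · rw [indicator_of_mem hy]
      exact mul_le_mul_of_nonneg_right (hM _) (sq_nonneg _)
    · rw [indicator_of_notMem hy]
      rw [Metric.mem_closedBall, dist_eq_norm, not_le] at hy
      simp [hφ.eq_zero hy]

lemma IsMollifier.exists_le {N : ℕ} {φ : Eucl N → ℝ} {η : ℝ} (hφ : IsMollifier φ η) :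
    ∃ M : ℝ, 0 ≤ M ∧ ∀ z, φ z ≤ M := by
  obtain ⟨M, hM⟩ := hφ.continuous.bounded_above_of_compact_support hφ.hasCompactSupport
  exact ⟨M, (norm_nonneg _).trans (hM 0), fun z => (le_abs_self _).trans (hM z)⟩

lemma exists_abs_mollify_le {N : ℕ} {φ u : Eucl N → ℝ} {η : ℝ} (hφ : IsMollifier φ η)
    (hu : Continuous u) (hu2 : MemLp u 2 volume) : ∃ C : ℝ, 0 ≤ C ∧ ∀ x, |mollify φ u x| ≤ C := by
  obtain ⟨M, hM0, hM⟩ := hφ.exists_le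
  have hi := (memLp_two_iff_integrable_sq hu.aestronglyMeasurable).1 hu2
  have hI : 0 ≤ ∫ y, u y ^ 2 := integral_nonneg fun y => sq_nonneg _
  refine ⟨(1 + M * ∫ y, u y ^ 2) / 2, by positivity, fun x => ?_⟩
  have h1 := mollify_abs_le hφ hu one_pos x
  have h2 := mollify_sq_le hφ hM hu x
  have h3 : ∫ y in Metric.closedBall x η, u y ^ 2 ≤ ∫ y, u y ^ 2 :=
    setIntegral_le_integral hi (Eventually.of_forall fun y => sq_nonneg _)
  have h4 := mul_le_mul_of_nonneg_left h3 hM0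
  rw [inv_one, one_mul] at h1
  linarith

/-- After averaging, the boundary values are attained uniformly, at the rate `t ^ s`. -/
lemma IsCaffarelliSilvestreExtension.exists_abs_mollify_sub_le {N : ℕ} {s : ℝ} (hs0 : 0 < s)
    {u : Eucl N → ℝ} (hu : Continuous u) {U : Eucl N → ℝ → ℝ}
    (hU : IsCaffarelliSilvestreExtension s u U) {φ : Eucl N → ℝ} {η : ℝ} (hφ : IsMollifier φ η) :
    ∃ C : ℝ, 0 ≤ C ∧ ∀ x t, 0 < t →
      |mollify φ (fun y => U y t) x - mollify φ u x| ≤ C * t ^ s := by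
  obtain ⟨M, hM0, hM⟩ := hφ.exists_le
  set A := ∫⁻ x, lineEnergy s U x
  have hA : A ≠ ⊤ := hU.finite_energy.ne
  have hA0 : 0 ≤ A.toReal := ENNReal.toReal_nonneg
  refine ⟨(1 + M * (A.toReal / s)) / 2, by positivity, fun x t ht => ?_⟩
  have hc := hU.continuous_slice ht
  have hw : Continuous fun y => U y t - u y := hc.sub hu
  have e : mollify φ (fun y => U y t) x - mollify φ u x = mollify φ (fun y => U y t - u y) x := by
    unfold mollify
    rw [← integral_sub (integrable_mollify hφ.continuous hφ.hasCompactSupport hc x)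
      (integrable_mollify hφ.continuous hφ.hasCompactSupport hu x)]
    simp only [mul_sub]
  have hts : 0 < t ^ s := Real.rpow_pos_of_pos ht _
  have h1 := mollify_abs_le hφ hw hts x
  have h2 := mollify_sq_le hφ hM hw x
  have h3 : ∫ y in Metric.closedBall x η, (U y t - u y) ^ 2 ≤ t ^ s * t ^ s * (A.toReal / s) := by
    have hK : IsCompact (Metric.closedBall x η) := isCompact_closedBall _ _
    rw [integral_eq_lintegral_of_nonneg_ae (Eventually.of_forall fun y => sq_nonneg _)
      (hw.pow 2).aestronglyMeasurable]
    have h4 := hU.setLIntegral_sq_sub_le hs0 hu hK ht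
    have h5 : t ^ (2 * s) = t ^ s * t ^ s := by rw [← Real.rpow_add ht]; ring_nf
    refine (ENNReal.toReal_mono (ENNReal.mul_ne_top (by simp)
      (ENNReal.mul_ne_top ENNReal.ofReal_ne_top hA)) h4).trans (le_of_eq ?_)
    rw [ENNReal.toReal_mul, ENNReal.toReal_mul, ENNReal.toReal_ofReal (by positivity), h5]
    simp only [ENNReal.toReal_ofNat]
    field_simp
  rw [e]
  calc _ ≤ _ := h1
    _ ≤ (t ^ s + (t ^ s)⁻¹ * (M * (t ^ s * t ^ s * (A.toReal / s)))) / 2 := by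
        have := mul_le_mul_of_nonneg_left (h2.trans (mul_le_mul_of_nonneg_left h3 hM0))
          (inv_nonneg.2 hts.le)
        linarith
    _ = _ := by field_simp

lemma IsCaffarelliSilvestreExtension.continuousOn_mollify {N : ℕ} {s : ℝ} {u : Eucl N → ℝ}
    {U : Eucl N → ℝ → ℝ} (hU : IsCaffarelliSilvestreExtension s u U)
    {φ : Eucl N → ℝ} {η : ℝ} (hφ : IsMollifier φ η) :
    ContinuousOn (fun p : Eucl N × ℝ => mollify φ (fun y => U y p.2) p.1) {p | 0 < p.2} := by
  unfold mollify
  refine continuousOn_integral_of_compact_support (k := Metric.closedBall (0 : Eucl N) η)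
    (isCompact_closedBall _ _) ?_ ?_
  · refine ContinuousOn.mul ?_ ?_
    · have := hφ.continuous
      exact (by fun_prop : Continuous fun q : (Eucl N × ℝ) × Eucl N => φ q.2).continuousOn
    · exact hU.smooth.continuousOn.comp
        (f := fun q : (Eucl N × ℝ) × Eucl N => (q.1.1 + q.2, q.1.2))
        (by fun_prop) fun q hq => hq.1
  · intro p z _ hz
    rw [hφ.eq_zero (by simpa using hz), zero_mul]

/-! ### Potentials of Poisson type -/

/-- Locally uniform decay of the Poisson kernel. -/
lemma rpow_neg_norm_sq_add_le {N : ℕ} {γ t₀ t : ℝ} (hγ : 0 < γ) (ht₀ : 0 < t₀) (ht : t₀ ≤ t)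
    (w : Eucl N) {z : Eucl N} (hz : ‖z‖ ≤ 1) :
    (‖w + z‖ ^ 2 + t ^ 2) ^ (-γ) ≤ (2 / t₀ + 1) ^ (2 * γ) * (1 + ‖w‖) ^ (-(2 * γ)) := by
  have ht0 : 0 < t := ht₀.trans_le ht
  set q := ‖w + z‖ ^ 2 + t ^ 2 with hq
  have hq0 : 0 < q := by positivity
  have hA : 0 < 2 / t₀ + 1 := by positivity
  have h1 : ‖w + z‖ ≤ √q := Real.le_sqrt_of_sq_le (by rw [hq]; nlinarith [sq_nonneg t])
  have h2 : t ≤ √q := Real.le_sqrt_of_sq_le (by rw [hq]; nlinarith [sq_nonneg ‖w + z‖])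
  have h3 : ‖w‖ ≤ ‖w + z‖ + 1 := by
    have := norm_sub_le (w + z) z
    rw [add_sub_cancel_right] at this
    linarith
  have h4 : 2 ≤ 2 / t₀ * √q := by
    rw [div_mul_eq_mul_div, le_div_iff₀ ht₀]
    linarith
  have h5 : 1 + ‖w‖ ≤ (2 / t₀ + 1) * √q := by linarith
  have h6 : (1 + ‖w‖) ^ (2 * γ) ≤ (2 / t₀ + 1) ^ (2 * γ) * q ^ γ := by
    calc (1 + ‖w‖) ^ (2 * γ) ≤ ((2 / t₀ + 1) * √q) ^ (2 * γ) := by gcongr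
      _ = (2 / t₀ + 1) ^ (2 * γ) * q ^ γ := by
        rw [Real.mul_rpow hA.le (Real.sqrt_nonneg q), Real.sqrt_eq_rpow, ← Real.rpow_mul hq0.le]
        ring_nf
  rw [Real.rpow_neg hq0.le, Real.rpow_neg (by positivity), ← div_eq_mul_inv,
    le_div_iff₀ (by positivity), inv_mul_le_iff₀ (by positivity)]
  linarith

lemma integrable_one_add_norm_sub_rpow {N : ℕ} {r : ℝ} (hr : (N : ℝ) < r) (x : Eucl N) :
    Integrable fun y : Eucl N => (1 + ‖x - y‖) ^ (-r) :=
  (integrable_one_add_norm (by simpa using hr)).comp_sub_left x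

/-- Twofold differentiation of a potential `∫ q(τ, y) ^ (-γ) v(y) dy`, where `q` is a monic
quadratic polynomial in `τ`. -/
lemma hasSecondDerivAt_integral_rpow {N : ℕ} {γ m τ₀ r M : ℝ} (hγ : 0 < γ) (hm : 0 < m)
    (hr : 0 < r) {a b D v : Eucl N → ℝ} (ha : Continuous a) (hb : Continuous b)
    (hv : Continuous v) (hM : ∀ y, |v y| ≤ M) (hD : Integrable D)
    (hqm : ∀ y, ∀ τ ∈ Metric.ball τ₀ r, m ≤ a y + 2 * b y * τ + τ ^ 2)
    (hqb : ∀ y, ∀ τ ∈ Metric.ball τ₀ r, (b y + τ) ^ 2 ≤ a y + 2 * b y * τ + τ ^ 2)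
    (hqD : ∀ y, ∀ τ ∈ Metric.ball τ₀ r, (a y + 2 * b y * τ + τ ^ 2) ^ (-γ) ≤ D y) :
    HasSecondDerivAt (fun τ => ∫ y, (a y + 2 * b y * τ + τ ^ 2) ^ (-γ) * v y)
      (∫ y, -(2 * γ) * (b y + τ₀) * (a y + 2 * b y * τ₀ + τ₀ ^ 2) ^ (-γ - 1) * v y)
      (∫ y, (-(2 * γ) * (a y + 2 * b y * τ₀ + τ₀ ^ 2) ^ (-γ - 1) +
        4 * γ * (γ + 1) * (b y + τ₀) ^ 2 * (a y + 2 * b y * τ₀ + τ₀ ^ 2) ^ (-γ - 2)) * v y) τ₀ ∧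
    Integrable (fun y => -(2 * γ) * (b y + τ₀) * (a y + 2 * b y * τ₀ + τ₀ ^ 2) ^ (-γ - 1) * v y) ∧
    Integrable (fun y => (-(2 * γ) * (a y + 2 * b y * τ₀ + τ₀ ^ 2) ^ (-γ - 1) +
        4 * γ * (γ + 1) * (b y + τ₀) ^ 2 * (a y + 2 * b y * τ₀ + τ₀ ^ 2) ^ (-γ - 2)) * v y) := by
  have hM0 : 0 ≤ M := (abs_nonneg _).trans (hM 0)
  set q : ℝ → Eucl N → ℝ := fun τ y => a y + 2 * b y * τ + τ ^ 2 with hq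
  have h0 : τ₀ ∈ Metric.ball τ₀ r := Metric.mem_ball_self hr
  have hq0 : ∀ y, ∀ τ ∈ Metric.ball τ₀ r, 0 < q τ y := fun y τ hτ => hm.trans_le (hqm y τ hτ)
  have hD0 : ∀ y, 0 ≤ D y := fun y => (Real.rpow_nonneg (hq0 y τ₀ h0).le _).trans (hqD y τ₀ h0)
  have hqc : ∀ τ ∈ Metric.ball τ₀ r, ∀ e : ℝ, Continuous fun y => q τ y ^ e := fun τ hτ e =>
    (show Continuous (q τ) by simp only [hq]; fun_prop).rpow_const
      fun y => Or.inl (hq0 y τ hτ).ne'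
  have hq1 : ∀ y, ∀ τ ∈ Metric.ball τ₀ r, q τ y ^ (-γ - 1) * q τ y ≤ D y := fun y τ hτ => by
    rw [← Real.rpow_add_one (hq0 y τ hτ).ne']; simpa using hqD y τ hτ
  have hq2 : ∀ y, ∀ τ ∈ Metric.ball τ₀ r, q τ y ^ (-γ - 1) ≤ D y / m := fun y τ hτ => by
    rw [le_div_iff₀ hm]
    exact (mul_le_mul_of_nonneg_left (hqm y τ hτ) (Real.rpow_nonneg (hq0 y τ hτ).le _)).trans
      (hq1 y τ hτ)
  have hq3 : ∀ y, ∀ τ ∈ Metric.ball τ₀ r, q τ y ^ (-γ - 2) * q τ y = q τ y ^ (-γ - 1) :=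
    fun y τ hτ => by
      rw [← Real.rpow_add_one (hq0 y τ hτ).ne']; ring_nf
  have hb1 : ∀ y, ∀ τ ∈ Metric.ball τ₀ r,
      ‖-(2 * γ) * (b y + τ) * q τ y ^ (-γ - 1) * v y‖ ≤ 2 * γ * (1 / m + 1) * M * D y := by
    intro y τ hτ
    have e1 : |b y + τ| ≤ 1 + q τ y := by
      have := hqb y τ hτ
      rw [← sq_abs] at this
      nlinarith [sq_nonneg (|b y + τ| - 1), hq0 y τ hτ]
    have e2 : |b y + τ| * q τ y ^ (-γ - 1) ≤ (1 / m + 1) * D y := by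
      have := mul_le_mul_of_nonneg_right e1 (Real.rpow_nonneg (hq0 y τ hτ).le (-γ - 1))
      have h4 := hq1 y τ hτ
      have h5 := hq2 y τ hτ
      rw [div_eq_mul_one_div, mul_comm (D y)] at h5
      linarith
    rw [Real.norm_eq_abs, abs_mul, abs_mul, abs_mul, abs_neg, abs_of_pos (by positivity : 0 < 2 * γ),
      abs_of_nonneg (Real.rpow_nonneg (hq0 y τ hτ).le _)]
    calc 2 * γ * |b y + τ| * q τ y ^ (-γ - 1) * |v y|
        = 2 * γ * (|b y + τ| * q τ y ^ (-γ - 1)) * |v y| := by ring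
      _ ≤ 2 * γ * ((1 / m + 1) * D y) * M := by
        have := hM y; have := hD0 y
        gcongr
      _ = _ := by ring
  have hb2 : ∀ y, ∀ τ ∈ Metric.ball τ₀ r,
      ‖(-(2 * γ) * q τ y ^ (-γ - 1) + 4 * γ * (γ + 1) * (b y + τ) ^ 2 * q τ y ^ (-γ - 2)) * v y‖
        ≤ (2 * γ + 4 * γ * (γ + 1)) / m * M * D y := by
    intro y τ hτ
    have p1 := Real.rpow_nonneg (hq0 y τ hτ).le (-γ - 1)
    have p2 := Real.rpow_nonneg (hq0 y τ hτ).le (-γ - 2)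
    have e1 : (b y + τ) ^ 2 * q τ y ^ (-γ - 2) ≤ q τ y ^ (-γ - 1) := by
      rw [← hq3 y τ hτ, mul_comm]
      exact mul_le_mul_of_nonneg_left (hqb y τ hτ) p2
    have e2 : |-(2 * γ) * q τ y ^ (-γ - 1) + 4 * γ * (γ + 1) * (b y + τ) ^ 2 * q τ y ^ (-γ - 2)|
        ≤ (2 * γ + 4 * γ * (γ + 1)) * q τ y ^ (-γ - 1) := by
      have e3 : 0 ≤ (b y + τ) ^ 2 * q τ y ^ (-γ - 2) := by positivity
      have e4 := mul_le_mul_of_nonneg_left e1 (by positivity : 0 ≤ 4 * γ * (γ + 1))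
      have e5 : 0 ≤ 4 * γ * (γ + 1) * ((b y + τ) ^ 2 * q τ y ^ (-γ - 2)) := by positivity
      have e6 : 0 ≤ γ * q τ y ^ (-γ - 1) := by positivity
      rw [abs_le]; constructor <;> nlinarith
    rw [Real.norm_eq_abs, abs_mul]
    calc _ ≤ (2 * γ + 4 * γ * (γ + 1)) * (D y / m) * M :=
          mul_le_mul (e2.trans (mul_le_mul_of_nonneg_left (hq2 y τ hτ) (by positivity))) (hM y)
            (abs_nonneg _) (mul_nonneg (by positivity) (div_nonneg (hD0 y) hm.le))
      _ = _ := by ring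
  have c0 : ∀ τ ∈ Metric.ball τ₀ r, Continuous fun y => q τ y ^ (-γ) * v y :=
    fun τ hτ => (hqc τ hτ _).mul hv
  have c1 : ∀ τ ∈ Metric.ball τ₀ r,
      Continuous fun y => -(2 * γ) * (b y + τ) * q τ y ^ (-γ - 1) * v y := fun τ hτ =>
    ((by fun_prop : Continuous fun y => -(2 * γ) * (b y + τ)).mul (hqc τ hτ _)).mul hv
  have c2 : Continuous fun y => (-(2 * γ) * q τ₀ y ^ (-γ - 1) +
      4 * γ * (γ + 1) * (b y + τ₀) ^ 2 * q τ₀ y ^ (-γ - 2)) * v y :=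
    ((continuous_const.mul (hqc τ₀ h0 _)).add
      ((by fun_prop : Continuous fun y => 4 * γ * (γ + 1) * (b y + τ₀) ^ 2).mul
        (hqc τ₀ h0 _))).mul hv
  have hdq : ∀ y τ, HasDerivAt (fun τ => q τ y) (2 * (b y + τ)) τ := fun y τ => by
    have := (HasSecondDerivAt.quadratic (a y) (2 * b y) 1 τ).hasDerivAt
    simp only [one_mul] at this
    exact this.congr_deriv (by ring)
  have hdq' : ∀ e y, ∀ τ ∈ Metric.ball τ₀ r,
      HasDerivAt (fun τ => q τ y ^ e) (2 * (b y + τ) * e * q τ y ^ (e - 1)) τ := fun e y τ hτ =>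
    (hdq y τ).rpow_const (Or.inl (hq0 y τ hτ).ne')
  refine ⟨HasSecondDerivAt.integral hr (F := fun τ y => q τ y ^ (-γ) * v y)
    (F₁ := fun τ y => -(2 * γ) * (b y + τ) * q τ y ^ (-γ - 1) * v y)
    (F₂ := fun τ y => (-(2 * γ) * q τ y ^ (-γ - 1) +
      4 * γ * (γ + 1) * (b y + τ) ^ 2 * q τ y ^ (-γ - 2)) * v y)
    (fun τ hτ => ?_) (fun τ hτ => (c1 τ hτ).aestronglyMeasurable) c2.aestronglyMeasurable
    (fun y τ hτ => ?_) (fun y τ hτ => ?_) hb1 (hD.const_mul _) hb2 (hD.const_mul _),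
    (hD.const_mul _).mono' (c1 τ₀ h0).aestronglyMeasurable
      (Eventually.of_forall fun y => hb1 y τ₀ h0),
    (hD.const_mul _).mono' c2.aestronglyMeasurable (Eventually.of_forall fun y => hb2 y τ₀ h0)⟩
  · refine (hD.const_mul M).mono' (c0 τ hτ).aestronglyMeasurable (Eventually.of_forall fun y => ?_)
    rw [Real.norm_eq_abs, abs_mul, abs_of_nonneg (Real.rpow_nonneg (hq0 y τ hτ).le _), mul_comm]
    exact mul_le_mul (hM y) (hqD y τ hτ) (Real.rpow_nonneg (hq0 y τ hτ).le _) hM0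
  · exact ((hdq' (-γ) y τ hτ).mul_const (v y)).congr_deriv (by ring)
  · have h1 := (((hasDerivAt_id τ).const_add (b y)).const_mul (-(2 * γ))).mul
      (hdq' (-γ - 1) y τ hτ)
    refine (h1.mul_const (v y)).congr_deriv ?_
    rw [show -γ - 1 - 1 = -γ - 2 by ring]
    simp only [id]
    ring

/-- The potential of a bounded density with kernel `(|x-y|² + t²)^(-(N+2s)/2)` solves the equation
with the conjugate weight `t ^ (1 + 2s)`. -/
lemma hasWeightedLaplacianAt_potential {N : ℕ} {s : ℝ} (hs0 : 0 < s) {v : Eucl N → ℝ}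
    (hv : Continuous v) {M : ℝ} (hM : ∀ y, |v y| ≤ M) (x : Eucl N) {t : ℝ} (ht : 0 < t) :
    HasWeightedLaplacianAt (1 + 2 * s)
      (fun x t => ∫ y, (‖x - y‖ ^ 2 + t ^ 2) ^ (-(((N : ℝ) + 2 * s) / 2)) * v y) x t 0 := by
  set γ := ((N : ℝ) + 2 * s) / 2 with hγ
  have hγ0 : 0 < γ := by positivity
  have hD : ∀ C : ℝ, Integrable fun y : Eucl N => C * (1 + ‖x - y‖) ^ (-(2 * γ)) := fun C =>
    (integrable_one_add_norm_sub_rpow (by rw [hγ]; linarith) x).const_mul C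
  -- horizontal slices
  have hx := fun i : Fin N => hasSecondDerivAt_integral_rpow (N := N) (τ₀ := 0) hγ0
    (show 0 < t ^ 2 by positivity) one_pos
    (a := fun y => ‖x - y‖ ^ 2 + t ^ 2) (b := fun y => (x - y) i) (v := v)
    (by fun_prop) (by fun_prop) hv hM (hD ((2 / t + 1) ^ (2 * γ)))
  have hq : ∀ (i : Fin N) (y : Eucl N) (τ : ℝ), ‖x - y‖ ^ 2 + t ^ 2 + 2 * (x - y) i * τ + τ ^ 2
      = ‖x - y + τ • EuclideanSpace.single i (1 : ℝ)‖ ^ 2 + t ^ 2 := fun i y τ => by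
    rw [HasWeightedLaplacianAt.norm_add_smul_single_sq]; ring
  have hx' := fun i => hx i (fun y τ _ => by
      rw [hq]; nlinarith [sq_nonneg ‖x - y + τ • EuclideanSpace.single i (1 : ℝ)‖])
    (fun y τ _ => by
      have : (x - y) i ^ 2 ≤ ‖x - y‖ ^ 2 := by
        rw [EuclideanSpace.real_norm_sq_eq]
        exact Finset.single_le_sum (f := fun i => (x - y) i ^ 2) (fun j _ => sq_nonneg _)
          (Finset.mem_univ i)
      nlinarith [sq_nonneg t])
    (fun y τ hτ => by
      rw [hq]
      refine rpow_neg_norm_sq_add_le hγ0 ht le_rfl _ ?_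
      rw [norm_smul]
      simpa using (mem_ball_zero_iff.1 hτ).le)
  -- vertical slice
  have hbt : ∀ τ ∈ Metric.ball t (t / 2), t / 2 ≤ τ := fun τ hτ => by
    rw [Metric.mem_ball, Real.dist_eq, abs_lt] at hτ; linarith
  have ht' := hasSecondDerivAt_integral_rpow (N := N) (τ₀ := t) (r := t / 2) hγ0
    (show 0 < (t / 2) ^ 2 by positivity) (by positivity)
    (a := fun y => ‖x - y‖ ^ 2) (b := fun _ => 0) (v := v)
    (by fun_prop) (by fun_prop) hv hM (hD ((2 / (t / 2) + 1) ^ (2 * γ)))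
    (fun y τ hτ => by
      have := pow_le_pow_left₀ (by positivity) (hbt τ hτ) 2
      nlinarith [sq_nonneg ‖x - y‖])
    (fun y τ _ => by nlinarith [sq_nonneg ‖x - y‖])
    (fun y τ hτ => by
      have := rpow_neg_norm_sq_add_le (N := N) hγ0 (by positivity : 0 < t / 2) (hbt τ hτ) (x - y)
        (z := 0) (by simp)
      simpa using this)
  refine ⟨_, _, _, _, fun i => (hx' i).1.congr (Eventually.of_forall fun τ => ?_),
    ht'.1.congr (Eventually.of_forall fun τ => ?_), ?_⟩
  · simp only [hq]
    congr 1; funext y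
    rw [show x + τ • EuclideanSpace.single i (1 : ℝ) - y
      = x - y + τ • EuclideanSpace.single i (1 : ℝ) by abel]
  · simp
  · have i1 := integrable_finsetSum Finset.univ fun i (_ : i ∈ Finset.univ) => (hx' i).2.2
    rw [← integral_finsetSum _ fun i _ => (hx' i).2.2, ← integral_const_mul,
      ← integral_add i1 ht'.2.2]
    refine Eq.trans ?_ (integral_add (i1.add ht'.2.2) (ht'.2.1.const_mul _))
    refine (integral_eq_zero_of_ae (Eventually.of_forall fun y => ?_)).symm
    have hs : ∑ i : Fin N, (x - y) i ^ 2 = ‖x - y‖ ^ 2 :=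
      (EuclideanSpace.real_norm_sq_eq _).symm
    simp only [mul_zero, zero_mul, add_zero, zero_add, ne_eq, OfNat.ofNat_ne_zero,
      not_false_eq_true, zero_pow, Pi.zero_apply]
    set q := ‖x - y‖ ^ 2 + t ^ 2 with hqd
    have hq0 : 0 < q := by positivity
    have e1 : q ^ (-γ - 1) = q ^ (-γ - 2) * q := by
      rw [← Real.rpow_add_one hq0.ne']; ring_nf
    have e2 : ∑ i : Fin N, (-(2 * γ) * q ^ (-γ - 1) +
        4 * γ * (γ + 1) * (x - y) i ^ 2 * q ^ (-γ - 2)) * v y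
        = (-(2 * γ) * N * q ^ (-γ - 1) + 4 * γ * (γ + 1) * ‖x - y‖ ^ 2 * q ^ (-γ - 2)) * v y := by
      rw [← Finset.sum_mul, Finset.sum_add_distrib, ← hs, Finset.mul_sum, Finset.sum_mul]
      simp only [Finset.sum_const, Finset.card_univ, Fintype.card_fin, nsmul_eq_mul]
      ring
    rw [e2, e1]
    have e3 : ‖x - y‖ ^ 2 = q - t ^ 2 := by rw [hqd]; ring
    rw [e3, show (N : ℝ) = 2 * γ - 2 * s by rw [hγ]; ring]
    field_simp
    ring

/-! ### Domination by the Poisson integral -/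

/-- The Poisson kernel of height one for the weight `t ^ (1 - 2s)`, up to normalization. -/
noncomputable def poissonWeight {N : ℕ} (s : ℝ) (z : Eucl N) : ℝ :=
  (1 + ‖z‖ ^ 2) ^ (-(((N : ℝ) + 2 * s) / 2))

lemma poissonWeight_pos {N : ℕ} (s : ℝ) (z : Eucl N) : 0 < poissonWeight s z :=
  Real.rpow_pos_of_pos (by positivity) _

lemma continuous_poissonWeight {N : ℕ} (s : ℝ) : Continuous (poissonWeight (N := N) s) :=
  (by fun_prop : Continuous fun z : Eucl N => 1 + ‖z‖ ^ 2).rpow_const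
    fun z => Or.inl (by positivity)

lemma integrable_poissonWeight {N : ℕ} {s : ℝ} (hs0 : 0 < s) :
    Integrable (poissonWeight (N := N) s) := by
  have := integrable_rpow_neg_one_add_norm_sq (E := Eucl N) (μ := volume)
    (r := (N : ℝ) + 2 * s) (by simpa using hs0)
  simp only [neg_div] at this
  exact this

lemma integral_poissonWeight_pos {N : ℕ} {s : ℝ} (hs0 : 0 < s) :
    0 < ∫ z : Eucl N, poissonWeight s z := by
  rw [integral_pos_iff_support_of_nonneg (fun z => (poissonWeight_pos s z).le)
    (integrable_poissonWeight hs0)]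
  have : Function.support (poissonWeight (N := N) s) = univ :=
    eq_univ_of_forall fun z => (poissonWeight_pos s z).ne'
  rw [this]
  exact isOpen_univ.measure_pos volume univ_nonempty

lemma norm_poissonWeight_mul_le {N : ℕ} {s : ℝ} {v : Eucl N → ℝ} {M : ℝ} (hM : ∀ y, |v y| ≤ M)
    (z y : Eucl N) : ‖poissonWeight s z * v y‖ ≤ poissonWeight s z * M := by
  rw [norm_mul, Real.norm_of_nonneg (poissonWeight_pos s z).le]
  exact mul_le_mul_of_nonneg_left (hM y) (poissonWeight_pos s z).le

/-- The Poisson integral of a bounded continuous function is continuous up to the boundary. -/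
lemma continuous_integral_poissonWeight_mul {N : ℕ} {s : ℝ} (hs0 : 0 < s) {v : Eucl N → ℝ}
    (hv : Continuous v) {M : ℝ} (hM : ∀ y, |v y| ≤ M) :
    Continuous fun p : Eucl N × ℝ => ∫ z, poissonWeight s z * v (p.1 - p.2 • z) := by
  have hk := continuous_poissonWeight (N := N) s
  refine continuous_of_dominated (fun p => ?_) (fun p => ?_)
    ((integrable_poissonWeight hs0).mul_const M) ?_
  · exact (hk.mul (hv.comp (by fun_prop))).aestronglyMeasurable
  · exact Eventually.of_forall fun z => norm_poissonWeight_mul_le hM z _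
  · exact Eventually.of_forall fun z => continuous_const.mul (hv.comp (by fun_prop))

lemma abs_integral_poissonWeight_mul_le {N : ℕ} {s : ℝ} (hs0 : 0 < s) {v : Eucl N → ℝ} {M : ℝ}
    (hM : ∀ y, |v y| ≤ M) (x : Eucl N) (t : ℝ) :
    |∫ z, poissonWeight s z * v (x - t • z)| ≤ (∫ z : Eucl N, poissonWeight s z) * M := by
  rw [← integral_mul_const, ← Real.norm_eq_abs]
  exact norm_integral_le_of_norm_le ((integrable_poissonWeight hs0).mul_const M)
    (Eventually.of_forall fun z => norm_poissonWeight_mul_le hM z _)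

/-- Change of variables `y = x - t z` in the Poisson integral. -/
lemma integral_poissonWeight_mul_eq {N : ℕ} {s : ℝ} (v : Eucl N → ℝ) (x : Eucl N) {t : ℝ}
    (ht : 0 < t) :
    ∫ z, poissonWeight s z * v (x - t • z)
      = t ^ (2 * s) * ∫ y, (‖x - y‖ ^ 2 + t ^ 2) ^ (-(((N : ℝ) + 2 * s) / 2)) * v y := by
  set γ := ((N : ℝ) + 2 * s) / 2 with hγ
  have h1 : ∀ z : Eucl N, poissonWeight s z * v (x - t • z)
      = t ^ (2 * γ) * ((‖t • z‖ ^ 2 + t ^ 2) ^ (-γ) * v (x - t • z)) := fun z => by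
    have e1 : ‖t • z‖ ^ 2 + t ^ 2 = t ^ 2 * (1 + ‖z‖ ^ 2) := by
      rw [norm_smul, Real.norm_of_nonneg ht.le]; ring
    have e2 : t ^ (2 * γ) * (t ^ 2) ^ (-γ) = 1 := by
      rw [← Real.rpow_natCast, ← Real.rpow_mul ht.le, ← Real.rpow_add ht]
      norm_num
    rw [e1, Real.mul_rpow (by positivity) (by positivity), ← mul_assoc, ← mul_assoc, e2, one_mul]
    rfl
  calc ∫ z, poissonWeight s z * v (x - t • z)
      = t ^ (2 * γ) * ∫ z, (fun w => (‖w‖ ^ 2 + t ^ 2) ^ (-γ) * v (x - w)) (t • z) := by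
        rw [← integral_const_mul]; exact integral_congr_ae (Eventually.of_forall h1)
    _ = t ^ (2 * γ) * ((t ^ N)⁻¹ * ∫ w, (‖w‖ ^ 2 + t ^ 2) ^ (-γ) * v (x - w)) := by
        rw [Measure.integral_comp_smul volume
          (fun w : Eucl N => (‖w‖ ^ 2 + t ^ 2) ^ (-γ) * v (x - w)) t]
        simp only [finrank_euclideanSpace, Fintype.card_fin, smul_eq_mul]
        rw [abs_of_pos (by positivity)]
    _ = t ^ (2 * s) * ∫ w, (‖w‖ ^ 2 + t ^ 2) ^ (-γ) * v (x - w) := by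
        rw [← mul_assoc, ← Real.rpow_natCast, ← Real.rpow_neg ht.le, ← Real.rpow_add ht]
        congr 2; rw [hγ]; ring
    _ = _ := by
        rw [← integral_sub_left_eq_self (fun w => (‖w‖ ^ 2 + t ^ 2) ^ (-γ) * v (x - w)) volume x]
        simp only [sub_sub_cancel]

/-- The mollified extension is dominated by the Poisson integral of the mollified datum. -/
lemma IsCaffarelliSilvestreExtension.mollify_le_poisson {N : ℕ} {s : ℝ} (hs0 : 0 < s) (hs1 : s < 1)
    {u : Eucl N → ℝ} (hu : Continuous u) (hu2 : MemLp u 2 volume) {U : Eucl N → ℝ → ℝ}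
    (hU : IsCaffarelliSilvestreExtension s u U) {φ : Eucl N → ℝ} {η : ℝ} (hφ : IsMollifier φ η)
    (x : Eucl N) {t : ℝ} (ht : 0 < t) :
    (∫ z : Eucl N, poissonWeight s z) * mollify φ (fun y => U y t) x
      ≤ t ^ (2 * s) *
        ∫ y, (‖x - y‖ ^ 2 + t ^ 2) ^ (-(((N : ℝ) + 2 * s) / 2)) * mollify φ u y := by
  set c := ∫ z : Eucl N, poissonWeight s z
  have hc : 0 < c := integral_poissonWeight_pos hs0
  set v := mollify φ u
  have hv : Continuous v := continuous_mollify hφ hu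
  obtain ⟨M, hM0, hM⟩ := exists_abs_mollify_le hφ hu hu2
  obtain ⟨C, hC0, hC⟩ := hU.exists_abs_mollify_sub_le hs0 hu hφ
  set P : Eucl N → ℝ → ℝ := fun x t => ∫ z, poissonWeight s z * v (x - t • z) with hP
  have hPc : Continuous fun p : Eucl N × ℝ => P p.1 p.2 :=
    continuous_integral_poissonWeight_mul hs0 hv hM
  have hPe : ∀ x t, 0 < t → P x t = t ^ (2 * s) *
      ∫ y, (‖x - y‖ ^ 2 + t ^ 2) ^ (-(((N : ℝ) + 2 * s) / 2)) * v y := fun x t ht =>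
    integral_poissonWeight_mul_eq v x ht
  have hP0 : ∀ x, P x 0 = c * v x := fun x => by
    simp only [hP, zero_smul, sub_zero]; rw [integral_mul_const]
  have hPM : ∀ x t, |P x t| ≤ c * M := abs_integral_poissonWeight_mul_le hs0 hM
  rw [← hPe x t ht, ← sub_nonpos]
  refine nonpos_of_hasWeightedLaplacianAt hs0 hs1 (C := c * C + 2 * (c * M))
    (W := fun x t => c * mollify φ (fun y => U y t) x - P x t) (by positivity) ?_ ?_ ?_ ?_ x t ht
  · exact (continuousOn_const.mul (hU.continuousOn_mollify hφ)).sub hPc.continuousOn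
  · intro x t ht
    have h1 := ((hasWeightedLaplacianAt_potential hs0 hv hM x ht).rpow_mul ht)
    have h2 := (hU.hasWeightedLaplacianAt_mollify hφ x ht).const_mul c
    have h3 := h2.sub h1
    rw [mul_zero, sub_zero] at h3
    refine h3.congr_of_pos ht fun x t ht => ?_
    rw [hPe x t ht]
  · intro x t ht
    have h1 := (abs_le.1 (hC x t ht)).2
    have h2 := (abs_le.1 (hPM x t)).1
    have h3 := mul_le_mul_of_nonneg_left (show mollify φ (fun y => U y t) x ≤ C * t ^ s + M by
      linarith [(abs_le.1 (hM x)).2]) hc.le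
    have h4 : 0 ≤ t ^ s := Real.rpow_nonneg ht.le _
    have h5 : 0 ≤ c * M := by positivity
    have h6 : 0 ≤ c * C := by positivity
    nlinarith [mul_nonneg h5 h4]
  · intro R ζ hζ
    have h1 : ∀ᶠ t : ℝ in 𝓝 0, ∀ x ∈ Metric.closedBall (0 : Eucl N) R, c * v x - P x t < ζ / 2 := by
      refine (isCompact_closedBall _ _).eventually_forall_of_forall_eventually fun x _ => ?_
      have h2 : Continuous fun p : ℝ × Eucl N => c * v p.2 - P p.2 p.1 := by
        have := hPc.comp (continuous_snd.prodMk continuous_fst : Continuous fun p : ℝ × Eucl N =>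
          (p.2, p.1))
        exact (continuous_const.mul (hv.comp continuous_snd)).sub this
      refine h2.continuousAt.eventually_lt continuousAt_const ?_
      simp only [hP0]; linarith
    have h2 : ∀ᶠ t : ℝ in 𝓝 0, c * (C * t ^ s) < ζ / 2 := by
      have : Continuous fun t : ℝ => c * (C * t ^ s) :=
        continuous_const.mul (continuous_const.mul
          (continuous_id.rpow_const fun _ => Or.inr hs0.le))
      refine this.continuousAt.eventually_lt continuousAt_const ?_
      rw [Real.zero_rpow hs0.ne']; simpa using hζ
    filter_upwards [nhdsWithin_le_nhds h1, nhdsWithin_le_nhds h2, self_mem_nhdsWithin]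
      with t ht1 ht2 ht0 x hx
    have h3 := mul_le_mul_of_nonneg_left ((abs_le.1 (hC x t ht0)).2) hc.le
    have h4 := ht1 x hx
    rw [mul_sub] at h3
    linarith

/-- The majorant of the Poisson kernel is square integrable. -/
lemma memLp_two_rpow_neg_norm {N : ℕ} {r : ℝ} (hr : (N : ℝ) < r) (x : Eucl N) :
    MemLp (fun y : Eucl N => (1 + ‖x - y‖) ^ (-r)) 2 volume := by
  have hc : Continuous fun y : Eucl N => (1 + ‖x - y‖) ^ (-r) :=
    (by fun_prop : Continuous fun y : Eucl N => 1 + ‖x - y‖).rpow_const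
      fun y => Or.inl (by positivity)
  rw [memLp_two_iff_integrable_sq hc.aestronglyMeasurable]
  have hN : (0 : ℝ) ≤ N := Nat.cast_nonneg N
  refine (integrable_one_add_norm_sub_rpow (show (N : ℝ) < 2 * r by linarith) x).congr
    (Eventually.of_forall fun y => ?_)
  simp only
  rw [← Real.rpow_mul_natCast (by positivity)]
  congr 1; push_cast; ring

/-- The extension is dominated by the Poisson integral of its boundary values. -/
lemma IsCaffarelliSilvestreExtension.le_poisson {N : ℕ} {s : ℝ} (hs0 : 0 < s) (hs1 : s < 1)
    {u : Eucl N → ℝ} (hu : Continuous u) (hu2 : MemLp u 2 volume) {U : Eucl N → ℝ → ℝ}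
    (hU : IsCaffarelliSilvestreExtension s u U) (x : Eucl N) {t : ℝ} (ht : 0 < t) :
    (∫ z : Eucl N, poissonWeight s z) * U x t
      ≤ t ^ (2 * s) * ∫ y, u y / (‖x - y‖ ^ 2 + t ^ 2) ^ (((N : ℝ) + 2 * s) / 2) := by
  set c := ∫ z : Eucl N, poissonWeight s z
  have hc : 0 < c := integral_poissonWeight_pos hs0
  set γ := ((N : ℝ) + 2 * s) / 2 with hγ
  have hγ0 : 0 < γ := by positivity
  set k : Eucl N → ℝ := fun y => (‖x - y‖ ^ 2 + t ^ 2) ^ (-γ) with hk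
  have hkc : ∀ z : Eucl N, Continuous fun y => (‖x - y + z‖ ^ 2 + t ^ 2) ^ (-γ) := fun z =>
    (by fun_prop : Continuous fun y : Eucl N => ‖x - y + z‖ ^ 2 + t ^ 2).rpow_const
      fun y => Or.inl (by positivity)
  have hkc0 : Continuous k := by simpa using hkc 0
  have hN : (N : ℝ) < 2 * γ := by rw [hγ]; linarith
  set D : Eucl N → ℝ := fun y => (2 / t + 1) ^ (2 * γ) * (1 + ‖x - y‖) ^ (-(2 * γ)) with hD
  have hD2 : MemLp D 2 volume := (memLp_two_rpow_neg_norm hN x).const_mul _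
  have hkD : ∀ z y : Eucl N, ‖z‖ ≤ 1 → ‖(‖x - y + z‖ ^ 2 + t ^ 2) ^ (-γ)‖ ≤ D y :=
    fun z y hz => by
      rw [Real.norm_of_nonneg (by positivity)]
      exact rpow_neg_norm_sq_add_le hγ0 ht le_rfl _ hz
  have hk2 : MemLp k 2 volume := hD2.mono' hkc0.aestronglyMeasurable
    (Eventually.of_forall fun y => by simpa using hkD 0 y (by simp))
  set H : Eucl N → ℝ := fun z => ∫ y, u (y + z) * k y with hH
  have hHe : H = fun z => ∫ y, u y * (‖x - y + z‖ ^ 2 + t ^ 2) ^ (-γ) := by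
    funext z
    rw [hH, ← integral_add_right_eq_self (fun y => u y * (‖x - y + z‖ ^ 2 + t ^ 2) ^ (-γ)) z]
    refine integral_congr_ae (Eventually.of_forall fun y => ?_)
    simp only [hk]
    rw [show x - (y + z) + z = x - y by abel]
  have hHc : ContinuousAt H 0 := by
    rw [hHe]
    refine continuousAt_of_dominated (bound := fun y => ‖u y‖ * D y) ?_ ?_
      (hu2.norm.integrable_mul hD2) ?_
    · exact Eventually.of_forall fun z => (hu.mul (hkc z)).aestronglyMeasurable
    · filter_upwards [Metric.ball_mem_nhds (0 : Eucl N) one_pos] with z hz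
      refine Eventually.of_forall fun y => ?_
      rw [norm_mul]
      exact mul_le_mul_of_nonneg_left (hkD z y (mem_ball_zero_iff.1 hz).le) (norm_nonneg _)
    · refine Eventually.of_forall fun y => Continuous.continuousAt ?_
      exact continuous_const.mul ((by fun_prop : Continuous fun z : Eucl N =>
        ‖x - y + z‖ ^ 2 + t ^ 2).rpow_const fun z => Or.inl (by positivity))
  have hH0 : H 0 = ∫ y, u y / (‖x - y‖ ^ 2 + t ^ 2) ^ γ := by
    simp only [hH, add_zero, hk]
    refine integral_congr_ae (Eventually.of_forall fun y => ?_)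
    simp only
    rw [Real.rpow_neg (by positivity), div_eq_mul_inv]
  rw [← hH0]
  have hUc : Continuous fun z => U (x + z) t :=
    (hU.continuous_slice ht).comp (by fun_prop : Continuous fun z : Eucl N => x + z)
  -- let the radius of the mollifying kernel tend to zero
  have key : ∀ ε : ℝ, 0 < ε → c * (U x t - ε) ≤ t ^ (2 * s) * (H 0 + ε) := by
    intro ε hε
    have e1 : ∀ᶠ z in 𝓝 (0 : Eucl N), H z < H 0 + ε :=
      hHc.eventually_lt continuousAt_const (by linarith)
    have e2 : ∀ᶠ z in 𝓝 (0 : Eucl N), U x t - ε < U (x + z) t :=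
      continuousAt_const.eventually_lt hUc.continuousAt (by simpa using hε)
    obtain ⟨d, hd, hdz⟩ := Metric.eventually_nhds_iff.1 (e1.and e2)
    obtain ⟨φ, hφ⟩ := exists_isMollifier N (half_pos hd)
    have hz : ∀ z : Eucl N, ‖z‖ ≤ d / 2 → dist z 0 < d := fun z hz => by
      rw [dist_zero_right]; linarith
    have h1 := hU.mollify_le_poisson hs0 hs1 hu hu2 hφ x ht
    have h2 : U x t - ε ≤ mollify φ (fun y => U y t) x :=
      le_mollify hφ (hU.continuous_slice ht) fun z hz' => (hdz (hz z hz')).2.le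
    obtain ⟨-, i1, i2⟩ := integral_mollify_mul hφ hu hu2 hkc0.measurable hk2
    have h3 : ∫ z, φ z * H z ≤ H 0 + ε := by
      calc ∫ z, φ z * H z ≤ ∫ z, φ z * (H 0 + ε) := by
            refine integral_mono i1 ((hφ.continuous.integrable_of_hasCompactSupport
              hφ.hasCompactSupport).mul_const _) fun z => ?_
            rcases le_or_gt ‖z‖ (d / 2) with hz' | hz'
            · exact mul_le_mul_of_nonneg_left (hdz (hz z hz')).1.le (hφ.nonneg z)
            · simp [hφ.eq_zero hz']
        _ = H 0 + ε := by rw [integral_mul_const, hφ.integral_eq, one_mul]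
    have h4 : ∫ y, (‖x - y‖ ^ 2 + t ^ 2) ^ (-γ) * mollify φ u y = ∫ z, φ z * H z := by
      rw [← i2]; simp only [mul_comm, hk]
    rw [h4] at h1
    calc _ ≤ _ := mul_le_mul_of_nonneg_left h2 hc.le
      _ ≤ _ := h1
      _ ≤ _ := mul_le_mul_of_nonneg_left h3 (Real.rpow_nonneg ht.le _)
  have hts : 0 < c + t ^ (2 * s) := by positivity
  refine le_of_forall_pos_lt_add fun ε hε => ?_
  have h5 := key (ε / 2 / (c + t ^ (2 * s))) (by positivity)
  have h6 : (c + t ^ (2 * s)) * (ε / 2 / (c + t ^ (2 * s))) = ε / 2 := mul_div_cancel₀ _ hts.ne'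
  linarith

/-! ### Hopf's lemma from the extension -/

/-- Positivity of the lower limit of `U(x₀, t) / t ^ (2s)` forces positive far mass at `x₀`. -/
lemma IsCaffarelliSilvestreExtension.hasFarMass {N : ℕ} (hN : 1 ≤ N) {s : ℝ} (hs0 : 0 < s)
    (hs1 : s < 1) {u : Eucl N → ℝ} (hu : Continuous u) (hu2 : MemLp u 2 volume)
    {U : Eucl N → ℝ → ℝ} (hU : IsCaffarelliSilvestreExtension s u U) {x₀ : Eucl N}
    (hux : u x₀ = 0) {δ : ℝ} (hδ : 0 < δ) (hnonneg : ∀ x ∈ Metric.ball x₀ δ, 0 ≤ u x)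
    (h : 0 < liminf (fun t : ℝ => (((U x₀ t - U x₀ 0) / t ^ (2 * s) : ℝ) : EReal)) (𝓝[>] 0)) :
    HasFarMass s u x₀ := by
  obtain ⟨a, ha0, ha⟩ := EReal.lt_iff_exists_real_btwn.1 h
  have ha0' : 0 < a := by exact_mod_cast ha0
  have hc := integral_poissonWeight_pos (N := N) hs0
  set c := ∫ z : Eucl N, poissonWeight s z
  refine hasFarMass_of_poisson hN hs0 hu hu2 hδ hnonneg (mul_pos hc ha0') ?_
  filter_upwards [eventually_lt_of_lt_liminf ha, self_mem_nhdsWithin] with t ht ht0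
  have ht0' : 0 < t := ht0
  have hp : 0 < t ^ (2 * s) := Real.rpow_pos_of_pos ht0' _
  have ht1 : a < (U x₀ t - U x₀ 0) / t ^ (2 * s) := by exact_mod_cast ht
  rw [hU.boundary, hux, sub_zero, lt_div_iff₀ hp] at ht1
  have h1 := hU.le_poisson hs0 hs1 hu hu2 x₀ ht0'
  refine le_of_mul_le_mul_left ?_ hp
  calc t ^ (2 * s) * (c * a) = c * (a * t ^ (2 * s)) := by ring
    _ ≤ c * U x₀ t := mul_le_mul_of_nonneg_left ht1.le hc.le
    _ ≤ _ := h1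

end FractionalHopf

theorem mainTheorem1 (N : ℕ) (hN : 1 ≤ N) (s : ℝ) (hs : s ∈ Ioo (0 : ℝ) 1)
    (Ω : Set (Eucl N)) (hΩ : IsOpen Ω)
    (c : Eucl N → ℝ) (hc : MemLp c ⊤ (volume.restrict Ω))
    (u : Eucl N → ℝ) (hu : MemHsZero s Ω u) (hu_cont : Continuous u)
    (hu_super : IsWeakSupersolution s Ω (fun x => c x * u x) (fun _ => 0) u)
    (hu_zero : ∀ x, x ∉ Ω → u x = 0)
    (x₀ : Eucl N) (hx₀ : x₀ ∈ frontier Ω)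
    (hball : ∃ (y₀ : Eucl N) (R : ℝ), IsInteriorBall Ω x₀ y₀ R)
    (hnonneg : ∃ δ : ℝ, 0 < δ ∧ ∀ x ∈ Metric.ball x₀ δ, 0 ≤ u x)
    (U : Eucl N → ℝ → ℝ) (hU : IsCaffarelliSilvestreExtension s u U)
    (hHopf : 0 < liminf
      (fun t : ℝ => (((U x₀ t - U x₀ 0) / t ^ (2 * s) : ℝ) : EReal)) (𝓝[>] 0)) :
    SatisfiesHopfLemma s Ω u x₀ := by
  have hx : x₀ ∉ Ω := (hΩ.frontier_eq ▸ hx₀).2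
  obtain ⟨δ, hδ, hpos⟩ := hnonneg
  exact satisfiesHopfLemma_of_hasFarMass hN hs.1 hs.2 hc hu_cont hu_super hx hδ hpos
    (hU.hasFarMass hN hs.1 hs.2 hu_cont hu.1.1 (hu_zero x₀ hx) hδ hpos hHopf)
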